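/- Let $\tilde{\mathbb O}=\mathbb H^2$ be the split octonions, with product $(a,b)(c,d)=(ac+\bar d b,\;da+b\bar c)$, conjugation $\overline{(a,b)}=(\bar a,-b)$ and inner product $\langle x,y\rangle=\mathrm{Re}(x\bar y)$. Let $V=\mathrm{Im}\,\mathbb H\oplus\mathbb H$ be the imaginary split octonions, $G_2=\mathrm{Aut}(\tilde{\mathbb O})\subset GL(\tilde{\mathbb O})$, and $$C=\{\mathbb R^+x : x\in V,\ x\neq 0,\ \langle x,x\rangle=0\}$$ the space of null rays, a submanifold of the space of rays of $V$. For $x\in V$ put $x^0=\{y\in V: xy=0\}$. Let $K\subset G_2$ be the image of $SU(2)\times SU(2)$ (pairs of unit quaternions) acting by $(q_1,q_2)\cdot(a,b)=(q_1a\bar q_1,\;q_2b\bar q_1)$. For a ball of radius $r$ rolling on a fixed ball of radius $R$, with $\rho=R/r$, the rolling distribution on $Q=SO_3\times S^2$ is the rank-$2$ distribution of those velocities $(\dot g,\dot{\mathbf x})$ at $(g,\mathbf x)$ for which the angular velocity $\omega$, given by $\dot g=\omega\times g$, satisfies $(\rho+1)\dot{\mathbf x}=\omega\times\mathbf x$ and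 $\langle\omega,\mathbf x\rangle=0$; it is invariant under the action $(g',g'')\cdot(g,\mathbf x)=(g'gg''^{-1},g'\mathbf x)$ of $SO_3\times SO_3$. The data of a $G$-homogeneous distribution $(M,D)$ at a base point $m_0$ are its isotropy group, with Lie algebra $\mathfrak h$, and the subspace $W\subset\mathfrak g/\mathfrak h\cong T_{m_0}M$ corresponding to $D_{m_0}$. Then: 1. $G_2$ is a closed linear group, whose Lie algebra $\mathfrak g_2$ is the algebra of derivations of $\tilde{\mathbb O}$. It acts continuously, transitively and by diffeomorphisms on $C$, and $C$ is diffeomorphic to $S^3\times S^2$. 2. The images $D_{[x]}\subset T_{[x]}C$ of the subspaces $x^0$ form a smooth $G_2$-invariant distribution $D$ of rank $2$ on $C$. 3. $K$ is a maximal compact subgroup of $G_2$, the kernel of $SU(2)\times SU(2)\to K$ is $\{\pm(1,1)\}$, and $K$ acts transitively on $C$. 4. There is a base point $c_0\in C$ with the following two properties. (a) $\mathfrak g_2$ is the split real form of type $G_2$: it is semisimple of dimension $14$ and has a Cartan subalgebra $\mathfrak t$ of dimension $2$ with one-dimensional root spaces for the roots $\pm\sigma_1,\pm\sigma_2,\pm\sigma_3$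 (short) and $\pm\lambda_1,\pm\lambda_2,\pm\lambda_3$ (long), where $\sigma_1=\sigma_2+\sigma_3$, $\lambda_1=\sigma_2-\sigma_3$, $\lambda_2=\sigma_1+\sigma_3$, $\lambda_3=\sigma_1+\sigma_2$ and $\sigma_2,\sigma_3$ are linearly independent. These can be chosen so that the data of $(C,D)$ at $c_0$ are $(G_2,P,W)$: $\mathfrak p$ is the span of $\mathfrak t$ and of the root spaces of $-\sigma_1,\sigma_2,-\sigma_3,\lambda_1,-\lambda_2,\lambda_3,-\lambda_3$; $P$, the connected subgroup generated by $\exp\mathfrak p$, is the isotropy group of $c_0$, with Lie algebra $\mathfrak p$; and $W\subset\mathfrak g_2/\mathfrak p$ is spanned by the root spaces of $\sigma_1$ and $-\sigma_2$. (b) Viewed as a $K$-homogeneous space, $(C,D)$ has at $c_0$ the same Lie algebraic data as the rolling distribution at $(1,\mathbf e_3)$, both for $R=3r$ and for $r=3R$: in each case some Lie algebra isomorphism $\mathfrak{so}_3\oplus\mathfrak{so}_3\to\mathfrak k$ matches the isotropy algebras and the planes. 5. If $R=3r$ or $r=3R$, there is a smooth two-to-one covering map $\pi:C\to SO_3\times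 S^2$ with injective differential, whose fibres are the orbits of the image of $(-1,1)$ in $K$, such that $d\pi_c(D_c)$ is the plane of the rolling distribution at $\pi(c)$ for every $c\in C$. It is equivariant for the double covers $SU(2)\to SO_3$, where $(q_1,q_2)$ acts on $SO_3\times S^2$ through $(g',g'')$ with $g',g''$ the rotations given by $q_1,q_2$ if $R=3r$, and by $q_2,q_1$ if $r=3R$. -/

import Mathlib

open scoped Manifold ContDiff Quaternion Matrix Topology

noncomputable section

/-! ### The split octonions -/

/-- The split octonions: pairs of quaternions (with the product topology and linear structure). -/
def SplitOct : Type := ℍ[ℝ] × ℍ[ℝ]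

namespace SplitOct

instance : NormedAddCommGroup SplitOct := inferInstanceAs (NormedAddCommGroup (ℍ[ℝ] × ℍ[ℝ]))

instance : NormedSpace ℝ SplitOct := inferInstanceAs (NormedSpace ℝ (ℍ[ℝ] × ℍ[ℝ]))

instance : FiniteDimensional ℝ SplitOct :=
  inferInstanceAs (FiniteDimensional ℝ (ℍ[ℝ] × ℍ[ℝ]))

/-- The product `(a,b)(c,d) = (ac + d̄b, da + bc̄)`. -/
instance : Mul SplitOct :=
  ⟨fun x y => (x.1 * y.1 + star y.2 * x.2, y.2 * x.1 + x.2 * star y.1)⟩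

/-- The unit `(1,0)`. -/
instance : One SplitOct := ⟨((1, 0) : ℍ[ℝ] × ℍ[ℝ])⟩

/-- The conjugation `(a,b) ↦ (ā,-b)`. -/
def conj (x : SplitOct) : SplitOct := (star x.1, -x.2)

/-- The inner product `⟨x,y⟩ = Re (x ȳ)` of signature `(4,4)`. -/
def form (x y : SplitOct) : ℝ := (x * conj y).1.re

/-- The space `V = Im ℍ ⊕ ℍ` of imaginary split octonions. -/
def imag : Submodule ℝ SplitOct where
  carrier := {x | x.1.re = 0}
  add_mem' {x y} hx hy := by
    change (x.1 + y.1).re = 0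
    simp_all
  zero_mem' := by
    change (0 : ℍ[ℝ]).re = 0
    simp
  smul_mem' c x hx := by
    change (c • x.1).re = 0
    simp_all

@[ext] theorem ext' {x y : SplitOct} (h₁ : x.1 = y.1) (h₂ : x.2 = y.2) : x = y := Prod.ext h₁ h₂

@[simp] theorem mul_fst (x y : SplitOct) : (x * y).1 = x.1 * y.1 + star y.2 * x.2 := rfl
@[simp] theorem mul_snd (x y : SplitOct) : (x * y).2 = y.2 * x.1 + x.2 * star y.1 := rfl
@[simp] theorem one_fst : (1 : SplitOct).1 = 1 := rfl
@[simp] theorem one_snd : (1 : SplitOct).2 = 0 := rfl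
@[simp] theorem add_fst (x y : SplitOct) : (x + y).1 = x.1 + y.1 := rfl
@[simp] theorem add_snd (x y : SplitOct) : (x + y).2 = x.2 + y.2 := rfl
@[simp] theorem zero_fst : (0 : SplitOct).1 = 0 := rfl
@[simp] theorem zero_snd : (0 : SplitOct).2 = 0 := rfl
@[simp] theorem smul_fst (c : ℝ) (x : SplitOct) : (c • x).1 = c • x.1 := rfl
@[simp] theorem smul_snd (c : ℝ) (x : SplitOct) : (c • x).2 = c • x.2 := rfl
@[simp] theorem conj_fst (x : SplitOct) : (conj x).1 = star x.1 := rfl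
@[simp] theorem conj_snd (x : SplitOct) : (conj x).2 = -x.2 := rfl

theorem mem_imag {x : SplitOct} : x ∈ imag ↔ x.1.re = 0 := Iff.rfl

protected theorem one_mul' (x : SplitOct) : 1 * x = x := by ext1 <;> simp

protected theorem mul_one' (x : SplitOct) : x * 1 = x := by ext1 <;> simp

protected theorem mul_add' (x y z : SplitOct) : x * (y + z) = x * y + x * z := by
  ext1 <;> simp [mul_add, add_mul] <;> abel

protected theorem add_mul' (x y z : SplitOct) : (x + y) * z = x * z + y * z := by
  ext1 <;> simp [mul_add, add_mul] <;> abel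

protected theorem mul_smul' (c : ℝ) (x y : SplitOct) : x * (c • y) = c • (x * y) := by
  ext1 <;> simp

protected theorem smul_mul' (c : ℝ) (x y : SplitOct) : (c • x) * y = c • (x * y) := by
  ext1 <;> simp

theorem form_self (x : SplitOct) : form x x = ‖x.1‖ ^ 2 - ‖x.2‖ ^ 2 := by
  simp only [form, mul_fst, conj_fst, conj_snd, star_neg, neg_mul, Quaternion.self_mul_star,
    Quaternion.star_mul_self, Quaternion.normSq_eq_norm_mul_self]
  simp [pow_two, sub_eq_add_neg]

/-- Every element satisfies its quadratic equation. -/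
theorem mul_self_eq (x : SplitOct) :
    x * x = (2 * x.1.re) • x - (form x x) • (1 : SplitOct) := by
  have h1 : form x x = Quaternion.normSq x.1 - Quaternion.normSq x.2 := by
    simp only [form, mul_fst, conj_fst, conj_snd, star_neg, neg_mul, Quaternion.self_mul_star,
      Quaternion.star_mul_self]
    simp [sub_eq_add_neg]
  rw [h1, eq_sub_iff_add_eq]
  ext1
  · simp only [add_fst, mul_fst, smul_fst, one_fst, Quaternion.star_mul_self]
    ext
    · simp [Quaternion.normSq_def', -Quaternion.coe_add, -Quaternion.coe_pow]
      ring
    all_goals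
      simp
      ring
  · simp only [add_snd, mul_snd, smul_snd, one_snd]
    ext <;> simp <;> ring

end SplitOct

open SplitOct

/-! ### The group `G₂` and its Lie algebra -/

/-- The group `G₂` of linear automorphisms of the split octonions, inside `GL(Õ)`. -/
def G2 : Subgroup (SplitOct →L[ℝ] SplitOct)ˣ where
  carrier := {g | ∀ x y : SplitOct, (g : SplitOct →L[ℝ] SplitOct) (x * y) =
    (g : SplitOct →L[ℝ] SplitOct) x * (g : SplitOct →L[ℝ] SplitOct) y}
  mul_mem' {g h} hg hh x y := by
    simp only [Units.val_mul, mul_apply_eq_comp]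
    rw [hh, hg]
  one_mem' x y := by simp
  inv_mem' {g} hg x y := by
    have h1 : ∀ z, ((g⁻¹ : (SplitOct →L[ℝ] SplitOct)ˣ) : SplitOct →L[ℝ] SplitOct)
        ((g : SplitOct →L[ℝ] SplitOct) z) = z := fun z => by
      rw [← mul_apply_eq_comp, Units.inv_mul]; rfl
    have h2 : ∀ z, (g : SplitOct →L[ℝ] SplitOct)
        (((g⁻¹ : (SplitOct →L[ℝ] SplitOct)ˣ) : SplitOct →L[ℝ] SplitOct) z) = z := fun z => by
      rw [← mul_apply_eq_comp, Units.mul_inv]; rfl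
    conv_lhs => rw [← h2 x, ← h2 y, ← hg, h1]

/-- The endomorphism of the split octonions underlying an element of `G₂`. -/
def G2.toEnd (g : G2) : SplitOct →L[ℝ] SplitOct := ((g : (SplitOct →L[ℝ] SplitOct)ˣ) : _)

namespace G2

theorem toEnd_mul (g h : G2) : toEnd (g * h) = toEnd g * toEnd h := rfl

theorem toEnd_one : toEnd 1 = 1 := rfl

theorem toEnd_inv_apply (g : G2) (x : SplitOct) : toEnd g⁻¹ (toEnd g x) = x := by
  rw [← mul_apply_eq_comp, ← toEnd_mul, inv_mul_cancel, toEnd_one]; rfl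

theorem toEnd_apply_inv (g : G2) (x : SplitOct) : toEnd g (toEnd g⁻¹ x) = x := by
  rw [← mul_apply_eq_comp, ← toEnd_mul, mul_inv_cancel, toEnd_one]; rfl

theorem map_mul' (g : G2) (x y : SplitOct) : toEnd g (x * y) = toEnd g x * toEnd g y := g.2 x y

theorem map_one' (g : G2) : toEnd g 1 = 1 := by
  have h := map_mul' g (toEnd g⁻¹ 1) 1
  rw [SplitOct.mul_one', toEnd_apply_inv, SplitOct.one_mul'] at h
  exact h.symm

theorem map_ne_zero (g : G2) {x : SplitOct} (hx : x ≠ 0) : toEnd g x ≠ 0 := by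
  intro h
  apply hx
  rw [← toEnd_inv_apply g x, h, map_zero]

theorem one_ne_zero' : (1 : SplitOct) ≠ 0 := fun h => by
  have := congrArg (fun x : SplitOct => x.1) h
  simp at this

/-- `G₂` preserves the imaginary split octonions and the quadratic form on them. -/
theorem preserves (g : G2) {x : SplitOct} (hx : x ∈ imag) :
    toEnd g x ∈ imag ∧ form (toEnd g x) (toEnd g x) = form x x := by
  rw [mem_imag] at hx
  have h1 : toEnd g x * toEnd g x = -(form x x) • (1 : SplitOct) := by
    rw [← map_mul', mul_self_eq x, hx, mul_zero, zero_smul, zero_sub, map_neg, map_smul, map_one',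
      neg_smul]
  have h2 := mul_self_eq (toEnd g x)
  rw [h1] at h2
  have h3 : (2 * (toEnd g x).1.re) • toEnd g x =
      (form (toEnd g x) (toEnd g x) - form x x) • (1 : SplitOct) := by
    rw [sub_smul]
    rw [neg_smul] at h2
    rw [eq_sub_iff_add_eq] at h2
    rw [← h2]
    abel
  have h4 : (toEnd g x).1.re = 0 := by
    by_contra hne
    have h5 : x = ((2 * (toEnd g x).1.re)⁻¹ *
        (form (toEnd g x) (toEnd g x) - form x x)) • (1 : SplitOct) := by
      have h6 : toEnd g x = ((2 * (toEnd g x).1.re)⁻¹ *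
          (form (toEnd g x) (toEnd g x) - form x x)) • (1 : SplitOct) := by
        rw [mul_smul, ← h3, smul_smul, inv_mul_cancel₀ (by positivity), one_smul]
      have h7 := congrArg (toEnd g⁻¹) h6
      rwa [toEnd_inv_apply, map_smul, map_one'] at h7
    generalize ((2 * (toEnd g x).1.re)⁻¹ *
        (form (toEnd g x) (toEnd g x) - form x x)) = c at h5
    have h8 : c = 0 := by
      rw [h5] at hx
      simpa using hx
    rw [h8, zero_smul] at h5
    rw [h5, map_zero] at hne
    simp at hne
  refine ⟨h4, ?_⟩
  rw [h4, mul_zero, zero_smul] at h3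
  rcases smul_eq_zero.mp h3.symm with h | h
  · linarith
  · exact absurd h one_ne_zero'

end G2

/-- The commutator bracket on endomorphisms. -/
instance : LieRing (SplitOct →L[ℝ] SplitOct) := LieRing.ofAssociativeRing

instance : LieAlgebra ℝ (SplitOct →L[ℝ] SplitOct) := LieAlgebra.ofAssociativeAlgebra

/-- The Lie algebra `𝔤₂` of derivations of the split octonions. -/
def g2 : LieSubalgebra ℝ (SplitOct →L[ℝ] SplitOct) where
  carrier := {ξ | ∀ x y : SplitOct, ξ (x * y) = ξ x * y + x * ξ y}
  add_mem' {ξ η} hξ hη x y := by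
    simp only [add_apply, hξ x y, hη x y, SplitOct.mul_add', SplitOct.add_mul']
    abel
  zero_mem' x y := by
    simp only [zero_apply]
    ext1 <;> simp
  smul_mem' c ξ hξ x y := by
    simp only [smul_apply, hξ x y, SplitOct.mul_smul', SplitOct.smul_mul', smul_add]
  lie_mem' {ξ η} hξ hη x y := by
    simp only [Ring.lie_def, sub_apply, mul_apply_eq_comp]
    rw [hη x y, hξ x y, map_add, map_add, hξ, hξ, hη, hη]
    have e1 : ∀ a b c : SplitOct, (a - b) * c = a * c - b * c := fun a b c => by
      rw [eq_sub_iff_add_eq, ← SplitOct.add_mul', sub_add_cancel]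
    have e2 : ∀ a b c : SplitOct, a * (b - c) = a * b - a * c := fun a b c => by
      rw [eq_sub_iff_add_eq, ← SplitOct.mul_add', sub_add_cancel]
    rw [e1, e2]
    abel

/-- The Lie algebra (as a set of endomorphisms) of a closed subgroup `Γ` of `G₂`:
those `ξ` for which the one-parameter group `exp (t ξ)` lies in `Γ`. -/
def lieAlg (Γ : Subgroup G2) : Set (SplitOct →L[ℝ] SplitOct) :=
  {ξ | ∀ t : ℝ, ∃ g ∈ Γ, G2.toEnd g = NormedSpace.exp (t • ξ)}

/-! ### The space of null rays -/

/-- Nonzero null vectors of `V`. -/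
def NullVec : Type := {x : SplitOct // x ∈ imag ∧ form x x = 0 ∧ x ≠ 0}

instance : TopologicalSpace NullVec :=
  inferInstanceAs (TopologicalSpace {x : SplitOct // x ∈ imag ∧ form x x = 0 ∧ x ≠ 0})

/-- Two null vectors span the same ray if they are positive multiples of each other. -/
instance NullVec.setoid : Setoid NullVec where
  r x y := ∃ c : ℝ, 0 < c ∧ y.1 = c • x.1
  iseqv :=
    { refl := fun x => ⟨1, one_pos, (one_smul ℝ x.1).symm⟩
      symm := by
        rintro x y ⟨c, hc, h⟩
        exact ⟨c⁻¹, inv_pos.2 hc, by rw [h, smul_smul, inv_mul_cancel₀ hc.ne', one_smul]⟩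
      trans := by
        rintro x y z ⟨c, hc, h⟩ ⟨d, hd, h'⟩
        exact ⟨d * c, mul_pos hd hc, by rw [h', h, smul_smul]⟩ }

/-- The space `C` of null rays `ℝ⁺x`, with the quotient topology. -/
def NullRay : Type := Quotient NullVec.setoid

instance : TopologicalSpace NullRay := inferInstanceAs (TopologicalSpace (Quotient NullVec.setoid))

instance : MulAction G2 NullVec where
  smul g x := ⟨G2.toEnd g x.1, (G2.preserves g x.2.1).1,
    (G2.preserves g x.2.1).2.trans x.2.2.1, G2.map_ne_zero g x.2.2.2⟩
  one_smul _ := rfl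
  mul_smul _ _ _ := rfl

theorem NullVec.smul_val (g : G2) (x : NullVec) : (g • x).1 = G2.toEnd g x.1 := rfl

/-- The action of `G₂` on null rays induced by its linear action on `V`. -/
instance : MulAction G2 NullRay where
  smul g := Quotient.map (fun x => g • x) (by
    rintro x y ⟨c, hc, h⟩
    exact ⟨c, hc, by rw [NullVec.smul_val, NullVec.smul_val, h, map_smul]⟩)
  one_smul := by
    rintro ⟨x⟩
    exact congrArg (Quotient.mk _) (one_smul G2 x)
  mul_smul := by
    rintro g h ⟨x⟩
    exact congrArg (Quotient.mk _) (mul_smul g h x)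

/-- The representative `(v,h)` with `‖v‖ = 1` of a null ray; it embeds the space of rays in `V`. -/
def NullRay.rep : NullRay → SplitOct :=
  Quotient.lift (fun x : NullVec => ‖x.1.1‖⁻¹ • x.1) (by
    rintro x y ⟨c, hc, h⟩
    rw [h, smul_fst, norm_smul, Real.norm_of_nonneg hc.le, mul_inv, smul_smul, mul_right_comm,
      inv_mul_cancel₀ hc.ne', one_mul])

/-- The model space of `C`. -/
abbrev E5 : Type := EuclideanSpace ℝ (Fin 5)

/-- A smooth structure on the space of null rays is the one inherited from the space of all rays
of `V`, i.e. the inclusion (in the form of `NullRay.rep`) is a smooth embedding: a smooth immersion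
that is a topological embedding. -/
structure IsRaySubmanifold [ChartedSpace E5 NullRay] : Prop where
  smooth : ContMDiff 𝓘(ℝ, E5) 𝓘(ℝ, SplitOct) ∞ NullRay.rep
  immersion : ∀ c, Function.Injective (mfderiv 𝓘(ℝ, E5) 𝓘(ℝ, SplitOct) NullRay.rep c)
  embedding : Topology.IsEmbedding NullRay.rep

/-! ### Distributions -/

/-- A rank `k` distribution on a manifold: a smooth rank `k` subbundle of the tangent bundle,
i.e. one that is locally spanned by `k` pointwise linearly independent smooth vector fields. -/
def IsDistribution {E M : Type*} [NormedAddCommGroup E] [NormedSpace ℝ E]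
    [TopologicalSpace M] [ChartedSpace E M] [IsManifold 𝓘(ℝ, E) ∞ M] (k : ℕ)
    (D : ∀ p : M, Submodule ℝ (TangentSpace 𝓘(ℝ, E) p)) : Prop :=
  ∀ p₀ : M, ∃ U : Set M, IsOpen U ∧ p₀ ∈ U ∧
    ∃ X : Fin k → ∀ p : M, TangentSpace 𝓘(ℝ, E) p,
      (∀ i, ContMDiffOn 𝓘(ℝ, E) 𝓘(ℝ, E).tangent ∞
        (fun p => (⟨p, X i p⟩ : TangentBundle 𝓘(ℝ, E) M)) U) ∧
      ∀ p ∈ U, LinearIndependent ℝ (fun i => X i p) ∧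
        Submodule.span ℝ (Set.range fun i => X i p) = D p

/-- The subspace `x⁰ = {y ∈ V | xy = 0}`. -/
def annihil (x : SplitOct) : Submodule ℝ SplitOct where
  carrier := {y | y ∈ imag ∧ x * y = 0}
  add_mem' {y z} hy hz := ⟨imag.add_mem hy.1 hz.1, by rw [SplitOct.mul_add', hy.2, hz.2, add_zero]⟩
  zero_mem' := ⟨imag.zero_mem, by ext1 <;> simp⟩
  smul_mem' c y hy := ⟨imag.smul_mem c hy.1, by rw [SplitOct.mul_smul', hy.2, smul_zero]⟩

/-- The distribution on `C` defined by the subspaces `x⁰`: its plane at the ray of `x` is the image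
of `x⁰` in the tangent space, i.e. it consists of the tangent vectors whose representative in `V`
lies in `x⁰` (which contains `ℝx`). -/
def octDist [ChartedSpace E5 NullRay] (c : NullRay) :
    Submodule ℝ (TangentSpace 𝓘(ℝ, E5) c) :=
  Submodule.comap
    (mfderiv 𝓘(ℝ, E5) 𝓘(ℝ, SplitOct) NullRay.rep c : E5 →L[ℝ] SplitOct).toLinearMap
    (annihil c.rep)

/-! ### The data `(𝔤, 𝔥, W)` of a homogeneous distribution -/

/-- The isotropy algebra at `c` of the action of `Γ ≤ G₂` on `C`. -/
def isotropyAlg (Γ : Subgroup G2) (c : NullRay) : Set (SplitOct →L[ℝ] SplitOct) :=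
  lieAlg (Γ ⊓ MulAction.stabilizer G2 c)

/-- The preimage in the Lie algebra of `Γ` of the subspace `W` of (Lie algebra)/(isotropy algebra)
that corresponds to the distribution `D` at `c`: those `ξ` for which the velocity at `t = 0` of
`exp (t ξ) • c` lies in `D`. -/
def distAlg [ChartedSpace E5 NullRay] (Γ : Subgroup G2)
    (D : ∀ c : NullRay, Submodule ℝ (TangentSpace 𝓘(ℝ, E5) c)) (c : NullRay) :
    Set (SplitOct →L[ℝ] SplitOct) :=
  {ξ | ξ ∈ lieAlg Γ ∧ ∃ γ : ℝ → G2, (∀ t, G2.toEnd (γ t) = NormedSpace.exp (t • ξ)) ∧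
    ∃ w ∈ D (γ 0 • c), HasMFDerivAt 𝓘(ℝ, ℝ) 𝓘(ℝ, E5) (fun t => γ t • c) 0
      ((ContinuousLinearMap.toSpanSingleton ℝ (w : E5) : ℝ →L[ℝ] E5))}

/-! ### The root diagram of `𝔤₂` -/

section Diagram

variable {L : Type*} [LieRing L] [LieAlgebra ℝ L] (H : LieSubalgebra ℝ L)

/-- The space of `X` with `[T,X] = α(T) X` for all `T ∈ H`. -/
def rootSp (α : Module.Dual ℝ H) : Submodule ℝ L where
  carrier := {X | ∀ T : H, ⁅(T : L), X⁆ = α T • X}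
  add_mem' {X Y} hX hY T := by rw [lie_add, hX T, hY T, smul_add]
  zero_mem' T := by simp
  smul_mem' c X hX T := by rw [lie_smul, hX T, smul_comm]

/-- `L` is the split real form of the simple Lie algebra of type `G₂`: it is semisimple, `H` is
a Cartan subalgebra of rank two, the nonzero roots are `±σᵢ` (short) and `±lᵢ` (long), placed as in
the hexagonal root diagram `σ₀ = σ₁ + σ₂`, `l₀ = σ₁ - σ₂`, `l₁ = σ₀ + σ₂`, `l₂ = σ₀ + σ₁`, with
one-dimensional root spaces that together with `H` span `L`. -/
structure IsG2Diagram (σ l : Fin 3 → Module.Dual ℝ H) : Prop where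
  semisimple : LieAlgebra.IsKilling ℝ L
  cartan : H.IsCartanSubalgebra
  rank : Module.finrank ℝ H = 2
  dim : Module.finrank ℝ L = 14
  indep : LinearIndependent ℝ ![σ 1, σ 2]
  rel_short : σ 0 = σ 1 + σ 2
  rel_long₀ : l 0 = σ 1 - σ 2
  rel_long₁ : l 1 = σ 0 + σ 2
  rel_long₂ : l 2 = σ 0 + σ 1
  short_pos : ∀ i, Module.finrank ℝ (rootSp H (σ i)) = 1
  short_neg : ∀ i, Module.finrank ℝ (rootSp H (-σ i)) = 1
  long_pos : ∀ i, Module.finrank ℝ (rootSp H (l i)) = 1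
  long_neg : ∀ i, Module.finrank ℝ (rootSp H (-l i)) = 1
  span : H.toSubmodule ⊔
    (⨆ i, rootSp H (σ i) ⊔ rootSp H (-σ i) ⊔ rootSp H (l i) ⊔ rootSp H (-l i)) = ⊤

/-- The nine-dimensional parabolic subalgebra `𝔭`, the span of `H` and of the root spaces for
`-σ₀, σ₁, -σ₂, l₀, -l₁, l₂, -l₂`. -/
def parabolic (σ l : Fin 3 → Module.Dual ℝ H) : Submodule ℝ L :=
  H.toSubmodule ⊔ rootSp H (-σ 0) ⊔ rootSp H (σ 1) ⊔ rootSp H (-σ 2) ⊔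
    rootSp H (l 0) ⊔ rootSp H (-l 1) ⊔ rootSp H (l 2) ⊔ rootSp H (-l 2)

/-- The preimage in the Lie algebra of the plane `W ⊆ 𝔤₂/𝔭` spanned by the root spaces
for `σ₀` and `-σ₁`. -/
def planeW (σ l : Fin 3 → Module.Dual ℝ H) : Submodule ℝ L :=
  parabolic H σ l ⊔ (rootSp H (σ 0) ⊔ rootSp H (-σ 1))

end Diagram

/-! ### The maximal compact subgroup -/

/-- The group of unit quaternions, `SU(2)`. -/
abbrev UnitQuat : Type := Metric.sphere (0 : ℍ[ℝ]) 1

/-- The endomorphism `(a,b) ↦ (q₁ a q̄₁, q₂ b q̄₁)` of the split octonions. -/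
def quatAct (q : UnitQuat × UnitQuat) : SplitOct →L[ℝ] SplitOct :=
  LinearMap.toContinuousLinearMap
    { toFun := fun x => ((q.1 : ℍ[ℝ]) * x.1 * star (q.1 : ℍ[ℝ]),
        (q.2 : ℍ[ℝ]) * x.2 * star (q.1 : ℍ[ℝ]))
      map_add' := fun x y => by
        apply SplitOct.ext'
        · exact (by simp [mul_add, add_mul] : (q.1 : ℍ[ℝ]) * (x + y).1 * star (q.1 : ℍ[ℝ]) =
            q.1 * x.1 * star (q.1 : ℍ[ℝ]) + q.1 * y.1 * star (q.1 : ℍ[ℝ]))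
        · exact (by simp [mul_add, add_mul] : (q.2 : ℍ[ℝ]) * (x + y).2 * star (q.1 : ℍ[ℝ]) =
            q.2 * x.2 * star (q.1 : ℍ[ℝ]) + q.2 * y.2 * star (q.1 : ℍ[ℝ]))
      map_smul' := fun c x => by
        apply SplitOct.ext'
        · exact (by simp : (q.1 : ℍ[ℝ]) * (c • x).1 * star (q.1 : ℍ[ℝ]) =
            c • (q.1 * x.1 * star (q.1 : ℍ[ℝ])))
        · exact (by simp : (q.2 : ℍ[ℝ]) * (c • x).2 * star (q.1 : ℍ[ℝ]) =
            c • (q.2 * x.2 * star (q.1 : ℍ[ℝ]))) }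

theorem quatAct_fst (q : UnitQuat × UnitQuat) (x : SplitOct) :
    (quatAct q x).1 = (q.1 : ℍ[ℝ]) * x.1 * star (q.1 : ℍ[ℝ]) := rfl

theorem quatAct_snd (q : UnitQuat × UnitQuat) (x : SplitOct) :
    (quatAct q x).2 = (q.2 : ℍ[ℝ]) * x.2 * star (q.1 : ℍ[ℝ]) := rfl

theorem UnitQuat.star_mul (q : UnitQuat) : star (q : ℍ[ℝ]) * (q : ℍ[ℝ]) = 1 := by
  rw [Quaternion.star_mul_self, Quaternion.normSq_eq_norm_mul_self, norm_eq_of_mem_sphere q]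
  simp

theorem quatAct_one : quatAct 1 = 1 := by
  ext1 x
  apply SplitOct.ext' <;> simp [quatAct_fst, quatAct_snd]

theorem quatAct_mul (p q : UnitQuat × UnitQuat) : quatAct (p * q) = quatAct p * quatAct q := by
  ext1 x
  apply SplitOct.ext' <;> simp [quatAct_fst, quatAct_snd, mul_assoc]

theorem quatAct_map_mul (q : UnitQuat × UnitQuat) (x y : SplitOct) :
    quatAct q (x * y) = quatAct q x * quatAct q y := by
  have e1 : ∀ z : ℍ[ℝ], star (q.1 : ℍ[ℝ]) * ((q.1 : ℍ[ℝ]) * z) = z := fun z => by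
    rw [← mul_assoc, UnitQuat.star_mul, one_mul]
  have e2 : ∀ z : ℍ[ℝ], star (q.2 : ℍ[ℝ]) * ((q.2 : ℍ[ℝ]) * z) = z := fun z => by
    rw [← mul_assoc, UnitQuat.star_mul, one_mul]
  apply SplitOct.ext' <;>
    simp [quatAct_fst, quatAct_snd, mul_add, add_mul, mul_assoc, e1, e2]

/-- The homomorphism `SU(2) × SU(2) → G₂`. -/
def quatHom : UnitQuat × UnitQuat →* G2 where
  toFun q := ⟨⟨quatAct q, quatAct q⁻¹, by rw [← quatAct_mul, mul_inv_cancel, quatAct_one],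
    by rw [← quatAct_mul, inv_mul_cancel, quatAct_one]⟩, quatAct_map_mul q⟩
  map_one' := Subtype.ext (Units.ext quatAct_one)
  map_mul' p q := Subtype.ext (Units.ext (quatAct_mul p q))

/-- The subgroup `K ≅ (SU(2) × SU(2)) / ±(1,1)` of `G₂`. -/
def maxK : Subgroup G2 := quatHom.range

/-- A maximal compact subgroup. -/
def IsMaximalCompact {G : Type*} [Group G] [TopologicalSpace G] (K : Subgroup G) : Prop :=
  IsCompact (K : Set G) ∧ ∀ K' : Subgroup G, K ≤ K' → IsCompact (K' : Set G) → K' = K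

/-! ### Rolling balls -/

/-- The standard two-sphere. -/
abbrev S2 : Type := Metric.sphere (0 : EuclideanSpace ℝ (Fin 3)) 1

/-- The standard three-sphere. -/
abbrev S3 : Type := Metric.sphere (0 : EuclideanSpace ℝ (Fin 4)) 1

/-- The configuration space `SO₃ × S²` of the rolling balls. -/
abbrev RollConf : Type := Matrix.specialOrthogonalGroup (Fin 3) ℝ × S2

/-- The vector space of pairs (matrix, vector), in which `SO₃ × S²` is an embedded submanifold. -/
abbrev RollAmb : Type := (Fin 3 → Fin 3 → ℝ) × (Fin 3 → ℝ)

/-- The rotation of the moving ball, as a matrix. -/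
def RollConf.rot (p : RollConf) : Matrix (Fin 3) (Fin 3) ℝ := p.1.1

/-- The direction of the point of contact. -/
def RollConf.dir (p : RollConf) : Fin 3 → ℝ := fun i => p.2.1 i

/-- The embedding of `SO₃ × S²` in the vector space of pairs (matrix, vector). -/
def RollConf.coord (p : RollConf) : RollAmb := (fun i j => p.rot i j, p.dir)

/-- The antisymmetric matrix of `v ↦ w × v`. -/
def crossMat (w : Fin 3 → ℝ) : Matrix (Fin 3) (Fin 3) ℝ :=
  LinearMap.toMatrix' (crossProduct w)

/-- The rolling distribution for a ball of radius `r` on a fixed ball of radius `R`: the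
velocities `(ġ, ẋ)`, with angular velocity `w`, i.e. `ġ = w × g`, that satisfy the no-slip condition
`(R + r) ẋ = r w × x` and the no-spin condition `⟨w,x⟩ = 0`. -/
def rollDist (R r : ℝ) (p : RollConf) : Submodule ℝ RollAmb where
  carrier := {u | ∃ w : Fin 3 → ℝ, Matrix.of u.1 = crossMat w * p.rot ∧
    (R + r) • u.2 = r • (w ⨯₃ p.dir) ∧ w ⬝ᵥ p.dir = 0}
  add_mem' := by
    rintro u u' ⟨w, h1, h2, h3⟩ ⟨w', h1', h2', h3'⟩
    refine ⟨w + w', ?_, ?_, ?_⟩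
    · rw [crossMat, map_add, map_add, add_mul]
      exact congrArg₂ (· + ·) h1 h1'
    · rw [Prod.snd_add, smul_add, h2, h2', map_add, LinearMap.add_apply, smul_add]
    · rw [add_dotProduct, h3, h3', add_zero]
  zero_mem' := ⟨0, by
    simp only [crossMat, map_zero, zero_mul, Prod.fst_zero]; rfl, by simp, by simp⟩
  smul_mem' := by
    rintro c u ⟨w, h1, h2, h3⟩
    refine ⟨c • w, ?_, ?_, ?_⟩
    · rw [crossMat, map_smul, map_smul, Matrix.smul_mul]
      exact congrArg (c • ·) h1
    · rw [Prod.smul_snd, smul_comm, h2, map_smul, LinearMap.smul_apply, smul_comm]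
    · rw [smul_dotProduct, h3, smul_zero]

/-- The base point `(1, e₃)` of `SO₃ × S²`. -/
def rollBase : RollConf := (1, ⟨EuclideanSpace.single 2 1, by simp⟩)

/-- The infinitesimal action on `SO₃ × S²` of a pair of angular velocities `(w',w'')`, an element of
`𝔰𝔬₃ ⊕ 𝔰𝔬₃`, for the action `(g,x) ↦ (g' g g''⁻¹, g' x)` of `SO₃ × SO₃`. -/
def rollInf (w : (Fin 3 → ℝ) × (Fin 3 → ℝ)) (p : RollConf) : RollAmb :=
  (fun i j => (crossMat w.1 * p.rot - p.rot * crossMat w.2) i j, w.1 ⨯₃ p.dir)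

/-- The isotropy algebra of the base point in `𝔰𝔬₃ ⊕ 𝔰𝔬₃`. -/
def rollIsotropy : Set ((Fin 3 → ℝ) × (Fin 3 → ℝ)) := {w | rollInf w rollBase = 0}

/-- The preimage in `𝔰𝔬₃ ⊕ 𝔰𝔬₃` of the rolling plane at the base point. -/
def rollPlane (R r : ℝ) : Set ((Fin 3 → ℝ) × (Fin 3 → ℝ)) :=
  {w | rollInf w rollBase ∈ rollDist R r rollBase}

/-- The Lie algebraic data at `c` of the distribution `D` on `C`, viewed as a `K`-homogeneous
space, coincide with those of the rolling distribution: an isomorphism of `𝔰𝔬₃ ⊕ 𝔰𝔬₃` (with the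
cross product as bracket) with the Lie algebra of `K` matches the isotropy algebras and the planes. -/
def HasRollingData [ChartedSpace E5 NullRay]
    (D : ∀ c : NullRay, Submodule ℝ (TangentSpace 𝓘(ℝ, E5) c)) (c : NullRay) (R r : ℝ) : Prop :=
  ∃ φ : ((Fin 3 → ℝ) × (Fin 3 → ℝ)) →ₗ[ℝ] (SplitOct →L[ℝ] SplitOct),
    Function.Injective φ ∧
    (∀ w η, φ (w.1 ⨯₃ η.1, w.2 ⨯₃ η.2) = ⁅φ w, φ η⁆) ∧
    Set.range φ = lieAlg maxK ∧
    (∀ w, φ w ∈ isotropyAlg maxK c ↔ w ∈ rollIsotropy) ∧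
    (∀ w, φ w ∈ distAlg maxK D c ↔ w ∈ rollPlane R r)

/-- The matrix, in the basis `i, j, k`, of the rotation `v ↦ q v q̄` of the imaginary quaternions. -/
def quatRot (q : UnitQuat) : Matrix (Fin 3) (Fin 3) ℝ :=
  Matrix.of fun i j =>
    let e : Fin 3 → ℍ[ℝ] := ![⟨0, 1, 0, 0⟩, ⟨0, 0, 1, 0⟩, ⟨0, 0, 0, 1⟩]
    let w : ℍ[ℝ] := (q : ℍ[ℝ]) * e j * star (q : ℍ[ℝ])
    ![w.imI, w.imJ, w.imK] i

/-- The element `(-1,1)` of `SU(2) × SU(2)`, whose image in `K` generates the deck group. -/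
def deckElt : UnitQuat × UnitQuat := (⟨-1, by simp⟩, 1)

/-- `π : C → SO₃ × S²` is a two-to-one covering map, with deck group generated by `(-1,1) ∈ K`,
smooth with injective differential, equivariant for the action of `SU(2) × SU(2)` on `C` through `K`
and on `SO₃ × S²` through the double covers `SU(2) → SO₃` (composed with `s`, which may interchange
the two factors), and it maps `D` onto the rolling distribution. -/
structure IsRollingCover [ChartedSpace E5 NullRay]
    (D : ∀ c : NullRay, Submodule ℝ (TangentSpace 𝓘(ℝ, E5) c)) (R r : ℝ)
    (s : UnitQuat × UnitQuat → UnitQuat × UnitQuat) (π : NullRay → RollConf) : Prop where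
  covering : IsCoveringMap π
  surjective : Function.Surjective π
  fibre : ∀ c c', π c = π c' ↔ c' = c ∨ c' = quatHom deckElt • c
  two : ∀ c : NullRay, quatHom deckElt • c ≠ c
  smooth : ContMDiff 𝓘(ℝ, E5) 𝓘(ℝ, RollAmb) ∞ (fun c => (π c).coord)
  immersion : ∀ c, Function.Injective
    (mfderiv 𝓘(ℝ, E5) 𝓘(ℝ, RollAmb) (fun c => (π c).coord) c)
  equivariant_rot : ∀ q c, (π (quatHom q • c)).rot =
    quatRot (s q).1 * (π c).rot * (quatRot (s q).2)ᵀ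
  equivariant_dir : ∀ q c, (π (quatHom q • c)).dir = quatRot (s q).1 *ᵥ (π c).dir
  push : ∀ c, Submodule.map
    (mfderiv 𝓘(ℝ, E5) 𝓘(ℝ, RollAmb) (fun c => (π c).coord) c : E5 →L[ℝ] RollAmb).toLinearMap
      (D c) = rollDist R r (π c)

end

/-! In the null coordinates `crd` the split octonions become Zorn's vector matrices. Put ℓ = (0,1),
so ℓ² = 1. The imaginary octonions split into ℝℓ and the two eigenspaces of left multiplication by
ℓ, which are totally null of dimension three. Products inside one eigenspace are cross products with
values in the other. A derivation is determined by its values on ℓ and on a basis of one eigenspace,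
so 𝔤₂ is sl₃ ⊕ ℝ³ ⊕ ℝ³ as a vector space, with the diagonal matrices of sl₃ as torus (`exists_der`,
`lie_torus`). The root space statements then follow from the criterion `IsRootBasis`. As the roots
are real, the Killing form restricted to the torus is a sum of squares of roots, and this gives
semisimplicity (`IsRootBasis.isKilling`).

The base point is the ray of `nb 7`. A derivation preserves it exactly when five root coordinates
vanish, and it sends `nb 7` into `nb 7`⁰ = span(`nb 2`, `nb 3`, `nb 7`) exactly when three of these
five vanish. This yields 𝔭 and W. The whole isotropy group is generated by exp 𝔭
(`stabilizer_base`): after a scaling by the torus an element fixes `nb 7`, unipotent elements bring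
the image of the dual vector `nb 4` back to `nb 4`, and what remains is a unimodular 2×2 matrix, a
product of elementary ones.

K is the centralizer in G₂ of the involution S(a,b) = (a,-b), because automorphisms of ℍ are inner
(`mem_maxK_of_comm`). It is maximal compact by a polar decomposition argument: for g in a compact
group containing K, the operator p = g S g⁻¹ S = g g* is positive and lies in the same group, so its
powers and those of its inverse are bounded. This forces p = 1, and g commutes with S.

Each null ray has a unique representative (v,h) with v a unit imaginary quaternion and h a unit
quaternion. This identifies C with S³ × S² and makes the transitivity of K visible. At (v,h) the
plane D consists of the vectors (b, hvb) with b imaginary and orthogonal to v (`mem_annihil_rep`).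
Smooth choices b = F and b = vF give local frames.

The covers are explicit. For R = 3r, (v,h) goes to the rotation of the unit quaternion q = v h̄ and
the contact point x = v; for r = 3R, to q = hv and x = h v h̄. Along (b, hvb) one finds q̇ = ½uq
with u imaginary and orthogonal to x, so u is the angular velocity and the no-spin condition holds.
No-slip reads (R+r)ẋ = r u x. In the first case ẋ = b and u x = 4b, giving R + r = 4r; in the second
ẋ = 3 h b h̄ and u x = 4 h b h̄, giving 3(R+r) = 4r. A rotation determines its unit quaternion up to
sign, and the sign change of q is h ↦ -h, the action of (-1,1); so the fibres have two points. -/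

noncomputable section
open SplitOct

/-! ### Null coordinates -/

namespace SplitOct

/-- Null coordinates on the split octonions: the real part of the first entry, the real part of the
second entry, and the coordinates of `a - b` and `a + b` for the imaginary parts `a`, `b`. -/
def crd : SplitOct ≃ₗ[ℝ] (Fin 8 → ℝ) where
  toFun x := ![x.1.re, x.2.re, x.1.imI - x.2.imI, x.1.imJ - x.2.imJ, x.1.imK - x.2.imK,
    x.1.imI + x.2.imI, x.1.imJ + x.2.imJ, x.1.imK + x.2.imK]
  invFun c := ((⟨c 0, (c 2 + c 5) / 2, (c 3 + c 6) / 2, (c 4 + c 7) / 2⟩ : ℍ[ℝ]),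
    (⟨c 1, (c 5 - c 2) / 2, (c 6 - c 3) / 2, (c 7 - c 4) / 2⟩ : ℍ[ℝ]))
  map_add' x y := by ext i; fin_cases i <;> simp <;> ring
  map_smul' c x := by ext i; fin_cases i <;> simp <;> ring
  left_inv x := by apply SplitOct.ext' <;> ext <;> simp
  right_inv c := by ext i; fin_cases i <;> simp <;> ring

theorem crd_apply (x : SplitOct) : crd x = ![x.1.re, x.2.re, x.1.imI - x.2.imI,
    x.1.imJ - x.2.imJ, x.1.imK - x.2.imK, x.1.imI + x.2.imI, x.1.imJ + x.2.imJ,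
    x.1.imK + x.2.imK] := rfl

theorem ext_crd {x y : SplitOct} (h : ∀ i, crd x i = crd y i) : x = y :=
  crd.injective (funext h)

/-- This is Zorn's form of the product: coordinates 2–4 and 5–7 are vectors in the eigenspaces of ℓ
= `nb 1` for the eigenvalues 1 and -1, paired by the scalar coordinates and multiplied by cross
products. -/
theorem crd_mul (x y : SplitOct) : crd (x * y) = ![
    crd x 0 * crd y 0 + crd x 1 * crd y 1 - (crd x 2 * crd y 5 + crd x 5 * crd y 2 +
      crd x 3 * crd y 6 + crd x 6 * crd y 3 + crd x 4 * crd y 7 + crd x 7 * crd y 4) / 2,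
    crd x 0 * crd y 1 + crd x 1 * crd y 0 - (crd x 2 * crd y 5 - crd x 5 * crd y 2 +
      crd x 3 * crd y 6 - crd x 6 * crd y 3 + crd x 4 * crd y 7 - crd x 7 * crd y 4) / 2,
    (crd x 0 + crd x 1) * crd y 2 + (crd y 0 - crd y 1) * crd x 2 +
      (crd x 6 * crd y 7 - crd x 7 * crd y 6),
    (crd x 0 + crd x 1) * crd y 3 + (crd y 0 - crd y 1) * crd x 3 +
      (crd x 7 * crd y 5 - crd x 5 * crd y 7),
    (crd x 0 + crd x 1) * crd y 4 + (crd y 0 - crd y 1) * crd x 4 +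
      (crd x 5 * crd y 6 - crd x 6 * crd y 5),
    (crd x 0 - crd x 1) * crd y 5 + (crd y 0 + crd y 1) * crd x 5 +
      (crd x 3 * crd y 4 - crd x 4 * crd y 3),
    (crd x 0 - crd x 1) * crd y 6 + (crd y 0 + crd y 1) * crd x 6 +
      (crd x 4 * crd y 2 - crd x 2 * crd y 4),
    (crd x 0 - crd x 1) * crd y 7 + (crd y 0 + crd y 1) * crd x 7 +
      (crd x 2 * crd y 3 - crd x 3 * crd y 2)] := by
  simp only [crd_apply]
  ext i; fin_cases i <;> simp <;> ring

theorem crd_one : crd 1 = ![1, 0, 0, 0, 0, 0, 0, 0] := by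
  simp [crd_apply]

theorem mem_imag_iff_crd {x : SplitOct} : x ∈ imag ↔ crd x 0 = 0 := Iff.rfl

theorem form_self_crd (x : SplitOct) : form x x =
    crd x 0 ^ 2 - crd x 1 ^ 2 + crd x 2 * crd x 5 + crd x 3 * crd x 6 + crd x 4 * crd x 7 := by
  simp only [crd_apply, form]
  simp
  ring

end SplitOct

/-! ### The derivations in null coordinates -/

/-- The endomorphism of the split octonions with torus parameters `h` and root vector
parameters `θ`. -/
def derMap (h : Fin 2 → ℝ) (θ : Fin 12 → ℝ) : SplitOct →ₗ[ℝ] SplitOct where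
  toFun x := crd.symm ![0,
    θ 0 * crd x 5 + θ 1 * crd x 6 + θ 2 * crd x 7 + θ 3 * crd x 2 + θ 4 * crd x 3 + θ 5 * crd x 4,
    h 0 * crd x 2 + θ 6 * crd x 3 + θ 8 * crd x 4 + 2 * crd x 1 * θ 0 -
      (θ 4 * crd x 7 - θ 5 * crd x 6),
    θ 7 * crd x 2 + h 1 * crd x 3 + θ 10 * crd x 4 + 2 * crd x 1 * θ 1 -
      (θ 5 * crd x 5 - θ 3 * crd x 7),
    θ 9 * crd x 2 + θ 11 * crd x 3 - (h 0 + h 1) * crd x 4 + 2 * crd x 1 * θ 2 -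
      (θ 3 * crd x 6 - θ 4 * crd x 5),
    -(h 0 * crd x 5 + θ 7 * crd x 6 + θ 9 * crd x 7) + 2 * crd x 1 * θ 3 +
      (θ 1 * crd x 4 - θ 2 * crd x 3),
    -(θ 6 * crd x 5 + h 1 * crd x 6 + θ 11 * crd x 7) + 2 * crd x 1 * θ 4 +
      (θ 2 * crd x 2 - θ 0 * crd x 4),
    -(θ 8 * crd x 5 + θ 10 * crd x 6 - (h 0 + h 1) * crd x 7) + 2 * crd x 1 * θ 5 +
      (θ 0 * crd x 3 - θ 1 * crd x 2)]
  map_add' x y := by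
    apply ext_crd; intro i
    fin_cases i <;> simp <;> ring
  map_smul' c x := by
    apply ext_crd; intro i
    fin_cases i <;> simp <;> ring

/-- `derMap` as a continuous linear map. -/
def der (h : Fin 2 → ℝ) (θ : Fin 12 → ℝ) : SplitOct →L[ℝ] SplitOct :=
  LinearMap.toContinuousLinearMap (derMap h θ)

theorem crd_der (h : Fin 2 → ℝ) (θ : Fin 12 → ℝ) (x : SplitOct) : crd (der h θ x) = ![0,
    θ 0 * crd x 5 + θ 1 * crd x 6 + θ 2 * crd x 7 + θ 3 * crd x 2 + θ 4 * crd x 3 + θ 5 * crd x 4,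
    h 0 * crd x 2 + θ 6 * crd x 3 + θ 8 * crd x 4 + 2 * crd x 1 * θ 0 -
      (θ 4 * crd x 7 - θ 5 * crd x 6),
    θ 7 * crd x 2 + h 1 * crd x 3 + θ 10 * crd x 4 + 2 * crd x 1 * θ 1 -
      (θ 5 * crd x 5 - θ 3 * crd x 7),
    θ 9 * crd x 2 + θ 11 * crd x 3 - (h 0 + h 1) * crd x 4 + 2 * crd x 1 * θ 2 -
      (θ 3 * crd x 6 - θ 4 * crd x 5),
    -(h 0 * crd x 5 + θ 7 * crd x 6 + θ 9 * crd x 7) + 2 * crd x 1 * θ 3 +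
      (θ 1 * crd x 4 - θ 2 * crd x 3),
    -(θ 6 * crd x 5 + h 1 * crd x 6 + θ 11 * crd x 7) + 2 * crd x 1 * θ 4 +
      (θ 2 * crd x 2 - θ 0 * crd x 4),
    -(θ 8 * crd x 5 + θ 10 * crd x 6 - (h 0 + h 1) * crd x 7) + 2 * crd x 1 * θ 5 +
      (θ 0 * crd x 3 - θ 1 * crd x 2)] :=
  crd.apply_symm_apply _

/-- The parameters `h` and `θ 6`, …, `θ 11` are the entries of a traceless matrix A acting on
coordinates 2–4 as A and on 5–7 as -Aᵀ. The vectors (`θ 0`, `θ 1`, `θ 2`) and (`θ 3`, `θ 4`, `θ 5`)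
are half of the image of ℓ, and act by pairings and cross products. -/
theorem der_mem (h : Fin 2 → ℝ) (θ : Fin 12 → ℝ) : der h θ ∈ g2 := by
  intro x y
  apply ext_crd; intro i
  rw [map_add, Pi.add_apply, crd_der, crd_mul, crd_mul, crd_mul, crd_der, crd_der]
  fin_cases i <;> simp <;> ring

namespace SplitOct

/-- The basis of the split octonions dual to the null coordinates. -/
def nb (i : Fin 8) : SplitOct := crd.symm (Pi.single i 1)

theorem crd_nb (i : Fin 8) : crd (nb i) = Pi.single i 1 := crd.apply_symm_apply _

theorem eq_sum_nb (x : SplitOct) : x = ∑ i, crd x i • nb i := by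
  apply crd.injective
  rw [map_sum]
  simp_rw [map_smul, crd_nb]
  exact (Finset.univ_sum_single (crd x)).symm.trans
    (Finset.sum_congr rfl fun i _ => by rw [← Pi.single_smul, smul_eq_mul, mul_one])

theorem nb_zero : nb 0 = 1 := by
  apply crd.injective; rw [crd_nb, crd_one]; ext i; fin_cases i <;> rfl

theorem nb_mul_11 : nb 1 * nb 1 = 1 := by
  apply crd.injective; rw [crd_mul, crd_one]; simp only [crd_nb]
  ext i; fin_cases i <;> simp

theorem nb_mul_12 : nb 1 * nb 2 = nb 2 := by
  apply crd.injective; rw [crd_mul]; simp only [crd_nb]; ext i; fin_cases i <;> simp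

theorem nb_mul_13 : nb 1 * nb 3 = nb 3 := by
  apply crd.injective; rw [crd_mul]; simp only [crd_nb]; ext i; fin_cases i <;> simp

theorem nb_mul_14 : nb 1 * nb 4 = nb 4 := by
  apply crd.injective; rw [crd_mul]; simp only [crd_nb]; ext i; fin_cases i <;> simp

theorem nb_mul_21 : nb 2 * nb 1 = -nb 2 := by
  apply crd.injective; rw [crd_mul, map_neg]; simp only [crd_nb]; ext i; fin_cases i <;> simp

theorem nb_mul_31 : nb 3 * nb 1 = -nb 3 := by
  apply crd.injective; rw [crd_mul, map_neg]; simp only [crd_nb]; ext i; fin_cases i <;> simp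

theorem nb_mul_41 : nb 4 * nb 1 = -nb 4 := by
  apply crd.injective; rw [crd_mul, map_neg]; simp only [crd_nb]; ext i; fin_cases i <;> simp

theorem nb_mul_23 : nb 2 * nb 3 = nb 7 := by
  apply crd.injective; rw [crd_mul]; simp only [crd_nb]; ext i; fin_cases i <;> simp

theorem nb_mul_34 : nb 3 * nb 4 = nb 5 := by
  apply crd.injective; rw [crd_mul]; simp only [crd_nb]; ext i; fin_cases i <;> simp

theorem nb_mul_42 : nb 4 * nb 2 = nb 6 := by
  apply crd.injective; rw [crd_mul]; simp only [crd_nb]; ext i; fin_cases i <;> simp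

theorem nb_mul_56 : nb 5 * nb 6 = nb 4 := by
  apply crd.injective; rw [crd_mul]; simp only [crd_nb]; ext i; fin_cases i <;> simp

theorem nb_mul_47_sub : nb 4 * nb 7 - nb 7 * nb 4 = -nb 1 := by
  apply crd.injective; rw [map_sub, map_neg, crd_mul, crd_mul]; simp only [crd_nb]
  ext i; fin_cases i <;> simp <;> norm_num

/-- Two linear endomorphisms that agree on the null basis are equal. -/
theorem clm_ext_nb {ξ η : SplitOct →L[ℝ] SplitOct} (h : ∀ i, ξ (nb i) = η (nb i)) : ξ = η := by
  ext1 x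
  rw [eq_sum_nb x, map_sum, map_sum]
  simp_rw [map_smul, h]

end SplitOct

theorem g2_map_one {ξ : SplitOct →L[ℝ] SplitOct} (hξ : ξ ∈ g2) : ξ 1 = 0 := by
  have h := hξ 1 1
  rw [SplitOct.mul_one', SplitOct.mul_one', SplitOct.one_mul'] at h
  simpa using h

theorem g2_map_ell {ξ : SplitOct →L[ℝ] SplitOct} (hξ : ξ ∈ g2) :
    crd (ξ (nb 1)) 0 = 0 ∧ crd (ξ (nb 1)) 1 = 0 := by
  have h := hξ (nb 1) (nb 1)
  rw [nb_mul_11, g2_map_one hξ] at h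
  have h := congrArg crd h
  have h0 := congrFun h 0
  have h1 := congrFun h 1
  simp [crd_mul, crd_nb] at h0 h1
  constructor <;> linarith

/-- A vector `x` with `ξ x = (ξ ℓ) x + ℓ ξ x` for an element of the positive null subspace, when
`ξ ℓ = 0`, has its image in the positive null subspace. -/
theorem crd_of_ell_eigen {y : SplitOct} (h₁ : nb 1 * y = y) (h₂ : y * nb 1 = -y) :
    crd y 0 = 0 ∧ crd y 1 = 0 ∧ crd y 5 = 0 ∧ crd y 6 = 0 ∧ crd y 7 = 0 := by
  have e := congrArg crd h₁
  have f := congrFun (congrArg crd h₂) 0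
  have e0 := congrFun e 0
  have e5 := congrFun e 5
  have e6 := congrFun e 6
  have e7 := congrFun e 7
  simp [crd_mul, crd_nb] at e0 e5 e6 e7 f
  refine ⟨?_, ?_, ?_, ?_, ?_⟩ <;> linarith

/-- A derivation with vanishing parameters is zero. -/
theorem g2_eq_zero {ξ : SplitOct →L[ℝ] SplitOct} (hξ : ξ ∈ g2)
    (h1 : ∀ i : Fin 6, crd (ξ (nb 1)) (i.natAdd 2) = 0)
    (h2 : crd (ξ (nb 2)) 2 = 0 ∧ crd (ξ (nb 2)) 3 = 0 ∧ crd (ξ (nb 2)) 4 = 0)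
    (h3 : crd (ξ (nb 3)) 2 = 0 ∧ crd (ξ (nb 3)) 3 = 0 ∧ crd (ξ (nb 3)) 4 = 0)
    (h4 : crd (ξ (nb 4)) 2 = 0 ∧ crd (ξ (nb 4)) 3 = 0) : ξ = 0 := by
  have z1 : ξ (nb 1) = 0 := by
    apply ext_crd
    intro i
    rw [map_zero, Pi.zero_apply]
    have := g2_map_ell hξ
    fin_cases i
    · exact this.1
    · exact this.2
    · exact h1 0
    · exact h1 1
    · exact h1 2
    · exact h1 3
    · exact h1 4
    · exact h1 5
  have zm : ∀ x : SplitOct, (0 : SplitOct) * x = 0 := fun x => by ext1 <;> simp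
  have mz : ∀ x : SplitOct, x * (0 : SplitOct) = 0 := fun x => by ext1 <;> simp
  have key : ∀ j, nb 1 * nb j = nb j → nb j * nb 1 = -nb j →
      crd (ξ (nb j)) 0 = 0 ∧ crd (ξ (nb j)) 1 = 0 ∧ crd (ξ (nb j)) 5 = 0 ∧
        crd (ξ (nb j)) 6 = 0 ∧ crd (ξ (nb j)) 7 = 0 := by
    intro j a b
    apply crd_of_ell_eigen
    · have h := hξ (nb 1) (nb j)
      rw [a, z1, zm, zero_add] at h
      exact h.symm
    · have h := hξ (nb j) (nb 1)
      rw [b, z1, mz, add_zero, map_neg] at h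
      exact h.symm
  obtain ⟨a0, a1, a5, a6, a7⟩ := key 2 nb_mul_12 nb_mul_21
  obtain ⟨b0, b1, b5, b6, b7⟩ := key 3 nb_mul_13 nb_mul_31
  obtain ⟨c0, c1, c5, c6, c7⟩ := key 4 nb_mul_14 nb_mul_41
  have z2 : ξ (nb 2) = 0 := by
    apply ext_crd; intro i; rw [map_zero, Pi.zero_apply]
    fin_cases i
    · exact a0
    · exact a1
    · exact h2.1
    · exact h2.2.1
    · exact h2.2.2
    all_goals assumption
  have z3 : ξ (nb 3) = 0 := by
    apply ext_crd; intro i; rw [map_zero, Pi.zero_apply]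
    fin_cases i
    · exact b0
    · exact b1
    · exact h3.1
    · exact h3.2.1
    · exact h3.2.2
    all_goals assumption
  -- The hypotheses say nothing about the last diagonal entry; multiplicativity has to show that it
  -- is minus the sum of the other two, hence zero.
  obtain ⟨m, hm⟩ : ∃ m : ℝ, ξ (nb 4) = m • nb 4 := by
    refine ⟨crd (ξ (nb 4)) 4, ?_⟩
    apply ext_crd; intro i
    have d2 := h4.1
    have d3 := h4.2
    rw [map_smul, crd_nb]
    fin_cases i <;> simp [*]
  have z7 : ξ (nb 7) = 0 := by rw [← nb_mul_23, hξ, z2, z3, zm, mz, add_zero]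
  have z5 : ξ (nb 5) = m • nb 5 := by
    rw [← nb_mul_34, hξ, z3, zm, zero_add, hm, SplitOct.mul_smul']
  have z6 : ξ (nb 6) = m • nb 6 := by
    rw [← nb_mul_42, hξ, z2, mz, add_zero, hm, SplitOct.smul_mul']
  -- `nb 5` and `nb 6` both have eigenvalue m, so their product `nb 4` has eigenvalue 2m as well as
  -- m.
  have hm0 : m = 0 := by
    have h := hξ (nb 5) (nb 6)
    rw [z5, z6, SplitOct.mul_smul', SplitOct.smul_mul', nb_mul_56, hm] at h
    have h := congrFun (congrArg crd h) 4
    simp [crd_nb] at h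
    linarith
  rw [hm0, zero_smul] at hm z5 z6
  apply clm_ext_nb
  intro i
  rw [zero_apply]
  fin_cases i
  · change ξ (nb 0) = 0
    rw [nb_zero]; exact g2_map_one hξ
  all_goals assumption

theorem der_add (h h' : Fin 2 → ℝ) (θ θ' : Fin 12 → ℝ) :
    der (h + h') (θ + θ') = der h θ + der h' θ' := by
  ext1 x
  apply ext_crd; intro i
  rw [add_apply, map_add, Pi.add_apply, crd_der, crd_der, crd_der]
  fin_cases i <;> simp <;> ring

theorem der_smul (c : ℝ) (h : Fin 2 → ℝ) (θ : Fin 12 → ℝ) :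
    der (c • h) (c • θ) = c • der h θ := by
  ext1 x
  apply ext_crd; intro i
  rw [smul_apply, map_smul, Pi.smul_apply, crd_der, crd_der]
  fin_cases i <;> simp <;> ring

/-- The linear map from parameters to derivations. -/
def derLin : ((Fin 2 ⊕ Fin 12) → ℝ) →ₗ[ℝ] g2 where
  toFun p := ⟨der (p ∘ Sum.inl) (p ∘ Sum.inr), der_mem _ _⟩
  map_add' _ _ := Subtype.ext (der_add _ _ _ _)
  map_smul' c _ := Subtype.ext (der_smul c _ _)

theorem crd_der_one (h : Fin 2 → ℝ) (θ : Fin 12 → ℝ) : crd (der h θ (nb 1)) =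
    ![0, 0, 2 * θ 0, 2 * θ 1, 2 * θ 2, 2 * θ 3, 2 * θ 4, 2 * θ 5] := by
  rw [crd_der, crd_nb]; simp

theorem crd_der_two (h : Fin 2 → ℝ) (θ : Fin 12 → ℝ) : crd (der h θ (nb 2)) =
    ![0, θ 3, h 0, θ 7, θ 9, 0, θ 2, -θ 1] := by
  rw [crd_der, crd_nb]; simp

theorem crd_der_three (h : Fin 2 → ℝ) (θ : Fin 12 → ℝ) : crd (der h θ (nb 3)) =
    ![0, θ 4, θ 6, h 1, θ 11, -θ 2, 0, θ 0] := by
  rw [crd_der, crd_nb]; simp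

theorem crd_der_four (h : Fin 2 → ℝ) (θ : Fin 12 → ℝ) : crd (der h θ (nb 4)) =
    ![0, θ 5, θ 8, θ 10, -(h 0 + h 1), θ 1, -θ 0, 0] := by
  rw [crd_der, crd_nb]; simp

theorem der_injective {h h' : Fin 2 → ℝ} {θ θ' : Fin 12 → ℝ} (e : der h θ = der h' θ') :
    h = h' ∧ θ = θ' := by
  have e1 := congrArg crd (congrArg (fun ξ => ξ (nb 1)) e)
  have e2 := congrArg crd (congrArg (fun ξ => ξ (nb 2)) e)
  have e3 := congrArg crd (congrArg (fun ξ => ξ (nb 3)) e)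
  have e4 := congrArg crd (congrArg (fun ξ => ξ (nb 4)) e)
  simp only [crd_der_one] at e1
  simp only [crd_der_two] at e2
  simp only [crd_der_three] at e3
  simp only [crd_der_four] at e4
  have f : ∀ {a b : ℝ}, 2 * a = 2 * b → a = b := fun h => mul_left_cancel₀ two_ne_zero h
  constructor
  · ext i
    fin_cases i
    · exact congrFun e2 2
    · exact congrFun e3 3
  · ext i
    fin_cases i
    · exact f (congrFun e1 2)
    · exact f (congrFun e1 3)
    · exact f (congrFun e1 4)
    · exact f (congrFun e1 5)
    · exact f (congrFun e1 6)
    · exact f (congrFun e1 7)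
    · exact congrFun e3 2
    · exact congrFun e2 3
    · exact congrFun e4 2
    · exact congrFun e2 4
    · exact congrFun e4 3
    · exact congrFun e3 4

/-- The parameters are read off from the images of `nb 1`, …, `nb 4`; the difference with the
resulting `der h θ` has vanishing parameters, so `g2_eq_zero` applies. -/
theorem exists_der {ξ : SplitOct →L[ℝ] SplitOct} (hξ : ξ ∈ g2) : ∃ h θ, ξ = der h θ := by
  obtain ⟨h, e2, e3⟩ : ∃ h : Fin 2 → ℝ, h 0 = crd (ξ (nb 2)) 2 ∧ h 1 = crd (ξ (nb 3)) 3 :=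
    ⟨![_, _], rfl, rfl⟩
  obtain ⟨θ, t0, t1, t2, t3, t4, t5, t6, t7, t8, t9, t10, t11⟩ : ∃ θ : Fin 12 → ℝ,
      θ 0 = crd (ξ (nb 1)) 2 / 2 ∧ θ 1 = crd (ξ (nb 1)) 3 / 2 ∧ θ 2 = crd (ξ (nb 1)) 4 / 2 ∧
      θ 3 = crd (ξ (nb 1)) 5 / 2 ∧ θ 4 = crd (ξ (nb 1)) 6 / 2 ∧ θ 5 = crd (ξ (nb 1)) 7 / 2 ∧
      θ 6 = crd (ξ (nb 3)) 2 ∧ θ 7 = crd (ξ (nb 2)) 3 ∧ θ 8 = crd (ξ (nb 4)) 2 ∧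
      θ 9 = crd (ξ (nb 2)) 4 ∧ θ 10 = crd (ξ (nb 4)) 3 ∧ θ 11 = crd (ξ (nb 3)) 4 :=
    ⟨![_, _, _, _, _, _, _, _, _, _, _, _], rfl, rfl, rfl, rfl, rfl, rfl, rfl, rfl, rfl, rfl, rfl,
      rfl⟩
  have key : ∀ i k, crd (ξ (nb i)) k = crd (der h θ (nb i)) k →
      crd ((ξ - der h θ) (nb i)) k = 0 := fun i k e => by
    rw [sub_apply, map_sub, Pi.sub_apply, e, sub_self]
  refine ⟨h, θ, ?_⟩
  rw [← sub_eq_zero]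
  apply g2_eq_zero (g2.sub_mem hξ (der_mem _ _))
  · intro i
    apply key
    rw [crd_der_one]
    fin_cases i
    · change crd (ξ (nb 1)) 2 = 2 * θ 0; linarith
    · change crd (ξ (nb 1)) 3 = 2 * θ 1; linarith
    · change crd (ξ (nb 1)) 4 = 2 * θ 2; linarith
    · change crd (ξ (nb 1)) 5 = 2 * θ 3; linarith
    · change crd (ξ (nb 1)) 6 = 2 * θ 4; linarith
    · change crd (ξ (nb 1)) 7 = 2 * θ 5; linarith
  · refine ⟨key _ _ ?_, key _ _ ?_, key _ _ ?_⟩ <;> rw [crd_der_two]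
    exacts [e2.symm, t7.symm, t9.symm]
  · refine ⟨key _ _ ?_, key _ _ ?_, key _ _ ?_⟩ <;> rw [crd_der_three]
    exacts [t6.symm, e3.symm, t11.symm]
  · refine ⟨key _ _ ?_, key _ _ ?_⟩ <;> rw [crd_der_four]
    exacts [t8.symm, t10.symm]

/-- The parametrization of `𝔤₂`. -/
def derEquiv : ((Fin 2 ⊕ Fin 12) → ℝ) ≃ₗ[ℝ] g2 :=
  LinearEquiv.ofBijective derLin ⟨fun p q e => by
    have := der_injective (congrArg Subtype.val e)
    ext (i | i)
    · exact congrFun this.1 i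
    · exact congrFun this.2 i, fun ξ => by
    obtain ⟨h, θ, e⟩ := exists_der ξ.2
    exact ⟨Sum.elim h θ, Subtype.ext e.symm⟩⟩

/-- The basis of `𝔤₂` consisting of two torus elements and twelve root vectors. -/
def g2Basis : Module.Basis (Fin 2 ⊕ Fin 12) ℝ g2 := Module.Basis.ofEquivFun derEquiv.symm

/-- The values of the roots on the torus element with parameters `h`. -/
def rootVal (h : Fin 2 → ℝ) : Fin 12 → ℝ :=
  ![h 0, h 1, -(h 0 + h 1), -h 0, -h 1, h 0 + h 1, h 0 - h 1, h 1 - h 0,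
    2 * h 0 + h 1, -(2 * h 0 + h 1), h 0 + 2 * h 1, -(h 0 + 2 * h 1)]

theorem lie_torus (h h' : Fin 2 → ℝ) (θ : Fin 12 → ℝ) :
    ⁅der h 0, der h' θ⁆ = der 0 (fun i => rootVal h i * θ i) := by
  ext1 x
  apply ext_crd; intro i
  rw [Ring.lie_def, sub_apply, map_sub, Pi.sub_apply, mul_apply_eq_comp, mul_apply_eq_comp]
  simp only [crd_der]
  fin_cases i <;> simp [rootVal] <;> ring

/-! ### Lie algebras with a basis of root vectors -/

/-- A basis of a Lie algebra consisting of a basis of an abelian subalgebra `H` and of root vectors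
for pairwise distinct nonzero roots spanning the dual of `H`, each of which pairs with another one
to an element of `H` on which the root does not vanish. -/
structure IsRootBasis {L κ ι : Type*} [LieRing L] [LieAlgebra ℝ L]
    (b : Module.Basis (κ ⊕ ι) ℝ L) (H : LieSubalgebra ℝ L) (β : ι → Module.Dual ℝ H) : Prop where
  eq_span : H.toSubmodule = Submodule.span ℝ (Set.range fun k => b (Sum.inl k))
  comm : ∀ T T' : H, ⁅(T : L), (T' : L)⁆ = 0
  root : ∀ i (T : H), ⁅(T : L), b (Sum.inr i)⁆ = β i T • b (Sum.inr i)
  regular : ∃ T₀ : H, (∀ i, β i T₀ ≠ 0) ∧ Function.Injective fun i => β i T₀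
  copair : ∀ i, ∃ (j : ι) (T : H), ⁅b (Sum.inr i), b (Sum.inr j)⁆ = (T : L) ∧ β i T ≠ 0
  faithful : ∀ T : H, (∀ i, β i T = 0) → T = 0

namespace IsRootBasis

variable {L κ ι : Type*} [LieRing L] [LieAlgebra ℝ L]
  {b : Module.Basis (κ ⊕ ι) ℝ L} {H : LieSubalgebra ℝ L} {β : ι → Module.Dual ℝ H}

theorem inl_mem (hb : IsRootBasis b H β) (k : κ) : b (Sum.inl k) ∈ H := by
  change b (Sum.inl k) ∈ H.toSubmodule
  rw [hb.eq_span]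
  exact Submodule.subset_span ⟨k, rfl⟩

/-- Invariance moves a regular T₀ from one argument to the other: [T,T₀] = 0 on one side, a nonzero
multiple of the root vector on the other. -/
theorem killingForm_torus_root (hb : IsRootBasis b H β) (T : H) (j : ι) :
    killingForm ℝ L T (b (Sum.inr j)) = 0 := by
  obtain ⟨T₀, h0, -⟩ := hb.regular
  have h := LieModule.traceForm_apply_lie_apply ℝ L L (T : L) (T₀ : L) (b (Sum.inr j))
  rw [hb.comm, hb.root, map_zero, LinearMap.zero_apply, map_smul, smul_eq_mul] at h
  exact (mul_eq_zero.1 h.symm).resolve_left (h0 j)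

/-- By invariance, root vectors can pair nontrivially only if their roots are opposite. -/
theorem killingForm_root_root (hb : IsRootBasis b H β) (T : H) (i j : ι) :
    (β i T + β j T) * killingForm ℝ L (b (Sum.inr i)) (b (Sum.inr j)) = 0 := by
  have h := LieModule.traceForm_apply_lie_apply ℝ L L (b (Sum.inr i)) (T : L) (b (Sum.inr j))
  rw [← lie_skew, hb.root, hb.root, map_neg, LinearMap.neg_apply, map_smul, LinearMap.smul_apply,
    map_smul, smul_eq_mul, smul_eq_mul] at h
  change (β i T + β j T) * LieModule.traceForm ℝ L L _ _ = 0
  linarith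

variable [Fintype κ] [Fintype ι]

theorem mem_iff (hb : IsRootBasis b H β) (X : L) : X ∈ H ↔ ∀ i, b.repr X (Sum.inr i) = 0 := by
  classical
  constructor
  · intro hX i
    change X ∈ H.toSubmodule at hX
    rw [hb.eq_span] at hX
    have : Submodule.span ℝ (Set.range fun k => b (Sum.inl k)) ≤
        LinearMap.ker (b.coord (Sum.inr i)) := by
      rw [Submodule.span_le]
      rintro _ ⟨k, rfl⟩
      simp
    exact this hX
  · intro h
    rw [← b.sum_repr X, Fintype.sum_sum_type]
    refine H.toSubmodule.add_mem (H.toSubmodule.sum_mem fun k _ => ?_)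
      (H.toSubmodule.sum_mem fun i _ => ?_)
    · exact H.toSubmodule.smul_mem _ (hb.inl_mem k)
    · rw [h i, zero_smul]; exact H.toSubmodule.zero_mem

theorem lie_eq_sum (hb : IsRootBasis b H β) (T : H) (X : L) :
    ⁅(T : L), X⁆ = ∑ i, (β i T * b.repr X (Sum.inr i)) • b (Sum.inr i) := by
  conv_lhs => rw [← b.sum_repr X, Fintype.sum_sum_type]
  rw [lie_add, lie_sum, lie_sum]
  rw [Finset.sum_eq_zero, zero_add]
  · refine Finset.sum_congr rfl fun i _ => ?_
    rw [lie_smul, hb.root, smul_smul, mul_comm]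
  · intro k _
    rw [lie_smul, hb.comm T ⟨_, hb.inl_mem k⟩, smul_zero]

theorem repr_lie_inr (hb : IsRootBasis b H β) (T : H) (X : L) (i : ι) :
    b.repr ⁅(T : L), X⁆ (Sum.inr i) = β i T * b.repr X (Sum.inr i) := by
  classical
  rw [hb.lie_eq_sum, map_sum, Finsupp.finsetSum_apply, Finset.sum_eq_single i]
  · simp
  · intro j _ hj
    simp [hj]
  · simp

theorem repr_lie_inl (hb : IsRootBasis b H β) (T : H) (X : L) (k : κ) :
    b.repr ⁅(T : L), X⁆ (Sum.inl k) = 0 := by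
  classical
  rw [hb.lie_eq_sum, map_sum, Finsupp.finsetSum_apply]
  exact Finset.sum_eq_zero fun i _ => by simp

/-- A regular T₀ has pairwise distinct nonzero eigenvalues on the root vectors and zero on the
torus, so its eigenspace for one root is already a line. -/
theorem rootSp_eq (hb : IsRootBasis b H β) (i : ι) :
    rootSp H (β i) = Submodule.span ℝ {b (Sum.inr i)} := by
  classical
  apply le_antisymm
  · intro X hX
    obtain ⟨T₀, h0, h1⟩ := hb.regular
    have hX := hX T₀
    rw [Submodule.mem_span_singleton]
    refine ⟨b.repr X (Sum.inr i), ?_⟩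
    apply b.repr.injective
    ext (k | j)
    · have e := hb.repr_lie_inl T₀ X k
      rw [hX] at e
      have : b.repr X (Sum.inl k) = 0 := by simpa [h0 i] using e
      simp [this]
    · have e := hb.repr_lie_inr T₀ X j
      rw [hX] at e
      by_cases hj : j = i
      · subst hj; simp
      · have h2 : (β i T₀ - β j T₀) * b.repr X (Sum.inr j) = 0 := by
          rw [sub_mul, sub_eq_zero]; simpa using e
        have h3 : b.repr X (Sum.inr j) = 0 := by
          refine (mul_eq_zero.1 h2).resolve_left fun h => hj (h1 ?_)
          exact (sub_eq_zero.1 h).symm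
        simp [h3, Ne.symm hj]
  · rw [Submodule.span_le, Set.singleton_subset_iff]
    exact fun T => hb.root i T

theorem finrank_rootSp (hb : IsRootBasis b H β) (i : ι) :
    Module.finrank ℝ (rootSp H (β i)) = 1 := by
  rw [hb.rootSp_eq]
  exact finrank_span_singleton (b.ne_zero _)

/-- An abelian H is nilpotent, and an X normalizing it has [T₀,X] ∈ H; each root coordinate of
[T₀,X] is a nonzero multiple of that of X, so X ∈ H. -/
theorem isCartanSubalgebra (hb : IsRootBasis b H β) : H.IsCartanSubalgebra where
  nilpotent := by
    have : IsLieAbelian H := ⟨fun T T' => Subtype.ext (hb.comm T T')⟩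
    infer_instance
  self_normalizing := by
    apply le_antisymm
    · intro X hX
      rw [LieSubalgebra.mem_normalizer_iff'] at hX
      obtain ⟨T₀, h0, -⟩ := hb.regular
      rw [hb.mem_iff]
      intro i
      have := (hb.mem_iff _).1 (hX T₀ T₀.2) i
      rw [hb.repr_lie_inr] at this
      exact (mul_eq_zero.1 this).resolve_left (h0 i)
    · exact LieSubalgebra.le_normalizer H

/-- In the root basis ad T is diagonal, with real eigenvalues. Hence the form is a sum of squares on
H, which is what `isKilling` exploits twice. -/
theorem killingForm_torus (hb : IsRootBasis b H β) (T T' : H) :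
    killingForm ℝ L T T' = ∑ i, β i T * β i T' := by
  classical
  rw [LieModule.traceForm_apply_apply, LinearMap.trace_eq_matrix_trace ℝ b, Matrix.trace,
    Fintype.sum_sum_type, Finset.sum_eq_zero, zero_add]
  · refine Finset.sum_congr rfl fun i _ => ?_
    simp [LinearMap.toMatrix_apply, hb.root, mul_comm]
  · intro k _
    simp [LinearMap.toMatrix_apply, hb.repr_lie_inl]

/-- An element of the radical is tested against the root vector paired with `b i`: only the i-th
root coordinate contributes, so it vanishes and the element lies in H. There the Killing form is
positive definite, because the roots separate the points of H. -/
theorem isKilling (hb : IsRootBasis b H β) : LieAlgebra.IsKilling ℝ L where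
  killingCompl_top_eq_bot := by
    classical
    rw [eq_bot_iff]
    intro X hX
    rw [LieIdeal.mem_killingCompl] at hX
    have hX : ∀ Y, killingForm ℝ L X Y = 0 := fun Y => by
      rw [LieModule.traceForm_comm]; exact hX Y (LieSubmodule.mem_top Y)
    obtain ⟨T₀, h0, h1⟩ := hb.regular
    have hXH : X ∈ H := by
      rw [hb.mem_iff]
      intro i
      obtain ⟨j, T, hT, hne⟩ := hb.copair i
      have hT0 : (T : L) ≠ 0 := fun h => hne (by rw [show T = 0 from Subtype.ext h, map_zero])
      -- The nonzero bracket T of the two root vectors commutes with H, but it would also have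
      -- weight βᵢ + βⱼ.
      have hopp : ∀ T' : H, β i T' + β j T' = 0 := fun T' => by
        have h := leibniz_lie (T' : L) (b (Sum.inr i)) (b (Sum.inr j))
        rw [hT, hb.comm, hb.root, hb.root, lie_smul, smul_lie, hT, ← add_smul] at h
        exact (smul_eq_zero.1 h.symm).resolve_right hT0
      -- Invariance gives κ(T,T) = βᵢ(T) κ(bᵢ,bⱼ), while κ(T,T) is a sum of squares containing
      -- βᵢ(T)² ≠ 0.
      have hκ : killingForm ℝ L (b (Sum.inr i)) (b (Sum.inr j)) ≠ 0 := fun h => by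
        have e := LieModule.traceForm_apply_lie_apply ℝ L L (T : L) (b (Sum.inr i)) (b (Sum.inr j))
        rw [hT, hb.root, map_smul, LinearMap.smul_apply] at e
        have e2 := hb.killingForm_torus T T
        have e1 : killingForm ℝ L (T : L) (T : L) = 0 :=
          e.symm.trans ((congrArg (β i T • ·) h).trans (smul_zero _))
        rw [e1] at e2
        have e3 := (Finset.sum_eq_zero_iff_of_nonneg fun i _ => mul_self_nonneg (β i T)).1 e2.symm i
          (Finset.mem_univ i)
        exact hne (mul_self_eq_zero.1 e3)
      have e := hX (b (Sum.inr j))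
      conv_lhs at e => rw [← b.sum_repr X, Fintype.sum_sum_type]
      rw [map_add, map_sum, map_sum, LinearMap.add_apply, LinearMap.sum_apply, LinearMap.sum_apply,
        Finset.sum_eq_zero, zero_add, Finset.sum_eq_single i] at e
      · rw [map_smul, LinearMap.smul_apply, smul_eq_mul] at e
        exact (mul_eq_zero.1 e).resolve_right hκ
      · intro k _ hk
        rw [map_smul, LinearMap.smul_apply]
        rw [(mul_eq_zero.1 (hb.killingForm_root_root T₀ k j)).resolve_left, smul_zero]
        intro h
        apply hk
        apply h1
        have := hopp T₀
        change β k T₀ = β i T₀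
        linarith
      · simp
      · intro k _
        rw [map_smul, LinearMap.smul_apply, hb.killingForm_torus_root ⟨_, hb.inl_mem k⟩, smul_zero]
    rw [LieSubmodule.mem_bot]
    have h2 : (⟨X, hXH⟩ : H) = 0 := by
      apply hb.faithful
      intro i
      have e := hb.killingForm_torus ⟨X, hXH⟩ ⟨X, hXH⟩
      rw [hX] at e
      exact mul_self_eq_zero.1 ((Finset.sum_eq_zero_iff_of_nonneg
        fun i _ => mul_self_nonneg (β i ⟨X, hXH⟩)).1 e.symm i (Finset.mem_univ i))
    exact congrArg Subtype.val h2

theorem le_ker_coord (hb : IsRootBasis b H β) (j : ι) :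
    H.toSubmodule ≤ LinearMap.ker (b.coord (Sum.inr j)) := fun X hX =>
  (hb.mem_iff X).1 hX j

theorem rootSp_le_ker_coord (hb : IsRootBasis b H β) {i j : ι} (hij : i ≠ j) :
    rootSp H (β i) ≤ LinearMap.ker (b.coord (Sum.inr j)) := by
  classical
  rw [hb.rootSp_eq, Submodule.span_le, Set.singleton_subset_iff]
  simp [hij]

theorem mem_of_coord (hb : IsRootBasis b H β) {N : Submodule ℝ L} (hH : H.toSubmodule ≤ N) {X : L}
    (h : ∀ i, b.repr X (Sum.inr i) = 0 ∨ rootSp H (β i) ≤ N) : X ∈ N := by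
  rw [← b.sum_repr X, Fintype.sum_sum_type]
  refine N.add_mem (N.sum_mem fun k _ => N.smul_mem _ (hH (hb.inl_mem k)))
    (N.sum_mem fun i _ => ?_)
  rcases h i with h | h
  · rw [h, zero_smul]; exact N.zero_mem
  · exact N.smul_mem _ (h fun T => hb.root i T)

end IsRootBasis

/-! ### The root diagram of the derivation algebra -/

theorem der_zero : der 0 0 = 0 := by
  have := der_smul 0 0 0
  simpa only [zero_smul] using this

theorem lie_torus_torus (h h' : Fin 2 → ℝ) : ⁅der h 0, der h' 0⁆ = 0 := by
  rw [lie_torus]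
  convert der_zero using 2
  ext i
  simp

/-- The parameters of the torus part of a derivation. -/
def torusCoord : g2 →ₗ[ℝ] (Fin 2 → ℝ) :=
  LinearMap.funLeft ℝ ℝ Sum.inl ∘ₗ derEquiv.symm.toLinearMap

/-- The parameters of the root vector part of a derivation. -/
def rootCoord : g2 →ₗ[ℝ] (Fin 12 → ℝ) :=
  LinearMap.funLeft ℝ ℝ Sum.inr ∘ₗ derEquiv.symm.toLinearMap

theorem der_coord (ξ : g2) : der (torusCoord ξ) (rootCoord ξ) = ξ :=
  congrArg Subtype.val (derEquiv.apply_symm_apply ξ)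

theorem coord_der {h : Fin 2 → ℝ} {θ : Fin 12 → ℝ} {ξ : g2}
    (e : (ξ : SplitOct →L[ℝ] SplitOct) = der h θ) : torusCoord ξ = h ∧ rootCoord ξ = θ :=
  der_injective ((der_coord ξ).trans e)

/-- The diagonal Cartan subalgebra. -/
def torus : LieSubalgebra ℝ g2 where
  toSubmodule := LinearMap.ker rootCoord
  lie_mem' {ξ η} hξ hη := by
    have hξ : rootCoord ξ = 0 := hξ
    have hη : rootCoord η = 0 := hη
    have : ⁅ξ, η⁆ = 0 := by
      apply Subtype.ext
      change ⁅(ξ : SplitOct →L[ℝ] SplitOct), (η : SplitOct →L[ℝ] SplitOct)⁆ = 0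
      rw [← der_coord ξ, ← der_coord η, hξ, hη, lie_torus_torus]
    change rootCoord ⁅ξ, η⁆ = 0
    rw [this, map_zero]

theorem torus_coe (T : torus) :
    ((T : g2) : SplitOct →L[ℝ] SplitOct) = der (torusCoord T) 0 := by
  conv_lhs => rw [← der_coord (T : g2)]
  exact congrArg _ T.2

/-- The coordinates on the Cartan subalgebra, as linear forms. -/
def torusForm (k : Fin 2) : Module.Dual ℝ torus :=
  LinearMap.proj k ∘ₗ torusCoord ∘ₗ torus.toSubmodule.subtype

/-- The short roots. -/
def shortRoot : Fin 3 → Module.Dual ℝ torus :=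
  ![-torusForm 1, torusForm 0, -(torusForm 0 + torusForm 1)]

/-- The long roots. -/
def longRoot : Fin 3 → Module.Dual ℝ torus :=
  ![shortRoot 1 - shortRoot 2, shortRoot 0 + shortRoot 2, shortRoot 0 + shortRoot 1]

/-- All roots, in the order of the parameters of root vectors. -/
def allRoot : Fin 12 → Module.Dual ℝ torus :=
  ![shortRoot 1, -shortRoot 0, shortRoot 2, -shortRoot 1, shortRoot 0, -shortRoot 2,
    longRoot 2, -longRoot 2, longRoot 0, -longRoot 0, -longRoot 1, longRoot 1]

theorem allRoot_apply (i : Fin 12) (T : torus) : allRoot i T = rootVal (torusCoord T) i := by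
  have e : ∀ k, torusForm k T = torusCoord T k := fun _ => rfl
  fin_cases i <;> simp [allRoot, rootVal, longRoot, shortRoot, e] <;> ring

/-- The element of the Cartan subalgebra with given coordinates. -/
def torusMk (h : Fin 2 → ℝ) : torus :=
  ⟨⟨der h 0, der_mem h 0⟩, (coord_der rfl).2⟩

theorem torusCoord_torusMk (h : Fin 2 → ℝ) : torusCoord (torusMk h) = h := (coord_der rfl).1

theorem g2Basis_repr_inr (ξ : g2) (i : Fin 12) :
    g2Basis.repr ξ (Sum.inr i) = rootCoord ξ i := rfl

theorem g2Basis_repr_inl (ξ : g2) (k : Fin 2) :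
    g2Basis.repr ξ (Sum.inl k) = torusCoord ξ k := rfl

theorem g2Basis_inr (i : Fin 12) :
    (g2Basis (Sum.inr i) : SplitOct →L[ℝ] SplitOct) = der 0 (Pi.single i 1) := by
  rw [← der_coord]
  congr 1
  · ext k
    rw [← g2Basis_repr_inl, Module.Basis.repr_self]; simp
  · ext j
    rw [← g2Basis_repr_inr, Module.Basis.repr_self]; simp [Finsupp.single_apply, Pi.single_apply,
      eq_comm]

/-- The index of the opposite root. -/
def oppIdx : Fin 12 → Fin 12 := ![3, 4, 5, 0, 1, 2, 7, 6, 9, 8, 11, 10]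

theorem allRoot_oppIdx (i : Fin 12) (T : torus) : allRoot (oppIdx i) T = -allRoot i T := by
  rw [allRoot_apply, allRoot_apply]
  fin_cases i <;> simp [rootVal, oppIdx]

theorem torusCoord_apply (ξ : g2) : torusCoord ξ =
    ![crd ((ξ : SplitOct →L[ℝ] SplitOct) (nb 2)) 2,
      crd ((ξ : SplitOct →L[ℝ] SplitOct) (nb 3)) 3] := by
  ext k
  rw [← der_coord ξ, crd_der_two, crd_der_three]
  fin_cases k <;> rfl

/-- These are, up to positive or negative factors, the coroots; all that matters later is that no
root vanishes on its own entry of the list. -/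
theorem torusCoord_opposite (i : Fin 12) :
    torusCoord ⁅g2Basis (Sum.inr i), g2Basis (Sum.inr (oppIdx i))⁆ =
      ![![2, -1], ![-1, 2], ![-1, -1], ![-2, 1], ![1, -2], ![1, 1], ![1, -1], ![-1, 1],
        ![1, 0], ![-1, 0], ![0, 1], ![0, -1]] i := by
  rw [torusCoord_apply]
  change ![crd (⁅(g2Basis (Sum.inr i) : SplitOct →L[ℝ] SplitOct),
    (g2Basis (Sum.inr (oppIdx i)) : SplitOct →L[ℝ] SplitOct)⁆ (nb 2)) 2,
    crd (⁅(g2Basis (Sum.inr i) : SplitOct →L[ℝ] SplitOct),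
    (g2Basis (Sum.inr (oppIdx i)) : SplitOct →L[ℝ] SplitOct)⁆ (nb 3)) 3] = _
  rw [g2Basis_inr, g2Basis_inr, Ring.lie_def, sub_apply, sub_apply, map_sub, map_sub, Pi.sub_apply,
    Pi.sub_apply, mul_apply_eq_comp, mul_apply_eq_comp, mul_apply_eq_comp, mul_apply_eq_comp]
  rw [crd_der _ _ (der _ _ _), crd_der _ _ (der _ _ _), crd_der _ _ (der _ _ _),
    crd_der _ _ (der _ _ _), crd_der_two, crd_der_two, crd_der_three, crd_der_three]
  fin_cases i <;> simp [oppIdx]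

theorem lie_torus_g2Basis (T : torus) (i : Fin 12) :
    ⁅(T : g2), g2Basis (Sum.inr i)⁆ = allRoot i T • g2Basis (Sum.inr i) := by
  apply Subtype.ext
  change ⁅((T : g2) : SplitOct →L[ℝ] SplitOct), (g2Basis (Sum.inr i) : SplitOct →L[ℝ] SplitOct)⁆ =
    allRoot i T • (g2Basis (Sum.inr i) : SplitOct →L[ℝ] SplitOct)
  rw [torus_coe, g2Basis_inr, lie_torus, ← der_smul, smul_zero, allRoot_apply]
  congr 1
  ext j
  by_cases hj : j = i
  · subst hj; simp
  · simp [hj]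

theorem mem_torus {ξ : g2} : ξ ∈ torus ↔ rootCoord ξ = 0 := Iff.rfl

theorem torus_comm (T T' : torus) : ⁅(T : g2), (T' : g2)⁆ = 0 := by
  apply Subtype.ext
  change ⁅((T : g2) : SplitOct →L[ℝ] SplitOct), ((T' : g2) : SplitOct →L[ℝ] SplitOct)⁆ = 0
  rw [torus_coe, torus_coe, lie_torus_torus]

theorem rootCoord_lie_torus (T : torus) (ξ : g2) :
    rootCoord ⁅(T : g2), ξ⁆ = fun i => rootVal (torusCoord T) i * rootCoord ξ i := by
  have h0 : ⁅(T : g2), ξ⁆ = ∑ i, (allRoot i T * rootCoord ξ i) • g2Basis (Sum.inr i) := by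
    conv_lhs => rw [← g2Basis.sum_repr ξ, Fintype.sum_sum_type]
    rw [lie_add, lie_sum, lie_sum, Finset.sum_eq_zero, zero_add]
    · refine Finset.sum_congr rfl fun i _ => ?_
      rw [lie_smul, lie_torus_g2Basis, smul_smul, mul_comm, g2Basis_repr_inr]
    · intro k _
      have hk : g2Basis (Sum.inl k) ∈ torus := by
        rw [mem_torus]; ext j
        rw [← g2Basis_repr_inr, Module.Basis.repr_self]; simp
      rw [lie_smul, torus_comm T ⟨_, hk⟩, smul_zero]
  ext j
  rw [h0, ← g2Basis_repr_inr, map_sum, Finsupp.finsetSum_apply, Finset.sum_eq_single j]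
  · simp [allRoot_apply]
  · intro i _ hi
    simp [hi]
  · simp

/-- The bracket has weight zero under the torus element (1,3), on which all roots are nonzero, so
its root coordinates vanish; no bracket needs to be computed. -/
theorem lie_opposite_mem (i : Fin 12) :
    ⁅g2Basis (Sum.inr i), g2Basis (Sum.inr (oppIdx i))⁆ ∈ torus := by
  rw [mem_torus]
  have h : ⁅(torusMk ![1, 3] : g2), ⁅g2Basis (Sum.inr i), g2Basis (Sum.inr (oppIdx i))⁆⁆ = 0 := by
    rw [leibniz_lie, lie_torus_g2Basis, lie_torus_g2Basis, lie_smul, smul_lie, allRoot_oppIdx,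
      ← add_smul, add_neg_cancel, zero_smul]
  have e := rootCoord_lie_torus (torusMk ![1, 3])
    ⁅g2Basis (Sum.inr i), g2Basis (Sum.inr (oppIdx i))⁆
  rw [h, map_zero, torusCoord_torusMk] at e
  ext j
  have ej := congrFun e j
  refine (mul_eq_zero.1 ej.symm).resolve_left ?_
  fin_cases j <;> norm_num [rootVal]

theorem isRootBasis_g2 : IsRootBasis g2Basis torus allRoot where
  eq_span := by
    apply le_antisymm
    · intro ξ hξ
      rw [← g2Basis.sum_repr ξ, Fintype.sum_sum_type]
      refine add_mem (sum_mem fun k _ => Submodule.smul_mem _ _ (Submodule.subset_span ⟨k, rfl⟩))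
        (sum_mem fun i _ => ?_)
      rw [g2Basis_repr_inr, (mem_torus.1 hξ : rootCoord ξ = 0), Pi.zero_apply, zero_smul]
      exact zero_mem _
    · rw [Submodule.span_le]
      rintro _ ⟨k, rfl⟩
      change rootCoord _ = 0
      ext j
      rw [← g2Basis_repr_inr, Module.Basis.repr_self]; simp
  comm := torus_comm
  root i T := lie_torus_g2Basis T i
  regular := by
    -- The twelve roots take the values ±1, ±2, ±3, ±4, ±5, ±7 here, nonzero and pairwise distinct.
    refine ⟨torusMk ![1, 3], ?_, ?_⟩
    · intro i
      rw [allRoot_apply, torusCoord_torusMk]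
      fin_cases i <;> norm_num [rootVal]
    · have e : (fun i => allRoot i (torusMk ![1, 3])) =
          fun i => ((![1, 3, -4, -1, -3, 4, -2, 2, 5, -5, 7, -7] i : ℤ) : ℝ) := by
        ext i
        rw [allRoot_apply, torusCoord_torusMk]
        fin_cases i <;> norm_num [rootVal]
      rw [e]
      exact Int.cast_injective.comp (by decide)
  copair i := by
    refine ⟨oppIdx i, ⟨_, lie_opposite_mem i⟩, rfl, ?_⟩
    rw [allRoot_apply]
    change rootVal (torusCoord ⁅g2Basis (Sum.inr i), g2Basis (Sum.inr (oppIdx i))⁆) i ≠ 0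
    rw [torusCoord_opposite]
    fin_cases i <;> norm_num [rootVal]
  faithful T hT := by
    have h0 := hT 0
    have h1 := hT 1
    rw [allRoot_apply] at h0 h1
    apply Subtype.ext
    apply Subtype.ext
    rw [torus_coe]
    have : torusCoord (T : g2) = 0 := by
      ext k
      fin_cases k
      · exact h0
      · exact h1
    rw [this]
    exact der_zero

theorem isG2Diagram : IsG2Diagram torus shortRoot longRoot where
  semisimple := isRootBasis_g2.isKilling
  cartan := isRootBasis_g2.isCartanSubalgebra
  rank := by
    have e : torus.toSubmodule = Submodule.span ℝ (Set.range fun k => g2Basis (Sum.inl k)) :=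
      isRootBasis_g2.eq_span
    change Module.finrank ℝ torus.toSubmodule = 2
    rw [e]
    exact (finrank_span_eq_card
      (g2Basis.linearIndependent.comp _ Sum.inl_injective)).trans (by simp)
  dim := (Module.finrank_eq_card_basis g2Basis).trans (by simp)
  indep := by
    rw [LinearIndependent.pair_iff]
    intro s t h
    have h1 := LinearMap.congr_fun h (torusMk ![1, 0])
    have h2 := LinearMap.congr_fun h (torusMk ![0, 1])
    have e : ∀ k T, torusForm k T = torusCoord T k := fun _ _ => rfl
    simp [shortRoot, e, torusCoord_torusMk] at h1 h2
    constructor <;> linarith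
  rel_short := by
    ext T
    simp [shortRoot]
  rel_long₀ := rfl
  rel_long₁ := rfl
  rel_long₂ := rfl
  short_pos i := by
    fin_cases i
    · exact isRootBasis_g2.finrank_rootSp 4
    · exact isRootBasis_g2.finrank_rootSp 0
    · exact isRootBasis_g2.finrank_rootSp 2
  short_neg i := by
    fin_cases i
    · exact isRootBasis_g2.finrank_rootSp 1
    · exact isRootBasis_g2.finrank_rootSp 3
    · exact isRootBasis_g2.finrank_rootSp 5
  long_pos i := by
    fin_cases i
    · exact isRootBasis_g2.finrank_rootSp 8
    · exact isRootBasis_g2.finrank_rootSp 11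
    · exact isRootBasis_g2.finrank_rootSp 6
  long_neg i := by
    fin_cases i
    · exact isRootBasis_g2.finrank_rootSp 9
    · exact isRootBasis_g2.finrank_rootSp 10
    · exact isRootBasis_g2.finrank_rootSp 7
  span := by
    rw [eq_top_iff]
    intro X _
    have key : ∀ i, rootSp torus (shortRoot i) ⊔ rootSp torus (-shortRoot i) ⊔
        rootSp torus (longRoot i) ⊔ rootSp torus (-longRoot i) ≤ torus.toSubmodule ⊔
        (⨆ i, rootSp torus (shortRoot i) ⊔ rootSp torus (-shortRoot i) ⊔
          rootSp torus (longRoot i) ⊔ rootSp torus (-longRoot i)) := fun i =>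
      le_sup_of_le_right (le_iSup (fun i => rootSp torus (shortRoot i) ⊔
        rootSp torus (-shortRoot i) ⊔ rootSp torus (longRoot i) ⊔ rootSp torus (-longRoot i)) i)
    have k1 := fun i => (le_sup_left.trans (le_sup_left.trans le_sup_left)).trans (key i)
    have k2 := fun i => (le_sup_right.trans (le_sup_left.trans le_sup_left)).trans (key i)
    have k3 := fun i => (le_sup_right.trans le_sup_left).trans (key i)
    have k4 := fun i => le_sup_right.trans (key i)
    refine isRootBasis_g2.mem_of_coord le_sup_left fun i => Or.inr ?_
    fin_cases i
    · exact k1 1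
    · exact k2 0
    · exact k1 2
    · exact k2 1
    · exact k1 0
    · exact k2 2
    · exact k3 2
    · exact k4 2
    · exact k3 0
    · exact k4 0
    · exact k4 1
    · exact k3 1

/-- The indices 2, 3, 4, 9, 11 are those of the roots σ₂, -σ₁, σ₀, -l₀, l₁ (numbered from zero), the
ones missing from 𝔭. -/
theorem mem_parabolic (ξ : g2) : ξ ∈ parabolic torus shortRoot longRoot ↔
    rootCoord ξ 2 = 0 ∧ rootCoord ξ 3 = 0 ∧ rootCoord ξ 4 = 0 ∧ rootCoord ξ 9 = 0 ∧
      rootCoord ξ 11 = 0 := by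
  constructor
  · intro h
    have key : ∀ j ∈ ({2, 3, 4, 9, 11} : Finset (Fin 12)), parabolic torus shortRoot longRoot ≤
        LinearMap.ker (g2Basis.coord (Sum.inr j)) := by
      intro j hj
      have r : ∀ i, i ≠ j → rootSp torus (allRoot i) ≤
        LinearMap.ker (g2Basis.coord (Sum.inr j)) := fun i hij =>
          isRootBasis_g2.rootSp_le_ker_coord hij
      refine sup_le (sup_le (sup_le (sup_le (sup_le (sup_le (sup_le
        (isRootBasis_g2.le_ker_coord j) ?_) ?_) ?_) ?_) ?_) ?_) ?_
      · exact r 1 (by rintro rfl; revert hj; decide)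
      · exact r 0 (by rintro rfl; revert hj; decide)
      · exact r 5 (by rintro rfl; revert hj; decide)
      · exact r 8 (by rintro rfl; revert hj; decide)
      · exact r 10 (by rintro rfl; revert hj; decide)
      · exact r 6 (by rintro rfl; revert hj; decide)
      · exact r 7 (by rintro rfl; revert hj; decide)
    exact ⟨key 2 (by decide) h, key 3 (by decide) h, key 4 (by decide) h, key 9 (by decide) h,
      key 11 (by decide) h⟩
  · rintro ⟨h2, h3, h4, h9, h11⟩
    refine isRootBasis_g2.mem_of_coord ?_ fun i => ?_
    · unfold parabolic
      simp only [sup_assoc]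
      exact le_sup_left
    · fin_cases i
      · exact Or.inr (le_sup_of_le_left (le_sup_of_le_left (le_sup_of_le_left (le_sup_of_le_left
          (le_sup_of_le_left le_sup_right)))))
      · exact Or.inr (le_sup_of_le_left (le_sup_of_le_left (le_sup_of_le_left (le_sup_of_le_left
          (le_sup_of_le_left (le_sup_of_le_left le_sup_right))))))
      · exact Or.inl h2
      · exact Or.inl h3
      · exact Or.inl h4
      · exact Or.inr (le_sup_of_le_left (le_sup_of_le_left (le_sup_of_le_left (le_sup_of_le_left
          le_sup_right))))
      · exact Or.inr (le_sup_of_le_left le_sup_right)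
      · exact Or.inr le_sup_right
      · exact Or.inr (le_sup_of_le_left (le_sup_of_le_left (le_sup_of_le_left le_sup_right)))
      · exact Or.inl h9
      · exact Or.inr (le_sup_of_le_left (le_sup_of_le_left le_sup_right))
      · exact Or.inl h11

/-- Compared with 𝔭, the coordinates 3 and 4, of the roots -σ₁ and σ₀, are released. -/
theorem mem_planeW (ξ : g2) : ξ ∈ planeW torus shortRoot longRoot ↔
    rootCoord ξ 2 = 0 ∧ rootCoord ξ 9 = 0 ∧ rootCoord ξ 11 = 0 := by
  constructor
  · intro h
    have key : ∀ j ∈ ({2, 9, 11} : Finset (Fin 12)), planeW torus shortRoot longRoot ≤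
        LinearMap.ker (g2Basis.coord (Sum.inr j)) := by
      intro j hj
      refine sup_le (fun η hη => ?_) (sup_le ?_ ?_)
      · obtain ⟨h2, -, -, h9, h11⟩ := (mem_parabolic η).1 hη
        fin_cases hj
        exacts [h2, h9, h11]
      · exact isRootBasis_g2.rootSp_le_ker_coord (i := 4) (by rintro rfl; revert hj; decide)
      · exact isRootBasis_g2.rootSp_le_ker_coord (i := 3) (by rintro rfl; revert hj; decide)
    exact ⟨key 2 (by decide) h, key 9 (by decide) h, key 11 (by decide) h⟩
  · rintro ⟨h2, h9, h11⟩
    have key : ∀ i, rootCoord (g2Basis (Sum.inr i)) = Pi.single i 1 := fun i =>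
      (coord_der (g2Basis_inr i)).2
    have p : ∀ (i : Fin 12) (c : ℝ), i = 3 ∨ i = 4 →
        c • g2Basis (Sum.inr i) ∈ planeW torus shortRoot longRoot := by
      intro i c hi
      refine Submodule.smul_mem _ _ (le_sup_right (α := Submodule ℝ g2) ?_)
      rcases hi with rfl | rfl
      · exact le_sup_right (α := Submodule ℝ g2) (fun T => isRootBasis_g2.root 3 T)
      · exact le_sup_left (α := Submodule ℝ g2) (fun T => isRootBasis_g2.root 4 T)
    have q : ξ - rootCoord ξ 3 • g2Basis (Sum.inr 3) - rootCoord ξ 4 • g2Basis (Sum.inr 4) ∈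
        parabolic torus shortRoot longRoot := by
      rw [mem_parabolic]
      simp only [map_sub, map_smul, key]
      simp [h2, h9, h11]
    have := add_mem (add_mem (le_sup_left (α := Submodule ℝ g2) q :
      _ ∈ planeW torus shortRoot longRoot) (p 4 (rootCoord ξ 4) (Or.inr rfl)))
      (p 3 (rootCoord ξ 3) (Or.inl rfl))
    rwa [sub_add_cancel, sub_add_cancel] at this

/-! ### Exponentials -/

section Exp

theorem exp_mul_exp_neg' {A : Type*} [NormedRing A] [NormedAlgebra ℝ A] [CompleteSpace A] (x : A) :
    NormedSpace.exp x * NormedSpace.exp (-x) = 1 := by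
  let _ : NormedAlgebra ℚ A := NormedAlgebra.restrictScalars ℚ ℝ A
  rw [← NormedSpace.exp_add_of_commute (Commute.refl x).neg_right, add_neg_cancel,
    NormedSpace.exp_zero]

theorem exp_neg_mul_exp' {A : Type*} [NormedRing A] [NormedAlgebra ℝ A] [CompleteSpace A] (x : A) :
    NormedSpace.exp (-x) * NormedSpace.exp x = 1 := by
  simpa using exp_mul_exp_neg' (-x)

variable {E : Type*} [NormedAddCommGroup E] [NormedSpace ℝ E] [CompleteSpace E]

theorem hasDerivAt_exp_smul_apply (ξ : E →L[ℝ] E) (x : E) (t : ℝ) :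
    HasDerivAt (fun t : ℝ => NormedSpace.exp (t • ξ) x) (ξ (NormedSpace.exp (t • ξ) x)) t :=
  (hasDerivAt_exp_smul_const' (𝕂 := ℝ) ξ t).clm_apply (hasDerivAt_const t x) |>.congr_deriv (by simp)

theorem hasDerivAt_exp_smul_apply_zero (ξ : E →L[ℝ] E) (x : E) :
    HasDerivAt (fun t : ℝ => NormedSpace.exp (t • ξ) x) (ξ x) 0 := by
  simpa using hasDerivAt_exp_smul_apply ξ x 0

/-- The curve `exp (t ξ) x` is the only solution of its differential equation. -/
theorem eq_exp_smul_apply {ξ : E →L[ℝ] E} {γ : ℝ → E} (h : ∀ t, HasDerivAt γ (ξ (γ t)) t) (t : ℝ) :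
    γ t = NormedSpace.exp (t • ξ) (γ 0) := by
  -- Undoing the flow gives a curve with zero derivative, hence a constant one.
  have h1 : ∀ t, HasDerivAt (fun t : ℝ => NormedSpace.exp (t • -ξ) (γ t)) 0 t := fun t => by
    refine ((hasDerivAt_exp_smul_const (𝕂 := ℝ) (-ξ) t).clm_apply (h t)).congr_deriv ?_
    simp
  have h2 := is_const_of_deriv_eq_zero (fun t => (h1 t).differentiableAt)
    (fun t => (h1 t).deriv) t 0
  simp only [zero_smul, NormedSpace.exp_zero, one_apply_eq_self] at h2
  rw [← h2, ← mul_apply_eq_comp, smul_neg, exp_mul_exp_neg']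
  rfl

theorem exp_smul_apply_of_eigen {ξ : E →L[ℝ] E} {x : E} {c : ℝ} (h : ξ x = c • x) (t : ℝ) :
    NormedSpace.exp (t • ξ) x = Real.exp (t * c) • x := by
  have := eq_exp_smul_apply (ξ := ξ) (γ := fun t => Real.exp (t * c) • x) (fun t => by
    have := (((hasDerivAt_id t).mul_const c).exp).smul_const x
    refine this.congr_deriv ?_
    rw [map_smul, h, smul_smul]
    simp) t
  simpa using this.symm

/-- The exponential of an operator of which the cube vanishes. -/
theorem exp_smul_apply_of_cube {ξ : E →L[ℝ] E} (h : ∀ x, ξ (ξ (ξ x)) = 0) (t : ℝ) (x : E) :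
    NormedSpace.exp (t • ξ) x = x + t • ξ x + (t ^ 2 / 2) • ξ (ξ x) := by
  have := eq_exp_smul_apply (ξ := ξ) (γ := fun t => x + t • ξ x + (t ^ 2 / 2) • ξ (ξ x)) (fun t => by
    have := ((((hasDerivAt_id t).smul_const (ξ x)).const_add x).add
      ((((hasDerivAt_id t).pow 2).div_const 2).smul_const (ξ (ξ x))))
    refine this.congr_deriv ?_
    simp [h]) t
  simpa using this.symm

end Exp

/-- A derivative of a curve in a closed subspace lies in the subspace. -/
theorem HasDerivAt.mem_of_forall_mem {E : Type*} [NormedAddCommGroup E] [NormedSpace ℝ E]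
    {γ : ℝ → E} {γ' : E} {t : ℝ} (h : HasDerivAt γ γ' t)
    {W : Submodule ℝ E} [FiniteDimensional ℝ W] (hW : ∀ t, γ t ∈ W) : γ' ∈ W := by
  have h1 := hasDerivAt_iff_tendsto_slope.1 h
  refine W.closed_of_finiteDimensional.mem_of_tendsto h1 (Filter.Eventually.of_forall fun s => ?_)
  rw [slope_def_module]
  exact W.smul_mem _ (W.sub_mem (hW _) (hW _))

/-! ### Derivations and one-parameter groups of automorphisms. -/

namespace SplitOct

/-- The product of split octonions as a bounded bilinear map. -/
def mulL : SplitOct →L[ℝ] SplitOct →L[ℝ] SplitOct :=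
  LinearMap.toContinuousLinearMap <| (LinearMap.toContinuousLinearMap :
    (SplitOct →ₗ[ℝ] SplitOct) ≃ₗ[ℝ] SplitOct →L[ℝ] SplitOct).toLinearMap ∘ₗ
    LinearMap.mk₂ ℝ (fun x y : SplitOct => x * y) SplitOct.add_mul' SplitOct.smul_mul'
      SplitOct.mul_add' SplitOct.mul_smul'

end SplitOct

theorem HasDerivAt.splitOct_mul {f g : ℝ → SplitOct} {f' g' : SplitOct} {t : ℝ}
    (hf : HasDerivAt f f' t) (hg : HasDerivAt g g' t) :
    HasDerivAt (fun t => f t * g t) (f' * g t + f t * g') t := by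
  have := (mulL.hasFDerivAt.comp_hasDerivAt t hf).clm_apply hg
  exact this

/-- By the Leibniz rule the product of the two moving factors solves the linear equation whose
unique solution is the left side. -/
theorem exp_map_mul {ξ : SplitOct →L[ℝ] SplitOct} (hξ : ξ ∈ g2) (t : ℝ) (x y : SplitOct) :
    NormedSpace.exp (t • ξ) (x * y) = NormedSpace.exp (t • ξ) x * NormedSpace.exp (t • ξ) y := by
  have := eq_exp_smul_apply (ξ := ξ)
    (γ := fun t => NormedSpace.exp (t • ξ) x * NormedSpace.exp (t • ξ) y) (fun t => by
      rw [hξ]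
      exact (hasDerivAt_exp_smul_apply ξ x t).splitOct_mul (hasDerivAt_exp_smul_apply ξ y t)) t
  simpa using this.symm

/-- The element `exp (t ξ)` of `G₂` for a derivation `ξ`. -/
def G2.exp (ξ : g2) (t : ℝ) : G2 :=
  ⟨⟨NormedSpace.exp (t • (ξ : SplitOct →L[ℝ] SplitOct)),
    NormedSpace.exp (-(t • (ξ : SplitOct →L[ℝ] SplitOct))),
    exp_mul_exp_neg' _, exp_neg_mul_exp' _⟩, exp_map_mul ξ.2 t⟩

theorem G2.toEnd_exp (ξ : g2) (t : ℝ) :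
    G2.toEnd (G2.exp ξ t) = NormedSpace.exp (t • (ξ : SplitOct →L[ℝ] SplitOct)) := rfl

theorem G2.toEnd_injective : Function.Injective G2.toEnd := fun _ _ h =>
  Subtype.ext (Units.ext h)

/-- The derivative at t = 0 of multiplicativity of exp(tξ) is the Leibniz rule for ξ. -/
theorem mem_g2_of_mem_lieAlg {Γ : Subgroup G2} {ξ : SplitOct →L[ℝ] SplitOct}
    (hξ : ξ ∈ lieAlg Γ) : ξ ∈ g2 := by
  intro x y
  have h : ∀ t : ℝ, NormedSpace.exp (t • ξ) (x * y) =
      NormedSpace.exp (t • ξ) x * NormedSpace.exp (t • ξ) y := fun t => by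
    obtain ⟨g, -, hg⟩ := hξ t
    rw [← hg, G2.map_mul']
  have h1 := (hasDerivAt_exp_smul_apply_zero ξ x).splitOct_mul (hasDerivAt_exp_smul_apply_zero ξ y)
  have h2 := hasDerivAt_exp_smul_apply_zero ξ (x * y)
  simp_rw [h] at h2
  simpa using h2.unique h1

theorem mem_lieAlg_iff {Γ : Subgroup G2} (ξ : g2) :
    (ξ : SplitOct →L[ℝ] SplitOct) ∈ lieAlg Γ ↔ ∀ t, G2.exp ξ t ∈ Γ := by
  refine forall_congr' fun t => ⟨?_, fun h => ⟨_, h, rfl⟩⟩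
  rintro ⟨g, hg, e⟩
  rwa [← G2.toEnd_injective (e.trans (G2.toEnd_exp ξ t).symm)]

theorem lieAlg_top : lieAlg ⊤ = (g2 : Set (SplitOct →L[ℝ] SplitOct)) :=
  Set.Subset.antisymm (fun _ h => mem_g2_of_mem_lieAlg h)
    fun ξ h => (mem_lieAlg_iff ⟨ξ, h⟩).2 fun _ => Subgroup.mem_top _

theorem continuous_toEnd : Continuous G2.toEnd :=
  Units.continuous_val.comp continuous_subtype_val

theorem isClosed_G2 : IsClosed (G2 : Set (SplitOct →L[ℝ] SplitOct)ˣ) := by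
  have : (G2 : Set (SplitOct →L[ℝ] SplitOct)ˣ) = ⋂ x : SplitOct, ⋂ y : SplitOct,
      {g : (SplitOct →L[ℝ] SplitOct)ˣ | (g : SplitOct →L[ℝ] SplitOct) (x * y) =
        mulL ((g : SplitOct →L[ℝ] SplitOct) x) ((g : SplitOct →L[ℝ] SplitOct) y)} := by
    ext g
    simp only [Set.mem_iInter]
    rfl
  rw [this]
  have h : ∀ x, Continuous fun g : (SplitOct →L[ℝ] SplitOct)ˣ => (g : SplitOct →L[ℝ] SplitOct) x :=
    fun x => (ContinuousLinearMap.apply ℝ SplitOct x).continuous.comp Units.continuous_val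
  exact isClosed_iInter fun x => isClosed_iInter fun y => isClosed_eq (h _)
    ((mulL.continuous.comp (h x)).clm_apply (h y))

/-! ### The base ray and its stabilizer -/

/-- The ray of a null vector. -/
def NullRay.mk (x : NullVec) : NullRay := Quotient.mk NullVec.setoid x

theorem NullRay.mk_eq_mk {x y : NullVec} :
    NullRay.mk x = NullRay.mk y ↔ ∃ c : ℝ, 0 < c ∧ y.1 = c • x.1 := Quotient.eq (r := NullVec.setoid)

theorem NullRay.smul_mk (g : G2) (x : NullVec) : g • NullRay.mk x = NullRay.mk (g • x) := rfl

theorem nb_ne_zero (i : Fin 8) : nb i ≠ 0 := fun h => by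
  have := congrFun (congrArg crd h) i
  rw [crd_nb, map_zero, Pi.single_eq_same] at this
  exact one_ne_zero this

/-- The base null vector. -/
def baseVec : NullVec := ⟨nb 7, by rw [mem_imag_iff_crd, crd_nb]; simp,
  by rw [form_self_crd]; simp [crd_nb], nb_ne_zero 7⟩

/-- The base ray. -/
def baseRay : NullRay := NullRay.mk baseVec

theorem mem_stabilizer_mk (g : G2) (x : NullVec) :
    g ∈ MulAction.stabilizer G2 (NullRay.mk x) ↔ ∃ c : ℝ, 0 < c ∧ G2.toEnd g x.1 = c • x.1 := by
  rw [MulAction.mem_stabilizer_iff, NullRay.smul_mk, eq_comm, NullRay.mk_eq_mk]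
  rfl

/-- Differentiating a curve in the line ℝx gives an eigenvector; conversely the eigenvalue exp(tc)
of the flow is positive, so that not only the line but the ray is fixed. -/
theorem mem_isotropyAlg_mk (Γ : Subgroup G2) (x : NullVec) (ξ : SplitOct →L[ℝ] SplitOct) :
    ξ ∈ isotropyAlg Γ (NullRay.mk x) ↔ ξ ∈ lieAlg Γ ∧ ∃ c : ℝ, ξ x.1 = c • x.1 := by
  constructor
  · intro h
    refine ⟨fun t => ?_, ?_⟩
    · obtain ⟨g, hg, e⟩ := h t
      exact ⟨g, hg.1, e⟩
    · have h1 : ∀ t : ℝ, NormedSpace.exp (t • ξ) x.1 ∈ Submodule.span ℝ {x.1} := fun t => by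
        obtain ⟨g, hg, e⟩ := h t
        obtain ⟨c, -, hc⟩ := (mem_stabilizer_mk g x).1 hg.2
        rw [← e, hc]
        exact Submodule.smul_mem _ _ (Submodule.mem_span_singleton_self _)
      have h2 := HasDerivAt.mem_of_forall_mem (hasDerivAt_exp_smul_apply_zero ξ x.1) h1
      obtain ⟨c, hc⟩ := Submodule.mem_span_singleton.1 h2
      exact ⟨c, hc.symm⟩
  · rintro ⟨h, c, hc⟩ t
    obtain ⟨g, hg, e⟩ := h t
    refine ⟨g, ⟨hg, (mem_stabilizer_mk g x).2 ⟨Real.exp (t * c), Real.exp_pos _, ?_⟩⟩, e⟩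
    rw [e, exp_smul_apply_of_eigen hc]

theorem crd_der_seven (h : Fin 2 → ℝ) (θ : Fin 12 → ℝ) : crd (der h θ (nb 7)) =
    ![0, θ 2, -θ 4, θ 3, 0, -θ 9, -θ 11, h 0 + h 1] := by
  rw [crd_der, crd_nb]; simp

/-- The image of `nb 7` has, up to sign, the entries `θ 2`, `θ 3`, `θ 4`, `θ 9`, `θ 11` off the line
of `nb 7`; their vanishing is the description of 𝔭 in `mem_parabolic`. This is where the labelling
of the roots is fitted to the base ray. -/
theorem mem_isotropyAlg_base (ξ : g2) :
    (ξ : SplitOct →L[ℝ] SplitOct) ∈ isotropyAlg ⊤ baseRay ↔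
      ξ ∈ parabolic torus shortRoot longRoot := by
  rw [baseRay, mem_isotropyAlg_mk, lieAlg_top, mem_parabolic]
  refine (and_iff_right ξ.2).trans ?_
  change (∃ c : ℝ, (ξ : SplitOct →L[ℝ] SplitOct) (nb 7) = c • nb 7) ↔ _
  rw [← der_coord ξ]
  have e := (der_coord ξ)
  constructor
  · rintro ⟨c, hc⟩
    have h := congrArg crd hc
    rw [crd_der_seven, map_smul, crd_nb] at h
    have h1 := congrFun h 1
    have h2 := congrFun h 2
    have h3 := congrFun h 3
    have h5 := congrFun h 5
    have h6 := congrFun h 6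
    simp at h1 h2 h3 h5 h6
    exact ⟨h1, h3, h2, h5, h6⟩
  · rintro ⟨h2, h3, h4, h9, h11⟩
    refine ⟨torusCoord ξ 0 + torusCoord ξ 1, ?_⟩
    apply ext_crd
    intro k
    rw [crd_der_seven, map_smul, crd_nb, h2, h3, h4, h9, h11]
    fin_cases k <;> simp

/-- The subgroup generated by the exponentials of the parabolic subalgebra. -/
def parabolicGroup : Subgroup G2 := Subgroup.closure
  {g : G2 | ∃ ξ ∈ parabolic torus shortRoot longRoot,
    G2.toEnd g = NormedSpace.exp (ξ : SplitOct →L[ℝ] SplitOct)}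

/-! ### The isotropy group of the base ray: torus, unipotent elements and a Levi factor. -/

theorem exp_mem_parabolicGroup {ξ : g2} (hξ : ξ ∈ parabolic torus shortRoot longRoot) (t : ℝ) :
    G2.exp ξ t ∈ parabolicGroup :=
  Subgroup.subset_closure ⟨t • ξ, Submodule.smul_mem _ t hξ, rfl⟩

theorem parabolicGroup_le : parabolicGroup ≤ MulAction.stabilizer G2 baseRay := by
  rw [parabolicGroup, Subgroup.closure_le]
  rintro g ⟨ξ, hξ, e⟩
  obtain ⟨g', hg', e'⟩ := (mem_isotropyAlg_base ξ).2 hξ 1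
  rw [one_smul, ← e] at e'
  rw [← G2.toEnd_injective e']
  exact hg'.2

theorem crd_root_0 (x : SplitOct) : crd (der 0 (Pi.single 0 1) x) =
    ![0, crd x 5, 2 * crd x 1, 0, 0, 0, -crd x 4, crd x 3] := by
  rw [crd_der]; simp

theorem crd_root_1 (x : SplitOct) : crd (der 0 (Pi.single 1 1) x) =
    ![0, crd x 6, 0, 2 * crd x 1, 0, crd x 4, 0, -crd x 2] := by
  rw [crd_der]; simp

theorem crd_root_5 (x : SplitOct) : crd (der 0 (Pi.single 5 1) x) =
    ![0, crd x 4, crd x 6, -crd x 5, 0, 0, 0, 2 * crd x 1] := by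
  rw [crd_der]; simp

theorem crd_root_6 (x : SplitOct) : crd (der 0 (Pi.single 6 1) x) =
    ![0, 0, crd x 3, 0, 0, 0, -crd x 5, 0] := by
  rw [crd_der]; simp

theorem crd_root_7 (x : SplitOct) : crd (der 0 (Pi.single 7 1) x) =
    ![0, 0, 0, crd x 2, 0, -crd x 6, 0, 0] := by
  rw [crd_der]; simp

theorem crd_root_8 (x : SplitOct) : crd (der 0 (Pi.single 8 1) x) =
    ![0, 0, crd x 4, 0, 0, 0, 0, -crd x 5] := by
  rw [crd_der]; simp

theorem crd_root_10 (x : SplitOct) : crd (der 0 (Pi.single 10 1) x) =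
    ![0, 0, 0, crd x 4, 0, 0, 0, -crd x 6] := by
  rw [crd_der]; simp

theorem rootCoord_g2Basis (i : Fin 12) : rootCoord (g2Basis (Sum.inr i)) = Pi.single i 1 :=
  (coord_der (g2Basis_inr i)).2

theorem g2Basis_mem_parabolic {i : Fin 12} (hi : i ∈ ({0, 1, 5, 6, 7, 8, 10} : Finset (Fin 12))) :
    g2Basis (Sum.inr i) ∈ parabolic torus shortRoot longRoot := by
  rw [mem_parabolic, rootCoord_g2Basis]
  refine ⟨?_, ?_, ?_, ?_, ?_⟩ <;> refine Pi.single_eq_of_ne ?_ _ <;>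
    (rintro rfl; revert hi; decide)

/-- The nonzero weights of the imaginary octonions are the short roots, so a root vector can be
applied nontrivially at most twice. The root subgroups are therefore given by explicit quadratic
polynomials. -/
theorem root_cube {i : Fin 12} (hi : i ∈ ({0, 1, 5, 6, 7, 8, 10} : Finset (Fin 12)))
    (x : SplitOct) :
    der 0 (Pi.single i 1) (der 0 (Pi.single i 1) (der 0 (Pi.single i 1) x)) = 0 := by
  apply ext_crd
  intro k
  fin_cases hi <;> simp only [Fin.isValue, crd_root_0, crd_root_1, crd_root_5, crd_root_6, crd_root_7, crd_root_8, crd_root_10] <;>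
    fin_cases k <;> simp

/-- The action of the one-parameter group of a root vector in null coordinates. -/
theorem crd_exp_root {i : Fin 12} (hi : i ∈ ({0, 1, 5, 6, 7, 8, 10} : Finset (Fin 12))) (t : ℝ)
    (x : SplitOct) (k : Fin 8) :
    crd (G2.toEnd (G2.exp (g2Basis (Sum.inr i)) t) x) k = crd x k +
      t * crd (der 0 (Pi.single i 1) x) k +
      t ^ 2 / 2 * crd (der 0 (Pi.single i 1) (der 0 (Pi.single i 1) x)) k := by
  rw [G2.toEnd_exp, g2Basis_inr, exp_smul_apply_of_cube (root_cube hi)]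
  simp only [map_add, map_smul, Pi.add_apply, Pi.smul_apply, smul_eq_mul]

/-- The root subgroups of the parabolic group fix the base vector. -/
theorem exists_root_element {i : Fin 12} (hi : i ∈ ({0, 1, 5, 6, 7, 8, 10} : Finset (Fin 12)))
    (t : ℝ) : ∃ s ∈ parabolicGroup, G2.toEnd s (nb 7) = nb 7 ∧ ∀ x k,
      crd (G2.toEnd s x) k = crd x k + t * crd (der 0 (Pi.single i 1) x) k +
        t ^ 2 / 2 * crd (der 0 (Pi.single i 1) (der 0 (Pi.single i 1) x)) k := by
  refine ⟨_, exp_mem_parabolicGroup (g2Basis_mem_parabolic hi) t, ?_, crd_exp_root hi t⟩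
  have h0 : der 0 (Pi.single i 1) (nb 7) = 0 := by
    apply ext_crd
    intro k
    rw [crd_der_seven, map_zero]
    fin_cases hi <;> fin_cases k <;> simp
  apply ext_crd
  intro k
  rw [crd_exp_root hi, h0, map_zero, map_zero]
  simp

/-- Gaussian elimination with pivot the coordinate 4: the root subgroups with indices 1, 0, 5, 8, 10
add multiples of the pivot to the coordinates 5, 6, 1, 2, 3. In this order none of them disturbs a
coordinate already cleared. -/
theorem exists_unipotent {y : SplitOct} (h0 : crd y 0 = 0) (hf : form y y = 0) (h4 : crd y 4 = 1) :
    ∃ s ∈ parabolicGroup, G2.toEnd s (nb 7) = nb 7 ∧ G2.toEnd s y = nb 4 := by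
  obtain ⟨s₁, m₁, f₁, e₁⟩ := exists_root_element (i := 1) (by decide) (-crd y 5)
  have a0 := e₁ y 0
  have a4 := e₁ y 4
  have a5 := e₁ y 5
  simp [crd_root_1, h0, h4] at a0 a4 a5
  have af := (G2.preserves s₁ h0).2.trans hf
  set y₁ := G2.toEnd s₁ y with hy₁
  obtain ⟨s₂, m₂, f₂, e₂⟩ := exists_root_element (i := 0) (by decide) (crd y₁ 6)
  have b0 := e₂ y₁ 0
  have b4 := e₂ y₁ 4
  have b5 := e₂ y₁ 5
  have b6 := e₂ y₁ 6
  simp [crd_root_0, a0, a4, a5] at b0 b4 b5 b6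
  have bf := (G2.preserves s₂ a0).2.trans af
  set y₂ := G2.toEnd s₂ y₁ with hy₂
  obtain ⟨s₃, m₃, f₃, e₃⟩ := exists_root_element (i := 5) (by decide) (-crd y₂ 1)
  have c0 := e₃ y₂ 0
  have c1 := e₃ y₂ 1
  have c4 := e₃ y₂ 4
  have c5 := e₃ y₂ 5
  have c6 := e₃ y₂ 6
  simp [crd_root_5, b0, b4, b5, b6] at c0 c1 c4 c5 c6
  have cf := (G2.preserves s₃ b0).2.trans bf
  set y₃ := G2.toEnd s₃ y₂ with hy₃
  obtain ⟨s₄, m₄, f₄, e₄⟩ := exists_root_element (i := 8) (by decide) (-crd y₃ 2)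
  have d0 := e₄ y₃ 0
  have d1 := e₄ y₃ 1
  have d2 := e₄ y₃ 2
  have d4 := e₄ y₃ 4
  have d5 := e₄ y₃ 5
  have d6 := e₄ y₃ 6
  simp [crd_root_8, c0, c1, c4, c5, c6] at d0 d1 d2 d4 d5 d6
  have df := (G2.preserves s₄ c0).2.trans cf
  set y₄ := G2.toEnd s₄ y₃ with hy₄
  obtain ⟨s₅, m₅, f₅, e₅⟩ := exists_root_element (i := 10) (by decide) (-crd y₄ 3)
  have g0 := e₅ y₄ 0
  have g1 := e₅ y₄ 1
  have g2 := e₅ y₄ 2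
  have g3 := e₅ y₄ 3
  have g4 := e₅ y₄ 4
  have g5 := e₅ y₄ 5
  have g6 := e₅ y₄ 6
  simp [crd_root_10, d0, d1, d2, d4, d5, d6] at g0 g1 g2 g3 g4 g5 g6
  have gf := (G2.preserves s₅ d0).2.trans df
  -- With the other coordinates cleared and the pivot equal to 1, nullity says that coordinate 7
  -- vanishes.
  rw [form_self_crd, g0, g1, g2, g3, g4] at gf
  refine ⟨s₅ * (s₄ * (s₃ * (s₂ * s₁))), mul_mem m₅ (mul_mem m₄ (mul_mem m₃ (mul_mem m₂ m₁))), ?_, ?_⟩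
  · simp only [G2.toEnd_mul, mul_apply_eq_comp, f₁, f₂, f₃, f₄, f₅]
  · simp only [G2.toEnd_mul, mul_apply_eq_comp, ← hy₁, ← hy₂, ← hy₃, ← hy₄]
    apply ext_crd
    intro k
    rw [crd_nb]
    fin_cases k
    · exact g0
    · exact g1
    · exact g2
    · exact g3
    · exact g4
    · exact g5
    · exact g6
    · simpa using gf

theorem toEnd_nb_mul {g : G2} {i j k : Fin 8} (h : nb i * nb j = nb k) :
    G2.toEnd g (nb k) = G2.toEnd g (nb i) * G2.toEnd g (nb j) := by
  rw [← h, G2.map_mul']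

/-- One eigenspace of ℓ generates the algebra: its products give the other eigenspace, and a
commutator gives ℓ. -/
theorem eq_one_of_fix {g : G2} (h2 : G2.toEnd g (nb 2) = nb 2) (h3 : G2.toEnd g (nb 3) = nb 3)
    (h4 : G2.toEnd g (nb 4) = nb 4) : g = 1 := by
  have h5 : G2.toEnd g (nb 5) = nb 5 := by rw [toEnd_nb_mul nb_mul_34, h3, h4, nb_mul_34]
  have h6 : G2.toEnd g (nb 6) = nb 6 := by rw [toEnd_nb_mul nb_mul_42, h4, h2, nb_mul_42]
  have h7 : G2.toEnd g (nb 7) = nb 7 := by rw [toEnd_nb_mul nb_mul_23, h2, h3, nb_mul_23]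
  have h1 : G2.toEnd g (nb 1) = nb 1 := by
    rw [← neg_inj, ← map_neg, ← nb_mul_47_sub, map_sub, G2.map_mul', G2.map_mul', h4, h7]
  apply G2.toEnd_injective
  apply clm_ext_nb
  intro i
  rw [G2.toEnd_one, one_apply_eq_self]
  fin_cases i
  · change G2.toEnd g (nb 0) = nb 0
    rw [nb_zero, G2.map_one']
  all_goals assumption

/-- The root subgroups of the Levi factor. -/
theorem exists_levi_upper (t : ℝ) : ∃ s ∈ parabolicGroup, G2.toEnd s (nb 7) = nb 7 ∧
    G2.toEnd s (nb 4) = nb 4 ∧ G2.toEnd s (nb 2) = nb 2 ∧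
    G2.toEnd s (nb 3) = nb 3 + t • nb 2 := by
  obtain ⟨s, hs, h7, e⟩ := exists_root_element (i := 6) (by decide) t
  refine ⟨s, hs, h7, ?_, ?_, ?_⟩ <;> apply ext_crd <;> intro k <;> rw [e] <;>
    simp only [crd_root_6, map_add, map_smul, crd_nb] <;> fin_cases k <;> simp

theorem exists_levi_lower (t : ℝ) : ∃ s ∈ parabolicGroup, G2.toEnd s (nb 7) = nb 7 ∧
    G2.toEnd s (nb 4) = nb 4 ∧ G2.toEnd s (nb 2) = nb 2 + t • nb 3 ∧
    G2.toEnd s (nb 3) = nb 3 := by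
  obtain ⟨s, hs, h7, e⟩ := exists_root_element (i := 7) (by decide) t
  refine ⟨s, hs, h7, ?_, ?_, ?_⟩ <;> apply ext_crd <;> intro k <;> rw [e] <;>
    simp only [crd_root_7, map_add, map_smul, crd_nb] <;> fin_cases k <;> simp

/-- An element of `G₂` fixing an opposite pair of null vectors acts on the Levi plane by a
unimodular matrix. -/
theorem levi_matrix {g : G2} (h7 : G2.toEnd g (nb 7) = nb 7) (h4 : G2.toEnd g (nb 4) = nb 4) :
    ∃ a b c d : ℝ, G2.toEnd g (nb 2) = a • nb 2 + c • nb 3 ∧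
      G2.toEnd g (nb 3) = b • nb 2 + d • nb 3 ∧ a * d - b * c = 1 := by
  have h1 : G2.toEnd g (nb 1) = nb 1 := by
    rw [← neg_inj, ← map_neg, ← nb_mul_47_sub, map_sub, G2.map_mul', G2.map_mul', h4, h7]
  have key : ∀ j, j = 2 ∨ j = 3 → nb 1 * nb j = nb j → nb j * nb 1 = -nb j →
      G2.toEnd g (nb j) = crd (G2.toEnd g (nb j)) 2 • nb 2 + crd (G2.toEnd g (nb j)) 3 • nb 3 := by
    intro j hj ha hb
    obtain ⟨c0, c1, c5, c6, c7⟩ := crd_of_ell_eigen (y := G2.toEnd g (nb j))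
      (by have := G2.map_mul' g (nb 1) (nb j); rw [h1, ha] at this; exact this.symm)
      (by have := G2.map_mul' g (nb j) (nb 1); rw [h1, hb, map_neg] at this; exact this.symm)
    have hi : nb j + nb 7 ∈ imag := by
      rw [mem_imag_iff_crd, map_add, crd_nb, crd_nb]
      rcases hj with rfl | rfl <;> simp
    have hf := (G2.preserves g hi).2
    rw [map_add, h7, form_self_crd, form_self_crd, map_add, map_add] at hf
    have c4 : crd (G2.toEnd g (nb j)) 4 = 0 := by
      rcases hj with rfl | rfl <;> simpa [crd_nb, c0, c1, c5, c6, c7] using hf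
    apply ext_crd
    intro k
    simp only [map_add, map_smul, crd_nb]
    fin_cases k <;> simp [c0, c1, c4, c5, c6, c7]
  have e2 := key 2 (Or.inl rfl) nb_mul_12 nb_mul_21
  have e3 := key 3 (Or.inr rfl) nb_mul_13 nb_mul_31
  refine ⟨_, _, _, _, e2, e3, ?_⟩
  have e7 := toEnd_nb_mul (g := g) nb_mul_23
  generalize crd (G2.toEnd g (nb 2)) 2 = a at *
  generalize crd (G2.toEnd g (nb 2)) 3 = c at *
  generalize crd (G2.toEnd g (nb 3)) 2 = b at *
  generalize crd (G2.toEnd g (nb 3)) 3 = d at *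
  rw [h7, e2, e3] at e7
  have := congrFun (congrArg crd e7) 7
  simp only [crd_mul, map_add, map_smul, crd_nb] at this
  simp at this
  linarith

/-- A unimodular matrix with nonzero lower left entry c is a product of three elementary ones. The
parameter (1-a)/c turns the entry a into 1, then -c clears the first column, and the last factor
clears what is left of the second column; the determinant makes its diagonal entry 1. -/
theorem levi_mem_of_ne {g : G2} (h4 : G2.toEnd g (nb 4) = nb 4)
    {a b c d : ℝ} (h2 : G2.toEnd g (nb 2) = a • nb 2 + c • nb 3)
    (h3 : G2.toEnd g (nb 3) = b • nb 2 + d • nb 3) (hdet : a * d - b * c = 1) (hc : c ≠ 0) :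
    g ∈ parabolicGroup := by
  obtain ⟨s, hs, s7, s4, s2, s3⟩ := exists_levi_upper ((1 - a) / c)
  obtain ⟨r, hr, r7, r4, r2, r3⟩ := exists_levi_lower (-c)
  obtain ⟨q, hq, q7, q4, q2, q3⟩ := exists_levi_upper (-(b + d * ((1 - a) / c)))
  have e : q * (r * (s * g)) = 1 := by
    apply eq_one_of_fix
    · simp only [G2.toEnd_mul, mul_apply_eq_comp, h2, map_add, map_smul, s2, s3, r2, r3, q2, q3]
      apply ext_crd
      intro k
      simp only [map_add, map_smul, crd_nb]
      fin_cases k <;> simp <;> field_simp <;> ring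
    · simp only [G2.toEnd_mul, mul_apply_eq_comp, h3, map_add, map_smul, s2, s3, r2, r3, q2, q3]
      apply ext_crd
      intro k
      simp only [map_add, map_smul, crd_nb]
      fin_cases k <;> simp <;> field_simp
      · linear_combination (-(b * c + d * (1 - a))) * hdet
      · linear_combination hdet
    · simp only [G2.toEnd_mul, mul_apply_eq_comp, h4, s4, r4, q4]
  exact (mul_mem_cancel_left hs).1 ((mul_mem_cancel_left hr).1 ((mul_mem_cancel_left hq).1
    (e ▸ one_mem _)))

theorem levi_mem {g : G2} (h7 : G2.toEnd g (nb 7) = nb 7) (h4 : G2.toEnd g (nb 4) = nb 4) :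
    g ∈ parabolicGroup := by
  obtain ⟨a, b, c, d, h2, h3, hdet⟩ := levi_matrix h7 h4
  by_cases hc : c = 0
  -- If c = 0 then a ≠ 0, and adding the first row to the second makes the lower left entry equal to
  -- a.
  · obtain ⟨r, hr, r7, r4, r2, r3⟩ := exists_levi_lower 1
    rw [hc, mul_zero, sub_zero] at hdet
    rw [← mul_mem_cancel_left hr]
    refine levi_mem_of_ne (a := a) (b := b) (c := a) (d := b + d) ?_ ?_ ?_ ?_ ?_
    · rw [G2.toEnd_mul, mul_apply_eq_comp, h4, r4]
    · rw [G2.toEnd_mul, mul_apply_eq_comp, h2, hc, map_add, map_smul, map_smul, r2, r3, zero_smul,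
        add_zero, one_smul, smul_add]
    · rw [G2.toEnd_mul, mul_apply_eq_comp, h3, map_add, map_smul, map_smul, r2, r3, one_smul,
        smul_add, add_assoc, ← add_smul]
    · linear_combination hdet
    · rintro rfl
      rw [zero_mul] at hdet
      exact zero_ne_one hdet
  · exact levi_mem_of_ne h4 h2 h3 hdet hc

/-- Only the inclusion of the stabilizer needs work. A given element is multiplied on the left by
elements of the generated subgroup, until it fixes both `nb 7` and `nb 4` and falls under
`levi_mem`. In particular no component of the stabilizer is missed by the exponentials. -/
theorem stabilizer_base : MulAction.stabilizer G2 baseRay = parabolicGroup := by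
  refine le_antisymm (fun g hg => ?_) parabolicGroup_le
  obtain ⟨c, hc, e⟩ := (mem_stabilizer_mk g baseVec).1 hg
  change G2.toEnd g (nb 7) = c • nb 7 at e
  -- `nb 7` is an eigenvector for the eigenvalue 1 of the torus element (1,0), so time -log c undoes
  -- the scaling by c.
  obtain ⟨r, hr, er⟩ : ∃ r ∈ parabolicGroup, G2.toEnd r (nb 7) = c⁻¹ • nb 7 := by
    have hT : (torusMk ![1, 0] : g2) ∈ parabolic torus shortRoot longRoot := by
      rw [mem_parabolic, (torusMk ![1, 0]).2]
      simp
    refine ⟨_, exp_mem_parabolicGroup hT (-Real.log c), ?_⟩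
    rw [G2.toEnd_exp, exp_smul_apply_of_eigen (c := 1), mul_one, Real.exp_neg, Real.exp_log hc]
    apply ext_crd
    intro k
    rw [torus_coe, torusCoord_torusMk, crd_der_seven, one_smul, crd_nb]
    fin_cases k <;> simp
  have h7 : G2.toEnd (r * g) (nb 7) = nb 7 := by
    rw [G2.toEnd_mul, mul_apply_eq_comp, e, map_smul, er, smul_smul, mul_inv_cancel₀ hc.ne', one_smul]
  have h4 : nb 4 ∈ imag := by rw [mem_imag_iff_crd, crd_nb]; simp
  have h47 : nb 4 + nb 7 ∈ imag := imag.add_mem h4 baseVec.2.1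
  have hy := G2.preserves (r * g) h4
  have hy7 := (G2.preserves (r * g) h47).2
  have f4 : form (nb 4) (nb 4) = 0 := by rw [form_self_crd]; simp [crd_nb]
  rw [f4] at hy
  -- The coordinate 4 is the pairing with `nb 7`, which is fixed; the pairing is read off from the
  -- form on `nb 4 + nb 7`.
  have c4 : crd (G2.toEnd (r * g) (nb 4)) 4 = 1 := by
    have h0 := hy.2
    have h1 := mem_imag_iff_crd.1 hy.1
    rw [map_add, h7, form_self_crd, form_self_crd, map_add, map_add] at hy7
    rw [form_self_crd] at h0
    simp [crd_nb] at hy7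
    rw [h1] at h0 hy7
    linarith
  obtain ⟨s, hs, s7, s4⟩ := exists_unipotent (mem_imag_iff_crd.1 hy.1) hy.2 c4
  have hm : s * (r * g) ∈ parabolicGroup := by
    apply levi_mem
    · rw [G2.toEnd_mul, mul_apply_eq_comp, h7, s7]
    · rw [G2.toEnd_mul, mul_apply_eq_comp, s4]
  exact (mul_mem_cancel_left hr).1 ((mul_mem_cancel_left hs).1 hm)

/-! ### Conjugation by unit quaternions -/

/-- The imaginary quaternion with given coordinates. -/
def imq (a b c : ℝ) : ℍ[ℝ] := ⟨0, a, b, c⟩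

@[simp] theorem imq_re (a b c : ℝ) : (imq a b c).re = 0 := rfl
@[simp] theorem imq_imI (a b c : ℝ) : (imq a b c).imI = a := rfl
@[simp] theorem imq_imJ (a b c : ℝ) : (imq a b c).imJ = b := rfl
@[simp] theorem imq_imK (a b c : ℝ) : (imq a b c).imK = c := rfl

/-- The split octonion with given entries. -/
def pr (a b : ℍ[ℝ]) : SplitOct := (a, b)

@[simp] theorem pr_fst (a b : ℍ[ℝ]) : (pr a b).1 = a := rfl
@[simp] theorem pr_snd (a b : ℍ[ℝ]) : (pr a b).2 = b := rfl

theorem eq_imq {v : ℍ[ℝ]} (hv : v.re = 0) : v = imq v.imI v.imJ v.imK :=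
  Quaternion.ext _ _ hv rfl rfl rfl

namespace UnitQuat

theorem mul_star (q : UnitQuat) : (q : ℍ[ℝ]) * star (q : ℍ[ℝ]) = 1 := by
  rw [Quaternion.self_mul_star, Quaternion.normSq_eq_norm_mul_self, norm_eq_of_mem_sphere q]
  simp

/-- A nonzero quaternion intertwining `v` and `w` can be normalized. -/
theorem exists_of_intertwine {p v w : ℍ[ℝ]} (hp : p ≠ 0) (h : p * v = w * p) :
    ∃ q : UnitQuat, ∃ c : ℝ, (q : ℍ[ℝ]) = c • p ∧ (q : ℍ[ℝ]) * v = w * q := by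
  refine ⟨⟨‖p‖⁻¹ • p, ?_⟩, ‖p‖⁻¹, rfl, ?_⟩
  · rw [mem_sphere_zero_iff_norm, norm_smul, norm_inv, norm_norm,
      inv_mul_cancel₀ (norm_ne_zero_iff.2 hp)]
  · change (‖p‖⁻¹ • p) * v = w * (‖p‖⁻¹ • p)
    rw [smul_mul_assoc, h, mul_smul_comm]

theorem conj_eq {q : UnitQuat} {v w : ℍ[ℝ]} (h : (q : ℍ[ℝ]) * v = w * q) :
    (q : ℍ[ℝ]) * v * star (q : ℍ[ℝ]) = w := by
  rw [h, mul_assoc, mul_star, mul_one]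

end UnitQuat

theorem Quaternion.star_eq_neg_of_re {v : ℍ[ℝ]} (hv : v.re = 0) : star v = -v := by
  ext <;> simp [hv]

theorem Quaternion.mul_self_of_unit_imag {v : ℍ[ℝ]} (hv : v.re = 0) (h1 : ‖v‖ = 1) :
    v * v = -1 := by
  have := Quaternion.self_mul_star v
  rw [Quaternion.star_eq_neg_of_re hv, Quaternion.normSq_eq_norm_mul_self, h1, mul_one] at this
  rw [← neg_inj, ← mul_neg, this]
  simp

/-- Every imaginary quaternion anticommutes with a unit imaginary quaternion. -/
theorem exists_anticomm {v : ℍ[ℝ]} (hv : v.re = 0) :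
    ∃ u : ℍ[ℝ], u ≠ 0 ∧ u.re = 0 ∧ u * v = -v * u := by
  by_cases h : v.imI = 0 ∧ v.imJ = 0
  · refine ⟨imq 1 0 0, fun h => ?_, rfl, ?_⟩
    · simpa using congrArg QuaternionAlgebra.imI h
    · ext <;> simp [hv, h.1, h.2]
  · refine ⟨imq (-v.imJ) v.imI 0, fun h' => h ⟨?_, ?_⟩, rfl, ?_⟩
    · simpa using congrArg QuaternionAlgebra.imJ h'
    · simpa using congrArg QuaternionAlgebra.imI h'
    · ext <;> simp [hv] <;> ring

/-- Unit quaternions act transitively on the unit imaginary quaternions by conjugation. -/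
theorem exists_intertwine {v w : ℍ[ℝ]} (hv : v.re = 0) (hw : w.re = 0) (hv1 : ‖v‖ = 1)
    (hw1 : ‖w‖ = 1) : ∃ q : UnitQuat, (q : ℍ[ℝ]) * v = w * q := by
  have vv := Quaternion.mul_self_of_unit_imag hv hv1
  have ww := Quaternion.mul_self_of_unit_imag hw hw1
  -- Since v² = w² = -1, the quaternion 1 - wv intertwines v and w. It vanishes only for w = -v,
  -- where a nonzero quaternion anticommuting with v serves.
  by_cases h : 1 - w * v = 0
  · have h1 : w = -v := by
      have : (1 - w * v) * v = 0 := by rw [h, zero_mul]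
      rw [sub_mul, one_mul, mul_assoc, vv, mul_neg, mul_one, sub_neg_eq_add] at this
      rw [eq_neg_iff_add_eq_zero, add_comm, this]
    obtain ⟨u, hu, -, hu2⟩ := exists_anticomm hv
    obtain ⟨q, -, -, hq⟩ := UnitQuat.exists_of_intertwine hu hu2
    exact ⟨q, by rw [hq, h1]⟩
  · obtain ⟨q, -, -, hq⟩ := UnitQuat.exists_of_intertwine (v := v) (w := w) h (by
      rw [sub_mul, mul_sub, mul_assoc, vv, ← mul_assoc, ww]; simp [add_comm])
    exact ⟨q, hq⟩

/-- Unit quaternions act transitively on orthonormal pairs of imaginary quaternions. -/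
theorem exists_intertwine_pair {i j v w : ℍ[ℝ]} (hi : i.re = 0) (hj : j.re = 0) (hv : v.re = 0)
    (hw : w.re = 0) (hi1 : ‖i‖ = 1) (hj1 : ‖j‖ = 1) (hv1 : ‖v‖ = 1) (hw1 : ‖w‖ = 1)
    (hij : i * j = -(j * i)) (hvw : v * w = -(w * v)) :
    ∃ q : UnitQuat, (q : ℍ[ℝ]) * i = v * q ∧ (q : ℍ[ℝ]) * j = w * q := by
  obtain ⟨r, hr⟩ := exists_intertwine hi hv hi1 hv1
  have rs := UnitQuat.mul_star r
  have sr := UnitQuat.star_mul r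
  have jj := Quaternion.mul_self_of_unit_imag hj hj1
  have ww := Quaternion.mul_self_of_unit_imag hw hw1
  -- As r already moves i to v, it remains to move j to z = r̄ w r by a p that commutes with i.
  obtain ⟨z, hz⟩ : ∃ z : ℍ[ℝ], z = star (r : ℍ[ℝ]) * w * r := ⟨_, rfl⟩
  have rz : (r : ℍ[ℝ]) * z = w * r := by rw [hz, ← mul_assoc, ← mul_assoc, rs, one_mul]
  have zz : z * z = -1 := by
    rw [hz, mul_assoc (star (r : ℍ[ℝ]) * w), ← mul_assoc (r : ℍ[ℝ]), ← mul_assoc (r : ℍ[ℝ]), rs,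
      one_mul, ← mul_assoc, mul_assoc _ w w, ww, mul_neg, mul_one, neg_mul, sr]
  have si : star (r : ℍ[ℝ]) * v = i * star (r : ℍ[ℝ]) := by
    have := congrArg (fun y => star (r : ℍ[ℝ]) * y * star (r : ℍ[ℝ])) hr
    rw [← mul_assoc, sr, one_mul, ← mul_assoc, mul_assoc (star (r : ℍ[ℝ]) * v), rs, mul_one] at this
    exact this.symm
  have iz : i * z = -(z * i) := by
    rw [hz, mul_assoc _ (r : ℍ[ℝ]) i, hr, ← mul_assoc, ← mul_assoc, ← si, ← mul_assoc,
      mul_assoc _ v w, hvw, mul_assoc _ w v]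
    simp
  obtain ⟨p, hp⟩ : ∃ p : UnitQuat, (p : ℍ[ℝ]) * i = i * p ∧ (p : ℍ[ℝ]) * j = z * p := by
    -- Both z and j anticommute with i, so the intertwiner 1 - zj commutes with i. If it vanishes, z
    -- = -j and i itself serves.
    by_cases h : 1 - z * j = 0
    · have h1 : z = -j := by
        have : (1 - z * j) * j = 0 := by rw [h, zero_mul]
        rw [sub_mul, one_mul, mul_assoc, jj, mul_neg, mul_one, sub_neg_eq_add] at this
        rw [eq_neg_iff_add_eq_zero, add_comm, this]
      exact ⟨⟨i, by rw [mem_sphere_zero_iff_norm, hi1]⟩, rfl, by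
        change i * j = z * i
        rw [h1, hij, neg_mul]⟩
    · obtain ⟨q, c, hq, hq2⟩ := UnitQuat.exists_of_intertwine (v := j) (w := z) h (by
        rw [sub_mul, mul_sub, mul_assoc, jj, ← mul_assoc, zz]; simp [add_comm])
      refine ⟨q, ?_, hq2⟩
      have e : i * (z * j) = z * j * i := by
        rw [← mul_assoc, iz, neg_mul, mul_assoc, hij, mul_assoc]; simp
      rw [hq, smul_mul_assoc, mul_smul_comm, sub_mul, mul_sub, one_mul, mul_one, e]
  refine ⟨r * p, ?_, ?_⟩
  · change (r : ℍ[ℝ]) * p * i = v * (r * p)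
    rw [mul_assoc, hp.1, ← mul_assoc, hr, mul_assoc]
  · change (r : ℍ[ℝ]) * p * j = w * (r * p)
    rw [mul_assoc, hp.2, ← mul_assoc, rz, mul_assoc]

/-! ### The maximal compact subgroup -/

theorem toEnd_quatHom (q : UnitQuat × UnitQuat) : G2.toEnd (quatHom q) = quatAct q := rfl

/-- The minus one of `SU(2)`. -/
def negUnit : UnitQuat := ⟨-1, by simp⟩

/-- The Cartan involution `(a,b) ↦ (a,-b)` as an element of `K`. -/
def invol : G2 := quatHom (1, negUnit)

theorem toEnd_invol (x : SplitOct) :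
    G2.toEnd invol x = pr x.1 (-x.2) := by
  apply SplitOct.ext'
  · change (quatAct (1, negUnit) x).1 = x.1
    rw [quatAct_fst]; simp
  · change (quatAct (1, negUnit) x).2 = -x.2
    rw [quatAct_snd]; simp [negUnit]

/-- Fixing (0,1) forces q₂ = q₁, and fixing all (a,0) makes q₁ central in ℍ, hence real of norm one.
-/
theorem quatHom_eq_one (q : UnitQuat × UnitQuat) :
    quatHom q = 1 ↔ q = 1 ∨ ((q.1 : ℍ[ℝ]) = -1 ∧ (q.2 : ℍ[ℝ]) = -1) := by
  constructor
  · intro h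
    have h1 : ∀ x, quatAct q x = x := fun x => by rw [← toEnd_quatHom, h]; rfl
    have h2 : (q.2 : ℍ[ℝ]) = q.1 := by
      have := (quatAct_snd q (pr 0 1)).symm.trans (congrArg Prod.snd (h1 (pr 0 1)))
      simp only [pr_snd, mul_one] at this
      have := congrArg (· * (q.1 : ℍ[ℝ])) this
      simpa [mul_assoc, UnitQuat.star_mul] using this
    have h3 : ∀ a : ℍ[ℝ], (q.1 : ℍ[ℝ]) * a = a * q.1 := fun a => by
      have := (quatAct_fst q (pr a 0)).symm.trans (congrArg Prod.fst (h1 (pr a 0)))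
      have := congrArg (· * (q.1 : ℍ[ℝ])) this
      simpa [mul_assoc, UnitQuat.star_mul] using this
    have e1 := h3 (imq 1 0 0)
    have e2 := h3 (imq 0 1 0)
    have f1 := congrArg QuaternionAlgebra.imJ e1
    have f2 := congrArg QuaternionAlgebra.imK e1
    have f3 := congrArg QuaternionAlgebra.imK e2
    simp at f1 f2 f3
    have g1 : (q.1 : ℍ[ℝ]).imI = 0 := by linarith
    have g2 : (q.1 : ℍ[ℝ]).imJ = 0 := by linarith
    have g3 : (q.1 : ℍ[ℝ]).imK = 0 := by linarith
    have n := UnitQuat.mul_star q.1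
    have n0 := congrArg QuaternionAlgebra.re n
    simp [g1, g2, g3] at n0
    rcases mul_self_eq_one_iff.1 n0 with hr | hr
    · left
      have e : (q.1 : ℍ[ℝ]) = 1 := by ext <;> simp [hr, g1, g2, g3]
      exact Prod.ext (Subtype.ext e) (Subtype.ext (h2.trans e))
    · right
      have e : (q.1 : ℍ[ℝ]) = -1 := by ext <;> simp [hr, g1, g2, g3]
      exact ⟨e, h2.trans e⟩
  · rintro (rfl | ⟨h1, h2⟩)
    · exact map_one _
    · apply G2.toEnd_injective
      ext1 x
      rw [toEnd_quatHom]
      apply SplitOct.ext'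
      · rw [quatAct_fst, h1]; simp [G2.toEnd_one]
      · rw [quatAct_snd, h1, h2]; simp [G2.toEnd_one]

/-! ### Invariance of the bilinear form -/

namespace SplitOct

theorem form_eq_inner (x y : SplitOct) : form x y = (x.1 * star y.1).re - (x.2 * star y.2).re := by
  simp [form]
  ring

theorem conj_eq (x : SplitOct) : conj x = (2 * x.1.re) • (1 : SplitOct) - x := by
  rw [eq_sub_iff_add_eq]
  apply SplitOct.ext'
  · apply Quaternion.ext <;> simp
    ring
  · simp

end SplitOct

theorem G2.re_apply (g : G2) (x : SplitOct) : (G2.toEnd g x).1.re = x.1.re := by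
  have h : x - x.1.re • (1 : SplitOct) ∈ imag := by
    change (x.1 - x.1.re • (1 : ℍ[ℝ])).re = 0
    simp
  have h2 := (G2.preserves g h).1
  rw [map_sub, map_smul, G2.map_one'] at h2
  have h3 : ((G2.toEnd g x).1 - x.1.re • (1 : ℍ[ℝ])).re = 0 := h2
  simp at h3
  linarith

/-- Conjugation is 2 Re(x) - x, so automorphisms commute with it as soon as they preserve the real
part; the form is built from conjugation, product and real part. -/
theorem G2.form_apply (g : G2) (x y : SplitOct) :
    form (G2.toEnd g x) (G2.toEnd g y) = form x y := by
  have h : conj (G2.toEnd g y) = G2.toEnd g (conj y) := by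
    rw [conj_eq, conj_eq, G2.re_apply, map_sub, map_smul, G2.map_one']
  rw [form, h, ← G2.map_mul', G2.re_apply, form]

/-! ### The centralizer of the Cartan involution -/

theorem invol_comm_of_mem {g : G2} (hg : g ∈ maxK) (x : SplitOct) :
    G2.toEnd g (G2.toEnd invol x) = G2.toEnd invol (G2.toEnd g x) := by
  obtain ⟨q, rfl⟩ := hg
  rw [toEnd_invol, toEnd_invol, toEnd_quatHom]
  apply SplitOct.ext'
  · simp [quatAct_fst]
  · simp [quatAct_snd]

theorem quat_eq_zero_of_eq_neg {a : ℍ[ℝ]} (h : a = -a) : a = 0 := by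
  have h2 : (2 : ℝ) • a = 0 := by rw [two_smul]; nth_rewrite 2 [h]; exact add_neg_cancel a
  exact (smul_eq_zero.1 h2).resolve_left two_ne_zero

theorem norm_eq_one_of_mul_star {v : ℍ[ℝ]} (h : v * star v = 1) : ‖v‖ = 1 := by
  rw [Quaternion.self_mul_star] at h
  have := congrArg QuaternionAlgebra.re h
  simp only [Quaternion.re_coe, Quaternion.re_one, Quaternion.normSq_eq_norm_mul_self] at this
  exact (mul_self_eq_one_iff.1 this).resolve_right (by have := norm_nonneg v; intro h; linarith)

/-- The elements of `G₂` that fix the first quaternion entry pointwise. -/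
theorem mem_maxK_of_fix {g : G2} (hc : ∀ x, G2.toEnd g (G2.toEnd invol x) =
    G2.toEnd invol (G2.toEnd g x)) (h : ∀ a, G2.toEnd g (pr a 0) = pr a 0) : g ∈ maxK := by
  set β := (G2.toEnd g (pr 0 1)).2 with hβ
  have h1 : G2.toEnd g (pr 0 1) = pr 0 β := by
    apply SplitOct.ext'
    · have e := hc (pr 0 1)
      rw [toEnd_invol, toEnd_invol] at e
      have e2 : pr (pr 0 1).1 (-(pr 0 1).2) = -pr 0 1 := by
        apply SplitOct.ext'
        · exact (neg_zero (G := ℍ[ℝ])).symm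
        · rfl
      rw [e2, map_neg] at e
      have e3 : -(G2.toEnd g (pr 0 1)).1 = (G2.toEnd g (pr 0 1)).1 := congrArg Prod.fst e
      exact quat_eq_zero_of_eq_neg e3.symm
    · rfl
  have h2 : ‖β‖ = 1 := by
    have e := G2.form_apply g (pr 0 1) (pr 0 1)
    rw [h1, form_self, form_self] at e
    simp at e
    exact e.resolve_right (by have := norm_nonneg β; intro h; linarith)
  refine ⟨(1, ⟨β, by simpa using h2⟩), ?_⟩
  apply G2.toEnd_injective
  ext1 x
  -- ℍ and (0,1) generate the algebra, so g is determined by the image (0,β) of (0,1).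
  have hx : x = pr x.1 0 + pr x.2 0 * pr 0 1 := by
    apply SplitOct.ext' <;> simp
  rw [toEnd_quatHom]
  conv_rhs => rw [hx, map_add, G2.map_mul', h, h, h1]
  apply SplitOct.ext'
  · rw [quatAct_fst]; simp
  · rw [quatAct_snd]; simp

/-- An automorphism commuting with the involution preserves its fixed algebra ℍ and acts there by an
inner automorphism: it takes i, j to an anticommuting pair of unit imaginary quaternions, and
conjugation by some q does the same. Dividing by the element (q,1) of K leaves one that fixes ℍ
pointwise. -/
theorem mem_maxK_of_comm {g : G2} (hc : ∀ x, G2.toEnd g (G2.toEnd invol x) =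
    G2.toEnd invol (G2.toEnd g x)) : g ∈ maxK := by
  have hfst : ∀ a, G2.toEnd g (pr a 0) = pr (G2.toEnd g (pr a 0)).1 0 := fun a => by
    apply SplitOct.ext'
    · rfl
    · have e := hc (pr a 0)
      rw [toEnd_invol, toEnd_invol] at e
      have e2 : pr (pr a 0).1 (-(pr a 0).2) = pr a 0 := by
        apply SplitOct.ext'
        · rfl
        · exact neg_zero (G := ℍ[ℝ])
      rw [e2] at e
      have e3 : (G2.toEnd g (pr a 0)).2 = -(G2.toEnd g (pr a 0)).2 := congrArg Prod.snd e
      exact quat_eq_zero_of_eq_neg e3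
  set α : ℍ[ℝ] → ℍ[ℝ] := fun a => (G2.toEnd g (pr a 0)).1 with hα
  have hre : ∀ a, (α a).re = a.re := fun a => G2.re_apply g (pr a 0)
  have hnorm : ∀ a, ‖a‖ = 1 → ‖α a‖ = 1 := fun a ha => by
    have e := G2.form_apply g (pr a 0) (pr a 0)
    rw [hfst, form_self, form_self] at e
    simp [ha] at e
    exact e.resolve_right (by have := norm_nonneg (α a); intro h; simp only [hα] at this; linarith)
  have hmul : ∀ a b, α (a * b) = α a * α b := fun a b => by
    have e : pr (a * b) 0 = pr a 0 * pr b 0 := by apply SplitOct.ext' <;> simp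
    simp only [hα]
    rw [e, G2.map_mul', hfst a, hfst b]
    simp
  have hneg : ∀ a, α (-a) = -α a := fun a => by
    have e : pr (-a) 0 = -pr a 0 := by
      apply SplitOct.ext'
      · rfl
      · exact (neg_zero (G := ℍ[ℝ])).symm
    simp only [hα]
    rw [e, map_neg]
    rfl
  have nI : ‖imq 1 0 0‖ = 1 := by
    apply norm_eq_one_of_mul_star; apply Quaternion.ext <;> simp
  have nJ : ‖imq 0 1 0‖ = 1 := by
    apply norm_eq_one_of_mul_star; apply Quaternion.ext <;> simp
  have hIJ : imq 1 0 0 * imq 0 1 0 = -(imq 0 1 0 * imq 1 0 0) := by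
    apply Quaternion.ext <;> simp
  obtain ⟨q, hq1, hq2⟩ := exists_intertwine_pair (i := imq 1 0 0) (j := imq 0 1 0)
    (v := α (imq 1 0 0)) (w := α (imq 0 1 0)) rfl rfl (hre _) (hre _) nI nJ (hnorm _ nI)
    (hnorm _ nJ) hIJ (by rw [← hmul, hIJ, hneg, hmul])
  have hK : quatHom (q, 1) ∈ maxK := ⟨_, rfl⟩
  rw [← mul_mem_cancel_left (inv_mem hK)]
  have hact : ∀ a, G2.toEnd (quatHom (q, 1)) (pr a 0) = pr ((q : ℍ[ℝ]) * a * star (q : ℍ[ℝ])) 0 := by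
    intro a
    rw [toEnd_quatHom]
    apply SplitOct.ext'
    · rfl
    · rw [quatAct_snd]; simp
  have key : ∀ a, α a = (q : ℍ[ℝ]) * a * star (q : ℍ[ℝ]) := by
    intro a
    have e1 := UnitQuat.conj_eq hq1
    have e2 := UnitQuat.conj_eq hq2
    have e3 : α (imq 1 0 0 * imq 0 1 0) = (q : ℍ[ℝ]) * (imq 1 0 0 * imq 0 1 0) * star (q : ℍ[ℝ]) := by
      rw [hmul, ← e1, ← e2]
      have := UnitQuat.star_mul q
      rw [mul_assoc, mul_assoc, ← mul_assoc (star (q : ℍ[ℝ])) , ← mul_assoc (star (q : ℍ[ℝ])), this,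
        one_mul]
      simp only [mul_assoc]
    have e0 : α 1 = (q : ℍ[ℝ]) * 1 * star (q : ℍ[ℝ]) := by
      rw [mul_one, UnitQuat.mul_star]
      change (G2.toEnd g 1).1 = 1
      rw [G2.map_one']; rfl
    have ha : a = a.re • (1 : ℍ[ℝ]) + a.imI • imq 1 0 0 + a.imJ • imq 0 1 0 +
        a.imK • (imq 1 0 0 * imq 0 1 0) := by
      apply Quaternion.ext <;> simp
    have hlin : ∀ (c₀ c₁ c₂ c₃ : ℝ) (a₀ a₁ a₂ a₃ : ℍ[ℝ]),
        α (c₀ • a₀ + c₁ • a₁ + c₂ • a₂ + c₃ • a₃) =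
          c₀ • α a₀ + c₁ • α a₁ + c₂ • α a₂ + c₃ • α a₃ := by
      intro c₀ c₁ c₂ c₃ a₀ a₁ a₂ a₃
      have e : pr (c₀ • a₀ + c₁ • a₁ + c₂ • a₂ + c₃ • a₃) 0 =
          c₀ • pr a₀ 0 + c₁ • pr a₁ 0 + c₂ • pr a₂ 0 + c₃ • pr a₃ 0 := by
        apply SplitOct.ext' <;> simp
      simp only [hα]
      rw [e]
      simp only [map_add, map_smul]
      rfl
    conv_lhs => rw [ha]
    rw [hlin, e0, ← e1, ← e2, e3]
    conv_rhs => rw [ha]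
    simp only [mul_add, add_mul, mul_smul_comm, smul_mul_assoc]
  apply mem_maxK_of_fix
  · intro x
    have hK' := invol_comm_of_mem (inv_mem hK)
    rw [G2.toEnd_mul, mul_apply_eq_comp, mul_apply_eq_comp, hc, hK']
  · intro a
    rw [G2.toEnd_mul, mul_apply_eq_comp]
    have : G2.toEnd g (pr a 0) = G2.toEnd (quatHom (q, 1)) (pr a 0) := by
      rw [hact, hfst]
      exact congrArg (fun z => pr z 0) (key a)
    rw [this, G2.toEnd_inv_apply]

/-! ### Maximality of `K` -/

/-- A convex bounded sequence does not increase at the start. -/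
theorem le_of_convex_bounded {a : ℕ → ℝ} (hc : ∀ n, 2 * a (n + 1) ≤ a (n + 2) + a n) {C : ℝ}
    (hb : ∀ n, a n ≤ C) : a 1 ≤ a 0 := by
  by_contra! h
  have h1 : ∀ n, a 1 - a 0 ≤ a (n + 1) - a n := fun n => by
    induction n with
    | zero => exact le_rfl
    | succ n ih => have := hc n; linarith
  have h2 : ∀ n : ℕ, a 0 + n * (a 1 - a 0) ≤ a n := fun n => by
    induction n with
    | zero => simp
    | succ n ih => have := h1 n; push_cast; linarith
  obtain ⟨n, hn⟩ := exists_nat_gt ((C - a 0) / (a 1 - a 0))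
  rw [div_lt_iff₀ (by linarith)] at hn
  have := h2 n
  have := hb n
  linarith

namespace SplitOct

/-- The Euclidean inner product on the split octonions. -/
def euc (x y : SplitOct) : ℝ := form x (G2.toEnd invol y)

theorem form_comm (x y : SplitOct) : form x y = form y x := by
  rw [form_eq_inner, form_eq_inner]
  simp
  ring

theorem form_add_left (x y z : SplitOct) : form (x + y) z = form x z + form y z := by
  simp only [form, SplitOct.add_mul', add_fst, Quaternion.re_add]

theorem form_sub_left (x y z : SplitOct) : form (x - y) z = form x z - form y z := by
  rw [eq_sub_iff_add_eq, ← form_add_left, sub_add_cancel]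

theorem euc_self (x : SplitOct) : euc x x = ‖x.1‖ ^ 2 + ‖x.2‖ ^ 2 := by
  rw [euc, toEnd_invol, form_eq_inner]
  simp only [pr_fst, pr_snd, star_neg, mul_neg, Quaternion.self_mul_star,
    Quaternion.normSq_eq_norm_mul_self]
  simp [pow_two]

theorem invol_invol (x : SplitOct) : G2.toEnd invol (G2.toEnd invol x) = x := by
  rw [toEnd_invol, toEnd_invol]
  apply SplitOct.ext' <;> simp

theorem euc_comm (x y : SplitOct) : euc x y = euc y x := by
  rw [euc, ← G2.form_apply invol, invol_invol, form_comm, euc]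

theorem euc_sub_left (x y z : SplitOct) : euc (x - y) z = euc x z - euc y z := form_sub_left _ _ _

theorem euc_nonneg (x : SplitOct) : 0 ≤ euc x x := by rw [euc_self]; positivity

theorem eq_zero_of_euc {x : SplitOct} (h : euc x x = 0) : x = 0 := by
  rw [euc_self] at h
  have h1 : ‖x.1‖ ^ 2 = 0 := by nlinarith [sq_nonneg ‖x.1‖, sq_nonneg ‖x.2‖]
  have h2 : ‖x.2‖ ^ 2 = 0 := by nlinarith [sq_nonneg ‖x.1‖, sq_nonneg ‖x.2‖]
  apply SplitOct.ext'
  · simpa using h1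
  · simpa using h2

theorem euc_sub_self (x y : SplitOct) : euc (x - y) (x - y) = euc x x - 2 * euc x y + euc y y := by
  rw [euc_sub_left, euc_comm x, euc_comm y, euc_sub_left, euc_sub_left, euc_comm y x]
  ring

theorem euc_le (x : SplitOct) : euc x x ≤ 2 * ‖x‖ ^ 2 := by
  rw [euc_self]
  have h1 : ‖x.1‖ ≤ ‖x‖ := le_max_left _ _
  have h2 : ‖x.2‖ ≤ ‖x‖ := le_max_right _ _
  nlinarith [norm_nonneg x.1, norm_nonneg x.2]

end SplitOct

/-- A self-adjoint element of a bounded subgroup does not increase the Euclidean norm. -/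
theorem euc_apply_le {p : G2} (hsym : ∀ x y, euc (G2.toEnd p x) y = euc x (G2.toEnd p y)) {C : ℝ}
    (hC : ∀ n : ℕ, ‖G2.toEnd (p ^ n)‖ ≤ C) (x : SplitOct) :
    euc (G2.toEnd p x) (G2.toEnd p x) ≤ euc x x := by
  have hs : ∀ (n : ℕ) x, G2.toEnd (p ^ (n + 1)) x = G2.toEnd p (G2.toEnd (p ^ n) x) := fun n x => by
    rw [pow_succ', G2.toEnd_mul]; rfl
  have := le_of_convex_bounded (a := fun n => euc (G2.toEnd (p ^ n) x) (G2.toEnd (p ^ n) x))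
    (C := 2 * (C * ‖x‖) ^ 2) (fun n => ?_) (fun n => ?_)
  · simpa [G2.toEnd_one] using this
  -- Self-adjointness gives ⟨pⁿ⁺²x, pⁿx⟩ = ‖pⁿ⁺¹x‖², so nonnegativity of ‖pⁿ⁺²x - pⁿx‖² is convexity
  -- of n ↦ ‖pⁿx‖².
  · have h := euc_nonneg (G2.toEnd (p ^ (n + 2)) x - G2.toEnd (p ^ n) x)
    rw [euc_sub_self, hs (n + 1), hsym _ (G2.toEnd (p ^ n) x), ← hs n] at h
    rw [hs (n + 1)]
    linarith
  · refine (euc_le _).trans ?_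
    have h1 : ‖G2.toEnd (p ^ n) x‖ ≤ C * ‖x‖ :=
      (ContinuousLinearMap.le_opNorm _ _).trans (mul_le_mul_of_nonneg_right (hC n) (norm_nonneg _))
    have := norm_nonneg (G2.toEnd (p ^ n) x)
    gcongr

/-- A positive operator whose powers, and those of its inverse, are bounded is the identity. This is
applied to g g*, in place of a polar decomposition. -/
theorem mem_maxK_of_bounded {K' : Subgroup G2} (hK : maxK ≤ K') {C : ℝ}
    (hC : ∀ g ∈ K', ‖G2.toEnd g‖ ≤ C) {g : G2} (hg : g ∈ K') : g ∈ maxK := by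
  have hs : invol ∈ K' := hK ⟨_, rfl⟩
  set S := G2.toEnd invol with hS
  -- For `euc` the adjoint of g is S g⁻¹ S, so p = g g*; as S ∈ K, it lies in the given group.
  set p : G2 := g * invol * g⁻¹ * invol with hp
  have hpK : p ∈ K' := mul_mem (mul_mem (mul_mem hg hs) (inv_mem hg)) hs
  have hpx : ∀ x, G2.toEnd p x = G2.toEnd g (S (G2.toEnd g⁻¹ (S x))) := fun x => rfl
  have e : ∀ x y, euc (G2.toEnd p x) y = euc (G2.toEnd g⁻¹ (S x)) (G2.toEnd g⁻¹ (S y)) := by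
    intro x y
    rw [hpx, euc, ← G2.form_apply g⁻¹, G2.toEnd_inv_apply, ← G2.form_apply invol, ← hS, euc]
    rw [hS, invol_invol]
  have hsym : ∀ x y, euc (G2.toEnd p x) y = euc x (G2.toEnd p y) := fun x y => by
    rw [e, euc_comm, ← e, euc_comm]
  have hsym' : ∀ x y, euc (G2.toEnd p⁻¹ x) y = euc x (G2.toEnd p⁻¹ y) := fun x y => by
    rw [← G2.toEnd_apply_inv p y, ← hsym, G2.toEnd_apply_inv, G2.toEnd_apply_inv]
  have h1 := euc_apply_le hsym fun n => hC _ (pow_mem hpK n)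
  have h2 := euc_apply_le hsym' fun n => hC _ (pow_mem (inv_mem hpK) n)
  have h3 : ∀ x, euc (G2.toEnd p x) (G2.toEnd p x) = euc x x := fun x => by
    refine le_antisymm (h1 x) ?_
    have := h2 (G2.toEnd p x)
    rwa [G2.toEnd_inv_apply] at this
  -- For a self-adjoint isometry ‖p²x - x‖² = 2‖x‖² - 2‖px‖² = 0.
  have h4 : ∀ x, G2.toEnd p (G2.toEnd p x) = x := fun x => by
    rw [← sub_eq_zero]
    apply eq_zero_of_euc
    rw [euc_sub_self, h3 (G2.toEnd p x), h3, hsym (G2.toEnd p x) x, h3]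
    ring
  -- As p² = 1, the vector px - x belongs to the eigenvalue -1, which positivity of p excludes
  -- unless it is zero.
  have h5 : ∀ x, G2.toEnd p x = x := fun x => by
    rw [← sub_eq_zero]
    set y := G2.toEnd p x - x with hy
    have hpy : G2.toEnd p y = -y := by rw [hy, map_sub, h4, neg_sub]
    have h6 : 0 ≤ euc (G2.toEnd p y) y := by rw [e]; exact euc_nonneg _
    have h7 : euc (G2.toEnd p y) y = -euc y y := by
      rw [hpy, ← zero_sub, euc_sub_left]
      have : euc 0 y = 0 := by
        have := euc_sub_left y y y
        rwa [sub_self, sub_self] at this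
      rw [this, zero_sub]
    exact eq_zero_of_euc (le_antisymm (by linarith) (euc_nonneg y))
  apply mem_maxK_of_comm
  intro x
  have h8 := h5 (S (G2.toEnd g x))
  rwa [hpx, hS, invol_invol, G2.toEnd_inv_apply] at h8

theorem continuous_quatHom : Continuous quatHom := by
  have h : Continuous fun q : UnitQuat × UnitQuat => quatAct q := by
    rw [continuous_clm_apply]
    intro x
    have h1 : Continuous fun q : UnitQuat × UnitQuat => (q.1 : ℍ[ℝ]) :=
      continuous_subtype_val.comp continuous_fst
    have h2 : Continuous fun q : UnitQuat × UnitQuat => (q.2 : ℍ[ℝ]) :=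
      continuous_subtype_val.comp continuous_snd
    exact ((h1.mul continuous_const).mul h1.star).prodMk ((h2.mul continuous_const).mul h1.star)
  refine Continuous.subtype_mk ?_ _
  rw [Units.continuous_iff]
  exact ⟨h, h.comp continuous_inv⟩

theorem isMaximalCompact_maxK : IsMaximalCompact maxK := by
  refine ⟨?_, fun K' hK hc => le_antisymm (fun g hg => ?_) hK⟩
  · have : (maxK : Set G2) = Set.range quatHom := MonoidHom.coe_range _
    rw [this]
    exact isCompact_range continuous_quatHom
  · obtain ⟨C, hC⟩ := (hc.image continuous_toEnd).isBounded.exists_norm_le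
    exact mem_maxK_of_bounded hK (C := C) (fun g hg => hC _ ⟨g, hg, rfl⟩) hg

/-! ### Transitivity -/

theorem NullVec.norm_eq (x : NullVec) : ‖x.1.1‖ = ‖x.1.2‖ := by
  have h := x.2.2.1
  rw [form_self, sub_eq_zero] at h
  exact (sq_eq_sq₀ (norm_nonneg _) (norm_nonneg _)).1 h

theorem NullVec.norm_pos (x : NullVec) : 0 < ‖x.1.1‖ := by
  refine lt_of_le_of_ne (norm_nonneg _) fun h => x.2.2.2 ?_
  have h2 := x.norm_eq
  rw [← h] at h2
  exact SplitOct.ext' (norm_eq_zero.1 h.symm) (norm_eq_zero.1 h2.symm)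

theorem nb_seven : nb 7 = pr (imq 0 0 (1 / 2)) (imq 0 0 (1 / 2)) := by
  apply crd.injective
  rw [crd_nb, crd_apply]
  ext k
  fin_cases k <;> simp
  norm_num

/-- With `nb 7` on the ray of (k,k), the first quaternion turns k into the direction of the first
entry; the second one is then free to adjust the second entry. -/
theorem exists_quatHom_smul_base (c : NullRay) : ∃ q, quatHom q • baseRay = c := by
  obtain ⟨x, rfl⟩ : ∃ x, NullRay.mk x = c := Quotient.exists_rep c
  have hp := x.norm_pos
  have hp2 : 0 < ‖x.1.2‖ := x.norm_eq ▸ hp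
  have nK : ‖imq 0 0 1‖ = 1 := by
    apply norm_eq_one_of_mul_star; apply Quaternion.ext <;> simp
  have hre : x.1.1.re = 0 := x.2.1
  obtain ⟨q, hq⟩ := exists_intertwine (v := imq 0 0 1) (w := ‖x.1.1‖⁻¹ • x.1.1) rfl
    (by simp [hre]) nK (by rw [norm_smul, norm_inv, norm_norm, inv_mul_cancel₀ hp.ne'])
  have hq' := UnitQuat.conj_eq hq
  have nq : ‖(q : ℍ[ℝ])‖ = 1 := norm_eq_of_mem_sphere q
  -- The second quaternion solves q₂ k q̄₁ = x₂/‖x₂‖.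
  refine ⟨(q, ⟨‖x.1.2‖⁻¹ • x.1.2 * (q : ℍ[ℝ]) * star (imq 0 0 1), ?_⟩), ?_⟩
  · rw [mem_sphere_zero_iff_norm, norm_mul, norm_mul, norm_star, nK, nq, norm_smul, norm_inv,
      norm_norm, inv_mul_cancel₀ hp2.ne', mul_one, mul_one]
  · rw [baseRay, NullRay.smul_mk, NullRay.mk_eq_mk]
    -- The factor 2 appears because the entries of `nb 7` are k/2.
    refine ⟨2 * ‖x.1.1‖, by positivity, ?_⟩
    rw [NullVec.smul_val]
    change x.1 = (2 * ‖x.1.1‖) • quatAct _ (nb 7)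
    have hk : imq 0 0 (1 / 2) = (1 / 2 : ℝ) • imq 0 0 1 := by apply Quaternion.ext <;> simp
    have ks : star (imq 0 0 1) * imq 0 0 1 = 1 := by apply Quaternion.ext <;> simp
    rw [nb_seven, hk]
    apply SplitOct.ext'
    · rw [smul_fst, quatAct_fst, pr_fst, mul_smul_comm, smul_mul_assoc]
      simp only
      rw [hq', smul_smul, smul_smul]
      have : 2 * ‖x.1.1‖ * (1 / 2) * ‖x.1.1‖⁻¹ = 1 := by field_simp
      rw [this, one_smul]
    · rw [smul_snd, quatAct_snd, pr_snd, mul_smul_comm, smul_mul_assoc]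
      simp only
      rw [mul_assoc _ (star (imq 0 0 1)), ks, mul_one, mul_assoc, UnitQuat.mul_star, mul_one,
        smul_smul, smul_smul, ← x.norm_eq]
      have : 2 * ‖x.1.1‖ * (1 / 2) * ‖x.1.1‖⁻¹ = 1 := by field_simp
      rw [this, one_smul]

theorem isPretransitive_maxK : MulAction.IsPretransitive maxK NullRay := by
  refine ⟨fun c d => ?_⟩
  obtain ⟨p, hp⟩ := exists_quatHom_smul_base c
  obtain ⟨q, hq⟩ := exists_quatHom_smul_base d
  refine ⟨⟨quatHom q * (quatHom p)⁻¹, mul_mem ⟨_, rfl⟩ (inv_mem ⟨_, rfl⟩)⟩, ?_⟩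
  change (quatHom q * (quatHom p)⁻¹) • c = d
  rw [mul_smul, ← hp, inv_smul_smul, hq]

theorem isPretransitive_G2 : MulAction.IsPretransitive G2 NullRay := by
  refine ⟨fun c d => ?_⟩
  obtain ⟨k, hk⟩ := isPretransitive_maxK.exists_smul_eq c d
  exact ⟨k.1, hk⟩

/-! ### The Lie algebra of `K` -/

/-- K is the centralizer of the involution in G₂, so its Lie algebra is the centralizer in 𝔤₂; one
direction differentiates, the other uses uniqueness of the flow. -/
theorem mem_lieAlg_maxK {ξ : SplitOct →L[ℝ] SplitOct} : ξ ∈ lieAlg maxK ↔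
    ξ ∈ g2 ∧ ∀ x, ξ (G2.toEnd invol x) = G2.toEnd invol (ξ x) := by
  constructor
  · intro h
    refine ⟨mem_g2_of_mem_lieAlg h, fun x => ?_⟩
    have h1 : ∀ t : ℝ, NormedSpace.exp (t • ξ) (G2.toEnd invol x) =
        G2.toEnd invol (NormedSpace.exp (t • ξ) x) := fun t => by
      obtain ⟨g, hg, e⟩ := h t
      rw [← e, invol_comm_of_mem hg]
    have h2 := (G2.toEnd invol).hasFDerivAt.comp_hasDerivAt (0 : ℝ)
      (hasDerivAt_exp_smul_apply_zero ξ x)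
    have h3 := hasDerivAt_exp_smul_apply_zero ξ (G2.toEnd invol x)
    simp_rw [h1] at h3
    exact h3.unique h2
  · rintro ⟨hξ, hc⟩
    refine (mem_lieAlg_iff ⟨ξ, hξ⟩).2 fun t => mem_maxK_of_comm fun x => ?_
    rw [G2.toEnd_exp]
    have := eq_exp_smul_apply (ξ := ξ) (γ := fun t => G2.toEnd invol (NormedSpace.exp (t • ξ) x))
      (fun t => by
        rw [hc]
        exact (G2.toEnd invol).hasFDerivAt.comp_hasDerivAt t (hasDerivAt_exp_smul_apply ξ x t)) t
    simpa using this.symm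

/-! ### Transport of a smooth structure along a homeomorphism -/

section Pullback

variable {E E' H M N : Type*} [NormedAddCommGroup E] [NormedSpace ℝ E] [NormedAddCommGroup E']
  [NormedSpace ℝ E'] [TopologicalSpace H] [TopologicalSpace M] [TopologicalSpace N]
  [ChartedSpace H N] (I : ModelWithCorners ℝ E H) [I.Boundaryless] (f : M ≃ₜ N) (L : E ≃L[ℝ] E')

/-- The chart of `M` that corresponds to a chart of `N`. -/
def pullbackChart (c : OpenPartialHomeomorph N H) : OpenPartialHomeomorph M E' :=
  f.toOpenPartialHomeomorph ≫ₕ c ≫ₕ (I.toHomeomorph.trans L.toHomeomorph).toOpenPartialHomeomorph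

/-- The charts of `N`, transported to `M` along a homeomorphism. -/
abbrev pullbackChartedSpace : ChartedSpace E' M where
  atlas := pullbackChart I f L '' atlas H N
  chartAt p := pullbackChart I f L (chartAt H (f p))
  mem_chart_source p := by simp [pullbackChart]
  chart_mem_atlas p := Set.mem_image_of_mem _ (chart_mem_atlas H _)

theorem isManifold_pullback [IsManifold I ∞ N] :
    letI := pullbackChartedSpace I f L
    IsManifold 𝓘(ℝ, E') ∞ M := by
  let _ := pullbackChartedSpace I f L
  refine isManifold_of_contDiffOn _ _ _ ?_
  rintro _ _ ⟨c, hc, rfl⟩ ⟨c', hc', rfl⟩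
  have h := ((contDiffGroupoid ∞ I).compatible hc hc')
  rw [contDiffGroupoid, mem_groupoid_of_pregroupoid] at h
  have h1 : ContDiffOn ℝ ∞ (I ∘ (c.symm ≫ₕ c') ∘ I.symm)
    (I.symm ⁻¹' (c.symm ≫ₕ c').source ∩ Set.range I) := h.1
  have h2 := L.contDiff.comp_contDiffOn (h1.comp L.symm.contDiff.contDiffOn (s := 
    L.symm ⁻¹' (I.symm ⁻¹' (c.symm ≫ₕ c').source ∩ Set.range I)) (fun x hx => hx))
  refine (h2.congr fun x hx => ?_).mono fun x hx => ?_
  · simp [pullbackChart, ModelWithCorners.toHomeomorph]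
  · simpa [pullbackChart, ModelWithCorners.toHomeomorph, I.range_eq_univ] using hx

theorem contMDiff_pullback [IsManifold I ∞ N] :
    letI := pullbackChartedSpace I f L
    ContMDiff 𝓘(ℝ, E') I ∞ f := by
  let _ := pullbackChartedSpace I f L
  have _ := isManifold_pullback I f L
  intro p
  have hc : chartAt E' p = pullbackChart I f L (chartAt H (f p)) := rfl
  have h1 := (contMDiffOn_extChartAt (I := 𝓘(ℝ, E')) (n := ∞) (x := p)).contMDiffAt
    ((chartAt E' p).open_source.mem_nhds (mem_chart_source E' p))
  have h2 := (contMDiffOn_extChartAt_symm (I := I) (n := ∞) (f p)).contMDiffAt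
    (extChartAt_target_mem_nhds (I := I) (f p))
  have h3 : L.symm (extChartAt 𝓘(ℝ, E') p p) = extChartAt I (f p) (f p) := by
    simp [hc, pullbackChart, ModelWithCorners.toHomeomorph]
  have h4 : ContMDiffAt 𝓘(ℝ, E') I ∞
      (fun z => (extChartAt I (f p)).symm (L.symm (extChartAt 𝓘(ℝ, E') p z))) p :=
    ContMDiffAt.comp p (h3 ▸ h2) (L.symm.contDiff.contMDiff.contMDiffAt.comp p h1)
  refine h4.congr_of_eventuallyEq ?_
  filter_upwards [(chartAt E' p).open_source.mem_nhds (mem_chart_source E' p)] with z hz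
  have hz' : f z ∈ (chartAt H (f p)).source := by
    simpa [hc, pullbackChart] using hz
  simp [hc, pullbackChart, ModelWithCorners.toHomeomorph]
  exact ((chartAt H (f p)).left_inv hz').symm

theorem contMDiff_pullback_symm [IsManifold I ∞ N] :
    letI := pullbackChartedSpace I f L
    ContMDiff I 𝓘(ℝ, E') ∞ f.symm := by
  let _ := pullbackChartedSpace I f L
  have _ := isManifold_pullback I f L
  intro q
  obtain ⟨p, rfl⟩ := f.surjective q
  have hc : chartAt E' p = pullbackChart I f L (chartAt H (f p)) := rfl
  have h1 := (contMDiffOn_extChartAt (I := I) (n := ∞) (x := f p)).contMDiffAt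
    ((chartAt H (f p)).open_source.mem_nhds (mem_chart_source H (f p)))
  have h2 := (contMDiffOn_extChartAt_symm (I := 𝓘(ℝ, E')) (n := ∞) p).contMDiffAt
    (extChartAt_target_mem_nhds (I := 𝓘(ℝ, E')) p)
  have h3 : L (extChartAt I (f p) (f p)) = extChartAt 𝓘(ℝ, E') p p := by
    simp [hc, pullbackChart, ModelWithCorners.toHomeomorph]
  have h4 : ContMDiffAt I 𝓘(ℝ, E') ∞
      (fun z => (extChartAt 𝓘(ℝ, E') p).symm (L (extChartAt I (f p) z))) (f p) :=
    ContMDiffAt.comp (f p) (h3 ▸ h2) (L.contDiff.contMDiff.contMDiffAt.comp (f p) h1)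
  refine h4.congr_of_eventuallyEq ?_
  filter_upwards [(chartAt H (f p)).open_source.mem_nhds (mem_chart_source H (f p))] with z hz
  simp [hc, pullbackChart, ModelWithCorners.toHomeomorph]
  exact ((chartAt H (f p)).left_inv hz).symm

end Pullback

/-! ### The space of null rays as a product of spheres -/

/-- The imaginary quaternion with given coordinates. -/
def imQuat : EuclideanSpace ℝ (Fin 3) →ₗᵢ[ℝ] ℍ[ℝ] where
  toFun x := imq (x 0) (x 1) (x 2)
  map_add' x y := by apply Quaternion.ext <;> simp
  map_smul' c x := by apply Quaternion.ext <;> simp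
  norm_map' x := by
    change ‖imq (x 0) (x 1) (x 2)‖ = ‖x‖
    rw [← sq_eq_sq₀ (norm_nonneg _) (norm_nonneg _), EuclideanSpace.norm_sq_eq, sq,
      ← Quaternion.normSq_eq_norm_mul_self, Quaternion.normSq_def', Fin.sum_univ_three]
    simp

/-- The coordinates of the imaginary part of a quaternion. -/
def imCoord : ℍ[ℝ] →L[ℝ] EuclideanSpace ℝ (Fin 3) := LinearMap.toContinuousLinearMap
  { toFun := fun q => !₂[q.imI, q.imJ, q.imK]
    map_add' := fun x y => by ext i; fin_cases i <;> simp
    map_smul' := fun c x => by ext i; fin_cases i <;> simp }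

theorem imQuat_apply (x : EuclideanSpace ℝ (Fin 3)) : imQuat x = imq (x 0) (x 1) (x 2) := rfl

theorem imCoord_apply (q : ℍ[ℝ]) : imCoord q = !₂[q.imI, q.imJ, q.imK] := rfl

theorem imQuat_imCoord {q : ℍ[ℝ]} (hq : q.re = 0) : imQuat (imCoord q) = q := by
  rw [imQuat_apply, imCoord_apply]
  exact (eq_imq hq).symm

theorem imCoord_imQuat (x : EuclideanSpace ℝ (Fin 3)) : imCoord (imQuat x) = x := by
  rw [imQuat_apply, imCoord_apply]; ext i; fin_cases i <;> simp

theorem norm_imCoord {q : ℍ[ℝ]} (hq : q.re = 0) : ‖imCoord q‖ = ‖q‖ := by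
  rw [← imQuat.norm_map, imQuat_imCoord hq]

namespace NullRay

theorem rep_mk (x : NullVec) : (mk x).rep = ‖x.1.1‖⁻¹ • x.1 := rfl

theorem exists_rep_eq (c : NullRay) : ∃ x : NullVec, c = mk x ∧ x.1 = c.rep := by
  obtain ⟨x, rfl⟩ := Quotient.exists_rep c
  have hp := inv_pos.2 x.norm_pos
  refine ⟨⟨‖x.1.1‖⁻¹ • x.1, imag.smul_mem _ x.2.1, ?_, smul_ne_zero hp.ne' x.2.2.2⟩,
    mk_eq_mk.2 ⟨‖x.1.1‖⁻¹, hp, rfl⟩, rfl⟩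
  rw [form_self, smul_fst, smul_snd, norm_smul, norm_smul, x.norm_eq, sub_self]

theorem rep_injective : Function.Injective rep := by
  intro c c' h
  obtain ⟨x, hc, hx⟩ := exists_rep_eq c
  obtain ⟨y, hc', hy⟩ := exists_rep_eq c'
  rw [hc, hc', Subtype.ext (hx.trans (h.trans hy.symm))]

theorem rep_re (c : NullRay) : c.rep.1.re = 0 := by
  obtain ⟨x, -, h⟩ := exists_rep_eq c
  rw [← h]; exact x.2.1

theorem norm_rep_fst (c : NullRay) : ‖c.rep.1‖ = 1 := by
  obtain ⟨x, rfl⟩ := Quotient.exists_rep c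
  change ‖(‖x.1.1‖⁻¹ • x.1).1‖ = 1
  rw [smul_fst, norm_smul, norm_inv, norm_norm, inv_mul_cancel₀ x.norm_pos.ne']

theorem norm_rep_snd (c : NullRay) : ‖c.rep.2‖ = 1 := by
  obtain ⟨x, -, h⟩ := exists_rep_eq c
  rw [← norm_rep_fst c, ← h, x.norm_eq]

/-- The ray of a pair of unit quaternions, the first of which is imaginary. -/
def ofUnit (v h : ℍ[ℝ]) (hv : v.re = 0) (h1 : ‖v‖ = 1) (h2 : ‖h‖ = 1) : NullRay :=
  mk ⟨pr v h, hv, by rw [form_self, pr_fst, pr_snd, h1, h2, sub_self], fun e => by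
    have := congrArg (fun x : SplitOct => x.1) e
    simp only [pr_fst, zero_fst] at this
    rw [this, norm_zero] at h1
    exact zero_ne_one h1⟩

theorem rep_ofUnit {v h : ℍ[ℝ]} (hv : v.re = 0) (h1 : ‖v‖ = 1) (h2 : ‖h‖ = 1) :
    (ofUnit v h hv h1 h2).rep = pr v h := by
  change ‖v‖⁻¹ • pr v h = pr v h
  rw [h1, inv_one, one_smul]

theorem continuous_rep : Continuous rep := by
  refine Continuous.quotient_lift (f := fun x : NullVec => ‖x.1.1‖⁻¹ • x.1) ?_ _
  have h0 : Continuous fun x : NullVec => x.1 := continuous_subtype_val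
  have h1 : Continuous fun x : NullVec => ‖x.1.1‖ := (continuous_fst.comp h0).norm
  exact (h1.inv₀ fun x => x.norm_pos.ne').smul h0

/-- The space of null rays is homeomorphic to the product of spheres. -/
def homeo : NullRay ≃ₜ S3 × S2 where
  toFun c := (⟨Quaternion.linearIsometryEquivTuple c.rep.2, by
      rw [mem_sphere_zero_iff_norm, LinearIsometryEquiv.norm_map, norm_rep_snd]⟩,
    ⟨imCoord c.rep.1, by
      rw [mem_sphere_zero_iff_norm, norm_imCoord c.rep_re, norm_rep_fst]⟩)
  invFun p := ofUnit (imQuat p.2.1) (Quaternion.linearIsometryEquivTuple.symm p.1.1) rfl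
    (by rw [imQuat.norm_map, norm_eq_of_mem_sphere])
    (by rw [LinearIsometryEquiv.norm_map, norm_eq_of_mem_sphere])
  left_inv c := rep_injective <| by
    refine (rep_ofUnit _ _ _).trans (SplitOct.ext' ?_ ?_)
    · exact imQuat_imCoord c.rep_re
    · exact LinearIsometryEquiv.symm_apply_apply _ _
  right_inv p := by
    refine Prod.ext (Subtype.ext ?_) (Subtype.ext ?_)
    · exact (congrArg (fun x : SplitOct => Quaternion.linearIsometryEquivTuple x.2)
        (rep_ofUnit _ _ _)).trans (LinearIsometryEquiv.apply_symm_apply _ _)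
    · exact (congrArg (fun x : SplitOct => imCoord x.1) (rep_ofUnit _ _ _)).trans
        (imCoord_imQuat _)
  continuous_toFun := by
    refine ((Quaternion.linearIsometryEquivTuple.continuous.comp
      (continuous_snd.comp continuous_rep)).subtype_mk _).prodMk
      ((imCoord.continuous.comp (continuous_fst.comp continuous_rep)).subtype_mk _)
  continuous_invFun := by
    refine continuous_quotient_mk'.comp (Continuous.subtype_mk ?_ _)
    exact (imQuat.continuous.comp (continuous_subtype_val.comp continuous_snd)).prodMk
      (Quaternion.linearIsometryEquivTuple.symm.continuous.comp
        (continuous_subtype_val.comp continuous_fst))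

end NullRay

/-! ### Smoothness of the representative and the smooth structure of the null rays. -/

section Chain

variable {E H M V W : Type*} [NormedAddCommGroup E] [NormedSpace ℝ E] [TopologicalSpace H]
  {I : ModelWithCorners ℝ E H} [TopologicalSpace M] [ChartedSpace H M] [NormedAddCommGroup V]
  [NormedSpace ℝ V] [NormedAddCommGroup W] [NormedSpace ℝ W] {f : M → V} {G : V → W} {c : M}

theorem mfderiv_comp_space (hG : DifferentiableAt ℝ G (f c)) (hf : MDifferentiableAt I 𝓘(ℝ, V) f c)
    (w : TangentSpace I c) : mfderiv I 𝓘(ℝ, W) (fun m => G (f m)) c w =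
      fderiv ℝ G (f c) (mfderiv I 𝓘(ℝ, V) f c w) := by
  have := mfderiv_comp c (I'' := 𝓘(ℝ, W)) hG.mdifferentiableAt hf
  rw [mfderiv_eq_fderiv] at this
  exact DFunLike.congr_fun this w

end Chain

section Sphere

variable {n : ℕ}

theorem contMDiff_coe_euclideanSphere :
    ContMDiff (𝓡 n) 𝓘(ℝ, EuclideanSpace ℝ (Fin (n + 1))) ∞
      ((↑) : Metric.sphere (0 : EuclideanSpace ℝ (Fin (n + 1))) 1 → EuclideanSpace ℝ (Fin (n + 1))) := by
  have := Fact.mk (finrank_euclideanSpace_fin (𝕜 := ℝ) (n := n + 1))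
  exact contMDiff_coe_sphere

theorem mfderiv_coe_euclideanSphere_injective
    (v : Metric.sphere (0 : EuclideanSpace ℝ (Fin (n + 1))) 1) :
    Function.Injective (mfderiv (𝓡 n) 𝓘(ℝ, EuclideanSpace ℝ (Fin (n + 1)))
      ((↑) : Metric.sphere (0 : EuclideanSpace ℝ (Fin (n + 1))) 1 → EuclideanSpace ℝ (Fin (n + 1))) v) := by
  have := Fact.mk (finrank_euclideanSpace_fin (𝕜 := ℝ) (n := n + 1))
  convert! injective_mvfderiv_subtypeVal_sphere v

theorem ContMDiff.codRestrict_euclideanSphere {E H M : Type*} [NormedAddCommGroup E]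
    [NormedSpace ℝ E] [TopologicalSpace H] {I : ModelWithCorners ℝ E H} [TopologicalSpace M]
    [ChartedSpace H M] [IsManifold I ∞ M] {f : M → EuclideanSpace ℝ (Fin (n + 1))}
    (hf : ContMDiff I 𝓘(ℝ, EuclideanSpace ℝ (Fin (n + 1))) ∞ f)
    (hf' : ∀ x, f x ∈ Metric.sphere (0 : EuclideanSpace ℝ (Fin (n + 1))) 1) :
    ContMDiff I (𝓡 n) ∞
      (Set.codRestrict _ _ hf' : M → Metric.sphere (0 : EuclideanSpace ℝ (Fin (n + 1))) 1) := by
  have := Fact.mk (finrank_euclideanSpace_fin (𝕜 := ℝ) (n := n + 1))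
  exact hf.codRestrict_sphere hf'

end Sphere

/-- The pair of quaternions with given coordinates. -/
def pairOct : EuclideanSpace ℝ (Fin 4) × EuclideanSpace ℝ (Fin 3) →L[ℝ] SplitOct :=
  (imQuat.toContinuousLinearMap.comp (ContinuousLinearMap.snd ℝ _ _)).prod
    ((Quaternion.linearIsometryEquivTuple.symm.toContinuousLinearEquiv :
      EuclideanSpace ℝ (Fin 4) →L[ℝ] ℍ[ℝ]).comp (ContinuousLinearMap.fst ℝ _ _))

theorem pairOct_injective : Function.Injective pairOct := fun x y h => by
  have h1 : imQuat x.2 = imQuat y.2 := congrArg Prod.fst h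
  have h2 : Quaternion.linearIsometryEquivTuple.symm x.1 =
    Quaternion.linearIsometryEquivTuple.symm y.1 := congrArg Prod.snd h
  exact Prod.ext (LinearIsometryEquiv.injective _ h2) (imQuat.injective h1)

/-- Identification of the model space of the product of spheres with the standard one. -/
def modelEquiv : (EuclideanSpace ℝ (Fin 3) × EuclideanSpace ℝ (Fin 2)) ≃L[ℝ] E5 :=
  ContinuousLinearEquiv.ofFinrankEq (by simp)

/-- Taking the charts from S³ × S² makes the diffeomorphism immediate; compatibility with the
embedding in the rays of V is what has to be proved, in `isRaySubmanifold`. -/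
instance NullRay.chartedSpace : ChartedSpace E5 NullRay :=
  pullbackChartedSpace ((𝓡 3).prod (𝓡 2)) NullRay.homeo modelEquiv

instance NullRay.isManifold : IsManifold 𝓘(ℝ, E5) ∞ NullRay :=
  isManifold_pullback ((𝓡 3).prod (𝓡 2)) NullRay.homeo modelEquiv

namespace NullRay

/-- The space of null rays is diffeomorphic to the product of spheres. -/
def diffeo : NullRay ≃ₘ⟮𝓘(ℝ, E5), (𝓡 3).prod (𝓡 2)⟯ (S3 × S2) where
  toEquiv := homeo.toEquiv
  contMDiff_toFun := contMDiff_pullback ((𝓡 3).prod (𝓡 2)) homeo modelEquiv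
  contMDiff_invFun := contMDiff_pullback_symm ((𝓡 3).prod (𝓡 2)) homeo modelEquiv

/-- The inclusion of the product of spheres in the product of vector spaces. -/
def sphIncl (p : S3 × S2) : EuclideanSpace ℝ (Fin 4) × EuclideanSpace ℝ (Fin 3) := (p.1, p.2)

theorem contMDiff_sphIncl : ContMDiff ((𝓡 3).prod (𝓡 2))
    𝓘(ℝ, EuclideanSpace ℝ (Fin 4) × EuclideanSpace ℝ (Fin 3)) ∞ sphIncl :=
  ((contMDiff_coe_euclideanSphere (n := 3)).comp contMDiff_fst).prodMk_space
    ((contMDiff_coe_euclideanSphere (n := 2)).comp contMDiff_snd)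

theorem mfderiv_sphIncl_injective (p : S3 × S2) : Function.Injective
    (mfderiv ((𝓡 3).prod (𝓡 2)) 𝓘(ℝ, EuclideanSpace ℝ (Fin 4) × EuclideanSpace ℝ (Fin 3))
      sphIncl p) := by
  rw [injective_iff_map_eq_zero]
  intro w hw
  have hd := (contMDiff_sphIncl p).mdifferentiableAt (by simp)
  refine Prod.ext ?_ ?_
  · have h1 := mfderiv_comp_space (G := Prod.fst) differentiableAt_fst hd w
    have h2 := mfderiv_comp p (f := Prod.fst) (I := (𝓡 3).prod (𝓡 2)) (I' := 𝓡 3)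
      (I'' := 𝓘(ℝ, EuclideanSpace ℝ (Fin 4)))
      ((contMDiff_coe_euclideanSphere (n := 3) p.1).mdifferentiableAt (by simp))
      mdifferentiableAt_fst
    apply mfderiv_coe_euclideanSphere_injective (n := 3) p.1
    rw [mfderiv_fst] at h2
    refine (DFunLike.congr_fun h2 w).symm.trans (h1.trans ?_)
    exact ((congrArg (fderiv ℝ Prod.fst (sphIncl p)) hw).trans (fderiv ℝ Prod.fst _).map_zero).trans
      (mfderiv (𝓡 3) 𝓘(ℝ, EuclideanSpace ℝ (Fin 4)) _ p.1).map_zero.symm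
  · have h1 := mfderiv_comp_space (G := Prod.snd) differentiableAt_snd hd w
    have h2 := mfderiv_comp p (f := Prod.snd) (I := (𝓡 3).prod (𝓡 2)) (I' := 𝓡 2)
      (I'' := 𝓘(ℝ, EuclideanSpace ℝ (Fin 3)))
      ((contMDiff_coe_euclideanSphere (n := 2) p.2).mdifferentiableAt (by simp))
      mdifferentiableAt_snd
    apply mfderiv_coe_euclideanSphere_injective (n := 2) p.2
    rw [mfderiv_snd] at h2
    refine (DFunLike.congr_fun h2 w).symm.trans (h1.trans ?_)
    exact ((congrArg (fderiv ℝ Prod.snd (sphIncl p)) hw).trans (fderiv ℝ Prod.snd _).map_zero).trans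
      (mfderiv (𝓡 2) 𝓘(ℝ, EuclideanSpace ℝ (Fin 3)) _ p.2).map_zero.symm

theorem rep_eq : rep = fun c => pairOct (sphIncl (diffeo c)) := by
  funext c
  have : diffeo.symm (diffeo c) = c := diffeo.symm_apply_apply c
  nth_rewrite 1 [← this]
  exact rep_ofUnit (v := imQuat (diffeo c).2)
    (h := Quaternion.linearIsometryEquivTuple.symm (diffeo c).1) rfl
    (by rw [imQuat.norm_map, norm_eq_of_mem_sphere])
    (by rw [LinearIsometryEquiv.norm_map, norm_eq_of_mem_sphere])

theorem contMDiff_rep : ContMDiff 𝓘(ℝ, E5) 𝓘(ℝ, SplitOct) ∞ rep := by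
  rw [rep_eq]
  exact pairOct.contDiff.contMDiff.comp (contMDiff_sphIncl.comp diffeo.contMDiff)

theorem mfderiv_rep_injective (c : NullRay) :
    Function.Injective (mfderiv 𝓘(ℝ, E5) 𝓘(ℝ, SplitOct) rep c) := by
  have h1 := mfderiv_comp c (I := 𝓘(ℝ, E5)) ((contMDiff_sphIncl (diffeo c)).mdifferentiableAt
    (by simp)) (diffeo.contMDiff c |>.mdifferentiableAt (by simp))
  have h2 := mfderiv_comp_space (I := 𝓘(ℝ, E5)) pairOct.differentiableAt
    ((contMDiff_sphIncl.comp diffeo.contMDiff) c |>.mdifferentiableAt (by simp))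
  rw [rep_eq, injective_iff_map_eq_zero]
  intro w hw
  have h3 := (h2 w).symm.trans hw
  rw [ContinuousLinearMap.fderiv, h1] at h3
  have h4 := pairOct_injective (h3.trans (ContinuousLinearMap.map_zero _).symm)
  have h5 := mfderiv_sphIncl_injective (diffeo c) (h4.trans (ContinuousLinearMap.map_zero _).symm)
  exact (diffeo.mfderivToContinuousLinearEquiv (by simp) c).injective
    (h5.trans (ContinuousLinearEquiv.map_zero _).symm)

instance : CompactSpace NullRay := homeo.symm.compactSpace

/-- Compactness of C makes the injective continuous map `rep` a closed embedding. -/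
theorem isRaySubmanifold : IsRaySubmanifold where
  smooth := contMDiff_rep
  immersion := mfderiv_rep_injective
  embedding := (continuous_rep.isClosedEmbedding rep_injective).isEmbedding

/-- A map into the space of null rays is smooth if its composition with the embedding is. -/
theorem contMDiff_of_rep {E H M : Type*} [NormedAddCommGroup E] [NormedSpace ℝ E]
    [TopologicalSpace H] {I : ModelWithCorners ℝ E H} [TopologicalSpace M] [ChartedSpace H M] [IsManifold I ∞ M]
    {F : M → NullRay} (h : ContMDiff I 𝓘(ℝ, SplitOct) ∞ fun m => (F m).rep) :
    ContMDiff I 𝓘(ℝ, E5) ∞ F := by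
  have h1 : ContMDiff I ((𝓡 3).prod (𝓡 2)) ∞ fun m => diffeo (F m) := by
    refine ContMDiff.prodMk (ContMDiff.codRestrict_euclideanSphere (f := fun m =>
      Quaternion.linearIsometryEquivTuple (F m).rep.2) ?_ fun m => ?_)
      (ContMDiff.codRestrict_euclideanSphere (f := fun m => imCoord (F m).rep.1) ?_ fun m => ?_)
    · exact (Quaternion.linearIsometryEquivTuple.contDiff.comp
        (contDiff_snd : ContDiff ℝ ∞ (Prod.snd : ℍ[ℝ] × ℍ[ℝ] → ℍ[ℝ]))).contMDiff.comp h
    · rw [mem_sphere_zero_iff_norm, LinearIsometryEquiv.norm_map, norm_rep_snd]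
    · exact (imCoord.contDiff.comp
        (contDiff_fst : ContDiff ℝ ∞ (Prod.fst : ℍ[ℝ] × ℍ[ℝ] → ℍ[ℝ]))).contMDiff.comp h
    · rw [mem_sphere_zero_iff_norm, norm_imCoord (F m).rep_re, norm_rep_fst]
  have h2 := diffeo.symm.contMDiff.comp h1
  convert h2 using 1
  funext m
  exact (diffeo.symm_apply_apply (F m)).symm

end NullRay

/-! ### Normalization of null vectors -/

namespace SplitOct

/-- The positive multiple of `x` whose first component has norm one. -/
def normalize (x : SplitOct) : SplitOct := ‖x.1‖⁻¹ • x

theorem contDiff_fst' : ContDiff ℝ ∞ fun x : SplitOct => x.1 :=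
  (contDiff_fst : ContDiff ℝ ∞ (Prod.fst : ℍ[ℝ] × ℍ[ℝ] → ℍ[ℝ]))

theorem contDiff_snd' : ContDiff ℝ ∞ fun x : SplitOct => x.2 :=
  (contDiff_snd : ContDiff ℝ ∞ (Prod.snd : ℍ[ℝ] × ℍ[ℝ] → ℍ[ℝ]))

theorem contDiffAt_norm_inv {y : SplitOct} (hy : y.1 ≠ 0) :
    ContDiffAt ℝ ∞ (fun x : SplitOct => ‖x.1‖⁻¹) y :=
  (contDiff_fst'.contDiffAt.norm ℝ hy).inv (norm_ne_zero_iff.2 hy)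

theorem contDiffAt_normalize {y : SplitOct} (hy : y.1 ≠ 0) : ContDiffAt ℝ ∞ normalize y :=
  (contDiffAt_norm_inv hy).smul contDiffAt_id

theorem differentiableAt_normalize {y : SplitOct} (hy : y.1 ≠ 0) :
    DifferentiableAt ℝ normalize y :=
  (contDiffAt_normalize hy).differentiableAt (by simp)

/-- Rescaling changes a velocity only by a positive factor and by a multiple of the base vector.
Since x⁰ contains x, the condition defining D can be tested before normalization. -/
theorem fderiv_normalize {y : SplitOct} (hy : y.1 ≠ 0) (k : SplitOct) :
    ∃ l : ℝ, fderiv ℝ normalize y k = ‖y.1‖⁻¹ • k + l • y := by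
  have h := ((contDiffAt_norm_inv hy).differentiableAt (by simp)).hasFDerivAt.smul
    (hasFDerivAt_id (𝕜 := ℝ) y)
  have h' : HasFDerivAt normalize _ y := h
  rw [h'.fderiv]
  exact ⟨_, rfl⟩

theorem mul_self_of_null {x : SplitOct} (hx : x ∈ imag) (h : form x x = 0) : x * x = 0 := by
  rw [mul_self_eq, mem_imag.1 hx, h, mul_zero, zero_smul, zero_smul, sub_zero]

theorem self_mem_annihil {x : SplitOct} (hx : x ∈ imag) (h : form x x = 0) : x ∈ annihil x :=
  ⟨hx, mul_self_of_null hx h⟩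

theorem mem_annihil {x y : SplitOct} : y ∈ annihil x ↔ y ∈ imag ∧ x * y = 0 := Iff.rfl

theorem annihil_smul {c : ℝ} (hc : c ≠ 0) (x : SplitOct) : annihil (c • x) = annihil x := by
  ext y
  rw [mem_annihil, mem_annihil, SplitOct.smul_mul', smul_eq_zero_iff_right hc]

theorem toEnd_mem_annihil (g : G2) {x y : SplitOct} :
    G2.toEnd g y ∈ annihil (G2.toEnd g x) ↔ y ∈ annihil x := by
  rw [mem_annihil, mem_annihil, ← G2.map_mul', mem_imag, mem_imag, G2.re_apply]
  refine and_congr_right fun _ => ⟨fun h => ?_, fun h => by rw [h, map_zero]⟩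
  by_contra h0
  exact G2.map_ne_zero g h0 h

theorem smul_add_smul_mem_annihil {x y : SplitOct} {c l : ℝ} (hc : c ≠ 0) (hx : x ∈ annihil x) :
    c • y + l • x ∈ annihil x ↔ y ∈ annihil x := by
  rw [Submodule.add_mem_iff_left _ (Submodule.smul_mem _ _ hx), Submodule.smul_mem_iff _ hc]

end SplitOct

/-! ### Smoothness of the action and invariance of the distribution. -/

namespace NullRay

theorem rep_imag (c : NullRay) : c.rep ∈ imag := c.rep_re

theorem form_rep (c : NullRay) : form c.rep c.rep = 0 := by
  rw [form_self, norm_rep_fst, norm_rep_snd, sub_self]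

theorem rep_mem_annihil (c : NullRay) : c.rep ∈ annihil c.rep :=
  self_mem_annihil c.rep_imag c.form_rep

theorem rep_smul (g : G2) (c : NullRay) : (g • c).rep = normalize (G2.toEnd g c.rep) := by
  obtain ⟨x, hc, hx⟩ := exists_rep_eq c
  rw [← hx, hc]
  rfl

theorem toEnd_rep_fst_ne (g : G2) (c : NullRay) : (G2.toEnd g c.rep).1 ≠ 0 := by
  obtain ⟨x, -, hx⟩ := exists_rep_eq c
  rw [← hx]
  exact norm_ne_zero_iff.1 (g • x).norm_pos.ne'

theorem contMDiff_smul (g : G2) : ContMDiff 𝓘(ℝ, E5) 𝓘(ℝ, E5) ∞ (fun c : NullRay => g • c) := by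
  refine contMDiff_of_rep ?_
  simp_rw [rep_smul]
  intro c
  exact ((contDiffAt_normalize (toEnd_rep_fst_ne g c)).contMDiffAt).comp c
    (((G2.toEnd g).contDiff.contMDiff.contMDiffAt).comp c (contMDiff_rep c))

instance : ContinuousSMul G2 NullRay where
  continuous_smul := by
    rw [isRaySubmanifold.embedding.continuous_iff]
    have h1 : Continuous fun p : G2 × NullRay => G2.toEnd p.1 p.2.rep :=
      (continuous_toEnd.comp continuous_fst).clm_apply (continuous_rep.comp continuous_snd)
    have h2 : Continuous fun p : G2 × NullRay => normalize (G2.toEnd p.1 p.2.rep) := by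
      rw [continuous_iff_continuousAt]
      exact fun p => ContinuousAt.comp (f := fun p : G2 × NullRay => G2.toEnd p.1 p.2.rep)
        (contDiffAt_normalize (toEnd_rep_fst_ne p.1 p.2)).continuousAt h1.continuousAt
    exact h2.congr fun p => (rep_smul p.1 p.2).symm

theorem mdifferentiableAt_rep (c : NullRay) : MDifferentiableAt 𝓘(ℝ, E5) 𝓘(ℝ, SplitOct) rep c :=
  (contMDiff_rep c).mdifferentiableAt (by simp)

/-- The derivative of the embedding of the space of null rays. -/
def drep (c : NullRay) : E5 →L[ℝ] SplitOct := mfderiv 𝓘(ℝ, E5) 𝓘(ℝ, SplitOct) rep c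

theorem drep_injective (c : NullRay) : Function.Injective (drep c) := mfderiv_rep_injective c

theorem mem_octDist {c : NullRay} {w : TangentSpace 𝓘(ℝ, E5) c} :
    w ∈ octDist c ↔ drep c w ∈ annihil c.rep := Iff.rfl

theorem mdifferentiableAt_smul (g : G2) (c : NullRay) :
    MDifferentiableAt 𝓘(ℝ, E5) 𝓘(ℝ, E5) (fun c : NullRay => g • c) c :=
  (contMDiff_smul g c).mdifferentiableAt (by simp)

/-- The derivative of the action of an element of `G₂`. -/
def dsmul (g : G2) (c : NullRay) : E5 →L[ℝ] E5 :=
  mfderiv 𝓘(ℝ, E5) 𝓘(ℝ, E5) (fun c : NullRay => g • c) c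

theorem drep_dsmul (g : G2) (c : NullRay) (w : E5) : drep (g • c) (dsmul g c w) =
    fderiv ℝ SplitOct.normalize (G2.toEnd g c.rep) (G2.toEnd g (drep c w)) := by
  have hne := toEnd_rep_fst_ne g c
  have h1 := mfderiv_comp c (I'' := 𝓘(ℝ, SplitOct)) (mdifferentiableAt_rep (g • c))
    (mdifferentiableAt_smul g c)
  have h2 := mfderiv_comp_space (G := fun x => SplitOct.normalize (G2.toEnd g x)) (c := c)
    ((differentiableAt_normalize hne).comp _ (G2.toEnd g).differentiableAt)
    (mdifferentiableAt_rep c) w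
  have h3 : (fun m : NullRay => SplitOct.normalize (G2.toEnd g m.rep)) = rep ∘ (fun c => g • c) :=
    funext fun m => (rep_smul g m).symm
  have h4 : fderiv ℝ (fun x => SplitOct.normalize (G2.toEnd g x)) c.rep =
      (fderiv ℝ SplitOct.normalize (G2.toEnd g c.rep)).comp (G2.toEnd g) := by
    have := fderiv_comp c.rep (differentiableAt_normalize hne) (G2.toEnd g).differentiableAt
    rwa [ContinuousLinearMap.fderiv] at this
  rw [h3, h1, h4] at h2
  exact h2

/-- An automorphism carries x⁰ onto (gx)⁰, and normalization does not affect membership. -/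
theorem dsmul_mem_octDist (g : G2) (c : NullRay) (w : E5) :
    drep (g • c) (dsmul g c w) ∈ annihil (g • c).rep ↔ drep c w ∈ annihil c.rep := by
  have hne := toEnd_rep_fst_ne g c
  obtain ⟨l, hl⟩ := fderiv_normalize hne (G2.toEnd g (drep c w))
  have hp : ‖(G2.toEnd g c.rep).1‖⁻¹ ≠ 0 := inv_ne_zero (norm_ne_zero_iff.2 hne)
  rw [drep_dsmul, hl, rep_smul, ← toEnd_mem_annihil g (y := drep c w), SplitOct.normalize,
    annihil_smul hp, smul_add_smul_mem_annihil hp]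
  exact (toEnd_mem_annihil g).2 c.rep_mem_annihil

theorem dsmul_dsmul_inv (g : G2) (c : NullRay) (w : E5) :
    dsmul g (g⁻¹ • c) (dsmul g⁻¹ c w) = w := by
  have h1 := mfderiv_comp c (g := fun c : NullRay => g • c) (f := fun c : NullRay => g⁻¹ • c)
    (mdifferentiableAt_smul g _) (mdifferentiableAt_smul g⁻¹ c)
  have h2 : (fun c : NullRay => g • c) ∘ (fun c => g⁻¹ • c) = id := funext (smul_inv_smul g)
  rw [h2, mfderiv_id] at h1
  exact (DFunLike.congr_fun h1 w).symm

/-- The reverse inclusion is the direct one for g⁻¹, pushed forward by g. -/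
theorem map_mfderiv_smul_octDist (g : G2) (c : NullRay) : Submodule.map
    (mfderiv 𝓘(ℝ, E5) 𝓘(ℝ, E5) (fun c : NullRay => g • c) c : E5 →L[ℝ] E5).toLinearMap
      (octDist c) = octDist (g • c) := by
  refine le_antisymm (Submodule.map_le_iff_le_comap.2 fun w hw =>
    (dsmul_mem_octDist g c w).2 hw) fun (w : E5) hw => ?_
  have h4 := (dsmul_mem_octDist g⁻¹ (g • c) w).2 hw
  have h5 := dsmul_dsmul_inv g (g • c) w
  rw [inv_smul_smul] at h4 h5
  exact ⟨_, h4, h5⟩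

/-- The velocity of a curve of null rays, in terms of representatives. -/
theorem hasMFDerivAt_curve {γ : ℝ → NullRay} {x : ℝ → SplitOct} {x' : SplitOct}
    (h : ∀ t, (γ t).rep = normalize (x t)) (hx : HasDerivAt x x' 0) (hne : (x 0).1 ≠ 0)
    (w : TangentSpace 𝓘(ℝ, E5) (γ 0))
    (hw : HasMFDerivAt 𝓘(ℝ, ℝ) 𝓘(ℝ, E5) γ 0
      (ContinuousLinearMap.toSpanSingleton ℝ (w : E5) : ℝ →L[ℝ] E5)) :
    ∃ l : ℝ, drep (γ 0) w = ‖(x 0).1‖⁻¹ • x' + l • x 0 := by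
  have h1 := (mdifferentiableAt_rep (γ 0)).hasMFDerivAt.comp (0 : ℝ) hw
  have h2 : HasDerivAt (fun t => normalize (x t)) (fderiv ℝ normalize (x 0) x') 0 :=
    (differentiableAt_normalize hne).hasFDerivAt.comp_hasDerivAt 0 hx
  have h3 : rep ∘ γ = fun t => normalize (x t) := funext h
  rw [h3] at h1
  have h4 : HasFDerivAt (fun t => normalize (x t))
      ((drep (γ 0)).comp (ContinuousLinearMap.toSpanSingleton ℝ (w : E5) : ℝ →L[ℝ] E5)) 0 :=
    hasMFDerivAt_iff_hasFDerivAt.1 h1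
  obtain ⟨l, hl⟩ := fderiv_normalize hne x'
  refine ⟨l, ?_⟩
  rw [← hl]
  have h5 := congrArg (fun L : ℝ →L[ℝ] SplitOct => L 1) (h4.unique h2.hasFDerivAt)
  refine Eq.trans ?_ (h5.trans ?_)
  · exact congrArg (drep (γ 0)) (one_smul ℝ (w : E5)).symm
  · rw [ContinuousLinearMap.toSpanSingleton_apply, one_smul]

end NullRay

/-- The Lie algebraic data of the octonionic distribution. -/
theorem mem_distAlg_octDist {Γ : Subgroup G2} {c : NullRay} {ξ : SplitOct →L[ℝ] SplitOct} :
    ξ ∈ distAlg Γ octDist c ↔ ξ ∈ lieAlg Γ ∧ ξ c.rep ∈ annihil c.rep := by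
  refine and_congr_right fun h => ?_
  let η : g2 := ⟨ξ, mem_g2_of_mem_lieAlg h⟩
  have hx : HasDerivAt (fun t : ℝ => NormedSpace.exp (t • ξ) c.rep) (ξ c.rep) 0 :=
    hasDerivAt_exp_smul_apply_zero ξ c.rep
  have key : ∀ γ : ℝ → G2, (∀ t, G2.toEnd (γ t) = NormedSpace.exp (t • ξ)) →
      ∀ w : TangentSpace 𝓘(ℝ, E5) (γ 0 • c),
      HasMFDerivAt 𝓘(ℝ, ℝ) 𝓘(ℝ, E5) (fun t => γ t • c) 0
        (ContinuousLinearMap.toSpanSingleton ℝ (w : E5) : ℝ →L[ℝ] E5) →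
      (w ∈ octDist (γ 0 • c) ↔ ξ c.rep ∈ annihil c.rep) := by
    intro γ hγ w hw
    have h0 : γ 0 = 1 := G2.toEnd_injective <| by
      rw [hγ, zero_smul, NormedSpace.exp_zero, G2.toEnd_one]
    have hx0 : NormedSpace.exp ((0 : ℝ) • ξ) c.rep = c.rep := by
      rw [zero_smul, NormedSpace.exp_zero]; rfl
    have hne : c.rep.1 ≠ 0 := norm_ne_zero_iff.1 (by rw [NullRay.norm_rep_fst]; exact one_ne_zero)
    obtain ⟨l, hl⟩ := NullRay.hasMFDerivAt_curve (γ := fun t => γ t • c)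
      (x := fun t => NormedSpace.exp (t • ξ) c.rep) (fun t => by rw [NullRay.rep_smul, hγ]) hx
      (by rw [hx0]; exact hne) w hw
    rw [NullRay.mem_octDist, hl, hx0, h0, one_smul, NullRay.norm_rep_fst,
      smul_add_smul_mem_annihil (by simp) c.rep_mem_annihil]
  constructor
  · rintro ⟨γ, hγ, w, hw, hd⟩
    exact (key γ hγ w hd).1 hw
  · intro h1
    -- The definition of `distAlg` demands that the velocity exist in C; the orbit curve is smooth
    -- because its representative is.
    have hs : ContMDiff 𝓘(ℝ, ℝ) 𝓘(ℝ, E5) ∞ (fun t => G2.exp η t • c) := by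
      refine NullRay.contMDiff_of_rep ?_
      simp_rw [NullRay.rep_smul]
      intro t
      refine ContMDiffAt.comp t (f := fun t => G2.toEnd (G2.exp η t) c.rep)
        ((contDiffAt_normalize (NullRay.toEnd_rep_fst_ne _ c)).contMDiffAt) ?_
      have h2 : ContDiffAt ℝ ∞ (fun t : ℝ => NormedSpace.exp (t • ξ)) t :=
        (NormedSpace.exp_analytic (𝕂 := ℝ) (t • ξ)).contDiffAt.comp t
          (contDiffAt_id.smul contDiffAt_const)
      exact (h2.clm_apply contDiffAt_const).contMDiffAt
    have hd := (hs 0).mdifferentiableAt (by simp) |>.hasMFDerivAt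
    let A : ℝ →L[ℝ] E5 := mfderiv 𝓘(ℝ, ℝ) 𝓘(ℝ, E5) (fun t => G2.exp η t • c) 0
    have hA : ContinuousLinearMap.toSpanSingleton ℝ (A 1) = A := by
      ext1; simp
    have hd' : HasMFDerivAt 𝓘(ℝ, ℝ) 𝓘(ℝ, E5) (fun t => G2.exp η t • c) 0
      (ContinuousLinearMap.toSpanSingleton ℝ (A 1)) :=
      hd.congr_mfderiv hA.symm
    exact ⟨G2.exp η, fun t => rfl, A 1, (key _ (fun t => rfl) (A 1) hd').2 h1, hd'⟩

/-! ### The Lie algebraic data -/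

/-- Thus `nb 7`⁰ has basis `nb 2`, `nb 3`, `nb 7`; modulo the ray direction it is a plane. -/
theorem mem_annihil_nb_seven (y : SplitOct) : y ∈ annihil (nb 7) ↔
    crd y 0 = 0 ∧ crd y 1 = 0 ∧ crd y 4 = 0 ∧ crd y 5 = 0 ∧ crd y 6 = 0 := by
  rw [mem_annihil, mem_imag_iff_crd, ← map_eq_zero_iff _ crd.injective, crd_mul, crd_nb, funext_iff]
  simp [Fin.forall_fin_succ]
  grind

theorem mem_distAlg_base {Γ : Subgroup G2} {ξ : SplitOct →L[ℝ] SplitOct} :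
    ξ ∈ distAlg Γ octDist baseRay ↔ ξ ∈ lieAlg Γ ∧ ξ (nb 7) ∈ annihil (nb 7) := by
  rw [mem_distAlg_octDist, baseRay, NullRay.rep_mk, map_smul,
    annihil_smul (inv_ne_zero baseVec.norm_pos.ne'),
    Submodule.smul_mem_iff _ (inv_ne_zero baseVec.norm_pos.ne')]
  rfl

theorem mem_distAlg_top_base (ξ : g2) : (ξ : SplitOct →L[ℝ] SplitOct) ∈ distAlg ⊤ octDist baseRay ↔
    ξ ∈ planeW torus shortRoot longRoot := by
  rw [mem_distAlg_base, lieAlg_top, mem_planeW, mem_annihil_nb_seven, ← der_coord ξ, crd_der_seven]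
  simp [der_mem]

/-- The infinitesimal action on the split octonions of a pair of angular velocities. -/
def kInf : ((Fin 3 → ℝ) × (Fin 3 → ℝ)) →ₗ[ℝ] (SplitOct →L[ℝ] SplitOct) where
  toFun w := der 0 ![(w.1 0 - w.2 0) / 4, (w.1 1 - w.2 1) / 4, (w.1 2 - w.2 2) / 4,
    -(w.1 0 - w.2 0) / 4, -(w.1 1 - w.2 1) / 4, -(w.1 2 - w.2 2) / 4,
    -(3 * w.1 2 + w.2 2) / 4, (3 * w.1 2 + w.2 2) / 4, (3 * w.1 1 + w.2 1) / 4,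
    -(3 * w.1 1 + w.2 1) / 4, -(3 * w.1 0 + w.2 0) / 4, (3 * w.1 0 + w.2 0) / 4]
  map_add' w η := by
    rw [← der_add, add_zero]
    congr 1
    ext i
    fin_cases i <;> simp <;> ring
  map_smul' c w := by
    rw [RingHom.id_apply, ← der_smul, smul_zero]
    congr 1
    ext i
    fin_cases i <;> simp <;> ring

/-- The imaginary quaternion of a vector. -/
def vecQuat (w : Fin 3 → ℝ) : ℍ[ℝ] := imq (w 0) (w 1) (w 2)

/-- The factor ½ is that of the double covers: an angular velocity w corresponds to the quaternion
w/2. It makes the cross product correspond to the commutator. -/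
theorem kInf_apply (w : (Fin 3 → ℝ) × (Fin 3 → ℝ)) (x : SplitOct) : kInf w x =
    (2⁻¹ : ℝ) • pr (vecQuat w.1 * x.1 - x.1 * vecQuat w.1) (vecQuat w.2 * x.2 - x.2 * vecQuat w.1) := by
  apply ext_crd
  intro i
  change crd (der _ _ x) i = _
  rw [crd_der, map_smul, crd_apply, crd_apply]
  fin_cases i <;> simp [vecQuat] <;> ring

theorem vecQuat_cross (v w : Fin 3 → ℝ) :
    vecQuat (v ⨯₃ w) = (2⁻¹ : ℝ) • (vecQuat v * vecQuat w - vecQuat w * vecQuat v) := by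
  apply Quaternion.ext <;> simp [vecQuat, cross_apply] <;> ring

theorem kInf_lie (w η : (Fin 3 → ℝ) × (Fin 3 → ℝ)) :
    kInf (w.1 ⨯₃ η.1, w.2 ⨯₃ η.2) = ⁅kInf w, kInf η⁆ := by
  ext1 x
  rw [Ring.lie_def, sub_apply, mul_apply_eq_comp, mul_apply_eq_comp, kInf_apply, kInf_apply w,
    kInf_apply η, kInf_apply η, kInf_apply w, vecQuat_cross, vecQuat_cross, ← smul_sub]
  congr 1
  apply SplitOct.ext'
  · change _ = _ - _
    simp only [pr_fst, smul_fst]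
    simp only [mul_smul_comm, smul_mul_assoc, ← smul_sub]
    congr 1
    noncomm_ring
  · change _ = _ - _
    simp only [pr_fst, pr_snd, smul_fst, smul_snd]
    simp only [mul_smul_comm, smul_mul_assoc, ← smul_sub]
    congr 1
    noncomm_ring

theorem crd_invol (x : SplitOct) : crd (G2.toEnd invol x) =
    ![crd x 0, -crd x 1, crd x 5, crd x 6, crd x 7, crd x 2, crd x 3, crd x 4] := by
  rw [toEnd_invol, crd_apply, crd_apply]
  ext i
  fin_cases i <;> simp [sub_eq_add_neg]

theorem range_kInf : Set.range kInf = lieAlg maxK := by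
  ext ξ
  rw [mem_lieAlg_maxK]
  constructor
  · rintro ⟨w, rfl⟩
    refine ⟨der_mem _ _, fun x => ?_⟩
    rw [kInf_apply, kInf_apply, map_smul, toEnd_invol, toEnd_invol]
    congr 1
    apply SplitOct.ext' <;> simp [sub_eq_add_neg, add_comm]
  · rintro ⟨h1, h2⟩
    obtain ⟨h, θ, rfl⟩ := exists_der h1
    have e1 := congrArg crd (h2 (nb 1))
    have e2 := congrArg crd (h2 (nb 2))
    have e3 := congrArg crd (h2 (nb 3))
    rw [crd_invol, crd_der, crd_invol, crd_der, crd_nb] at e1 e2 e3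
    simp [funext_iff, Fin.forall_fin_succ] at e1 e2 e3
    -- These solve `θ 0` = (w' - w'')/4 and `θ 11` = (3w' + w'')/4 for the first components, and
    -- likewise for the others.
    refine ⟨(![θ 11 + θ 0, θ 8 + θ 1, θ 7 + θ 2],
      ![θ 11 - 3 * θ 0, θ 8 - 3 * θ 1, θ 7 - 3 * θ 2]), ?_⟩
    refine congrArg₂ der ?_ ?_
    · ext i; fin_cases i <;> simp <;> grind
    · ext i; fin_cases i <;> simp <;> grind

theorem kInf_injective : Function.Injective kInf := by
  rw [← LinearMap.ker_eq_bot, LinearMap.ker_eq_bot']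
  intro w hw
  have h0 : kInf w = der 0 0 := by rw [hw, der_zero]
  have h := (der_injective h0).2
  simp [funext_iff, Fin.forall_fin_succ] at h
  refine Prod.ext (funext fun i => ?_) (funext fun i => ?_) <;> fin_cases i <;> simp <;> linarith

theorem crd_kInf_base (w : (Fin 3 → ℝ) × (Fin 3 → ℝ)) : crd (kInf w (nb 7)) =
    ![0, (w.1 2 - w.2 2) / 4, (w.1 1 - w.2 1) / 4, -(w.1 0 - w.2 0) / 4, 0,
      (3 * w.1 1 + w.2 1) / 4, -(3 * w.1 0 + w.2 0) / 4, 0] := by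
  change crd (der _ _ (nb 7)) = _
  rw [crd_der_seven]
  ext i
  fin_cases i <;> simp <;> ring

theorem kInf_mem_isotropyAlg (w : (Fin 3 → ℝ) × (Fin 3 → ℝ)) :
    kInf w ∈ isotropyAlg maxK baseRay ↔ w.1 = w.2 ∧ w.1 0 = 0 ∧ w.1 1 = 0 := by
  rw [baseRay, mem_isotropyAlg_mk, ← range_kInf, and_iff_right (Set.mem_range_self w)]
  have h : (∃ c : ℝ, kInf w (nb 7) = c • nb 7) ↔ ∃ c : ℝ, crd (kInf w (nb 7)) = crd (c • nb 7) := by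
    simp only [crd.injective.eq_iff]
  refine h.trans ?_
  rw [crd_kInf_base, funext_iff (f := w.1)]
  simp only [map_smul, crd_nb]
  simp [funext_iff, Fin.forall_fin_succ]
  constructor
  · rintro ⟨h1, h2, h3, h4, h5⟩
    refine ⟨⟨?_, ?_, ?_⟩, ?_, ?_⟩ <;> linarith
  · rintro ⟨⟨h1, h2, h3⟩, h4, h5⟩
    refine ⟨?_, ?_, ?_, ?_, ?_⟩ <;> linarith

theorem kInf_mem_distAlg (w : (Fin 3 → ℝ) × (Fin 3 → ℝ)) :
    kInf w ∈ distAlg maxK octDist baseRay ↔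
      w.1 2 = w.2 2 ∧ 3 * w.1 0 + w.2 0 = 0 ∧ 3 * w.1 1 + w.2 1 = 0 := by
  rw [mem_distAlg_base, ← range_kInf, and_iff_right (Set.mem_range_self w), mem_annihil_nb_seven,
    crd_kInf_base]
  simp [sub_eq_zero]
  grind

/-! ### The rolling data at (1, e₃) and their comparison with the octonionic data. -/

theorem crossMat_eq (w : Fin 3 → ℝ) :
    crossMat w = !![0, -w 2, w 1; w 2, 0, -w 0; -w 1, w 0, 0] := by
  ext i j
  rw [crossMat, LinearMap.toMatrix'_apply]
  fin_cases i <;> fin_cases j <;> simp [cross_apply]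

theorem rollBase_rot : rollBase.rot = 1 := rfl

theorem rollBase_dir : rollBase.dir = ![0, 0, 1] := by
  ext i; fin_cases i <;> simp [rollBase, RollConf.dir]

theorem mem_rollIsotropy (w : (Fin 3 → ℝ) × (Fin 3 → ℝ)) :
    w ∈ rollIsotropy ↔ w.1 = w.2 ∧ w.1 0 = 0 ∧ w.1 1 = 0 := by
  change rollInf w rollBase = 0 ↔ _
  rw [rollInf, rollBase_rot, rollBase_dir, mul_one, one_mul, crossMat_eq, crossMat_eq, Prod.ext_iff,
    funext_iff (f := w.1)]
  simp [funext_iff, Fin.forall_fin_succ, cross_apply]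
  grind

/-- At g = 1 the angular velocity is w' - w''. No-spin equates the third components, and no-slip
says R w' + r w'' = 0 in the first two. -/
theorem mem_rollPlane {R r : ℝ} (w : (Fin 3 → ℝ) × (Fin 3 → ℝ)) :
    w ∈ rollPlane R r ↔ w.1 2 = w.2 2 ∧ (R + r) * w.1 0 = r * (w.1 0 - w.2 0) ∧
      (R + r) * w.1 1 = r * (w.1 1 - w.2 1) := by
  change (∃ η : Fin 3 → ℝ, crossMat w.1 * rollBase.rot - rollBase.rot * crossMat w.2 =
    crossMat η * rollBase.rot ∧ (R + r) • (w.1 ⨯₃ rollBase.dir) = r • (η ⨯₃ rollBase.dir) ∧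
    η ⬝ᵥ rollBase.dir = 0) ↔ _
  rw [rollBase_rot, rollBase_dir, mul_one, one_mul]
  constructor
  · rintro ⟨η, h1, h2, h3⟩
    rw [crossMat_eq, crossMat_eq, crossMat_eq, mul_one] at h1
    simp at h1
    simp [funext_iff, Fin.forall_fin_succ, cross_apply] at h2
    simp [dotProduct, Fin.sum_univ_three] at h3
    grind
  · rintro ⟨h1, h2, h3⟩
    refine ⟨w.1 - w.2, ?_, ?_, ?_⟩
    · rw [crossMat, crossMat, crossMat, map_sub, map_sub, mul_one]
    · simp [funext_iff, Fin.forall_fin_succ, cross_apply, h2, h3]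
      ring
    · simp [dotProduct, Fin.sum_univ_three, h1]

/-- The infinitesimal action of a pair of angular velocities, with the roles of the two factors
interchanged. -/
def kInfSwap : ((Fin 3 → ℝ) × (Fin 3 → ℝ)) →ₗ[ℝ] (SplitOct →L[ℝ] SplitOct) :=
  kInf ∘ₗ (LinearEquiv.prodComm ℝ (Fin 3 → ℝ) (Fin 3 → ℝ)).toLinearMap

theorem kInfSwap_apply (w : (Fin 3 → ℝ) × (Fin 3 → ℝ)) : kInfSwap w = kInf w.swap := rfl

theorem range_kInfSwap : Set.range kInfSwap = lieAlg maxK := by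
  rw [← range_kInf]
  exact (LinearEquiv.prodComm ℝ (Fin 3 → ℝ) (Fin 3 → ℝ)).surjective.range_comp kInf

/-- In the first two components the octonionic plane is 3w' + w'' = 0 and the rolling plane is R w'
+ r w'' = 0. They agree for R : r = 3 : 1, and after interchanging the two copies of so₃ for 1 : 3;
the isotropy algebra is symmetric under the interchange. -/
theorem hasRollingData {R r : ℝ} (hR : 0 < R) (hr : 0 < r) (h : R = 3 * r ∨ r = 3 * R) :
    HasRollingData octDist baseRay R r := by
  rcases h with rfl | rfl
  · refine ⟨kInf, kInf_injective, kInf_lie, range_kInf, fun w => ?_, fun w => ?_⟩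
    · rw [kInf_mem_isotropyAlg, mem_rollIsotropy]
    · rw [kInf_mem_distAlg, mem_rollPlane]
      have h1 : ∀ a b : ℝ, (3 * r + r) * a = r * (a - b) ↔ 3 * a + b = 0 := fun a b => by
        have : (3 * r + r) * a = r * (a - b) ↔ r * (3 * a + b) = 0 := by
          rw [← sub_eq_zero]; ring_nf
        rw [this, mul_eq_zero, or_iff_right hr.ne']
      rw [h1, h1]
  · refine ⟨kInfSwap, kInf_injective.comp (LinearEquiv.injective _), fun w η => ?_, range_kInfSwap,
      fun w => ?_, fun w => ?_⟩
    · rw [kInfSwap_apply, kInfSwap_apply, kInfSwap_apply, ← kInf_lie]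
      rfl
    · rw [kInfSwap_apply, kInf_mem_isotropyAlg, mem_rollIsotropy]
      simp only [Prod.fst_swap, Prod.snd_swap]
      constructor <;> rintro ⟨h1, h2, h3⟩ <;> simp_all
    · rw [kInfSwap_apply, kInf_mem_distAlg, mem_rollPlane]
      have h1 : ∀ a b : ℝ, (R + 3 * R) * a = 3 * R * (a - b) ↔ 3 * b + a = 0 := fun a b => by
        have : (R + 3 * R) * a = 3 * R * (a - b) ↔ R * (3 * b + a) = 0 := by
          rw [← sub_eq_zero]; ring_nf
        rw [this, mul_eq_zero, or_iff_right hR.ne']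
      rw [h1, h1, eq_comm]
      rfl

/-! ### Tangent vectors and vector fields on the space of null rays -/

theorem one_le_norm_add_smul {V : Type*} [NormedAddCommGroup V] [InnerProductSpace ℝ V] {a b : V}
    (ha : ‖a‖ = 1) (hab : inner ℝ a b = 0) (t : ℝ) : 1 ≤ ‖a + t • b‖ := by
  have h : ‖a + t • b‖ ^ 2 = 1 + t ^ 2 * ‖b‖ ^ 2 := by
    rw [norm_add_sq_real, inner_smul_right, hab, ha, norm_smul, mul_pow, Real.norm_eq_abs, sq_abs]
    ring
  have h1 : (1 : ℝ) ^ 2 ≤ ‖a + t • b‖ ^ 2 := by rw [h]; nlinarith [sq_nonneg (t * ‖b‖)]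
  exact (sq_le_sq₀ zero_le_one (norm_nonneg _)).1 h1

/-- A line tangent to the unit sphere, projected to the sphere, keeps its velocity. -/
theorem hasDerivAt_normalize_line {V : Type*} [NormedAddCommGroup V] [InnerProductSpace ℝ V]
    {a b : V} (ha : ‖a‖ = 1) (hab : inner ℝ a b = 0) :
    HasDerivAt (fun t : ℝ => ‖a + t • b‖⁻¹ • (a + t • b)) b 0 := by
  have hl : HasDerivAt (fun t : ℝ => a + t • b) b 0 := by
    simpa using ((hasDerivAt_id (0 : ℝ)).smul_const b).const_add a
  have hp : ∀ t : ℝ, 0 < ‖a + t • b‖ := fun t =>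
    zero_lt_one.trans_le (one_le_norm_add_smul ha hab t)
  have hn : DifferentiableAt ℝ (fun t : ℝ => ‖a + t • b‖⁻¹) 0 :=
    (hl.differentiableAt.norm ℝ (norm_pos_iff.1 (hp 0))).inv (hp 0).ne'
  -- As b is orthogonal to a, the norm is smallest at t = 0, so the scaling factor is stationary
  -- there.
  have hm : IsLocalMax (fun t : ℝ => ‖a + t • b‖⁻¹) 0 := Filter.Eventually.of_forall fun t => by
    simp only [zero_smul, add_zero, ha, inv_one]
    exact inv_le_one_of_one_le₀ (one_le_norm_add_smul ha hab t)
  have h0 := hm.hasDerivAt_eq_zero hn.hasDerivAt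
  have := hn.hasDerivAt.smul hl
  rw [h0] at this
  exact this.congr_deriv (by simp [ha])

namespace NullRay

theorem rep_fst_mul_self (c : NullRay) : c.rep.1 * c.rep.1 = -1 :=
  Quaternion.mul_self_of_unit_imag c.rep_re c.norm_rep_fst

theorem star_rep_snd_mul (c : NullRay) : star c.rep.2 * c.rep.2 = 1 := by
  rw [Quaternion.star_mul_self, Quaternion.normSq_eq_norm_mul_self, norm_rep_snd]
  simp

/-- The derivative of a smooth function of the representative. -/
theorem mfderiv_comp_rep {W : Type*} [NormedAddCommGroup W] [NormedSpace ℝ W] {G : SplitOct → W}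
    {c : NullRay} (hG : DifferentiableAt ℝ G c.rep) (w : E5) :
    (mfderiv 𝓘(ℝ, E5) 𝓘(ℝ, W) (fun c : NullRay => G c.rep) c : E5 →L[ℝ] W) w =
      fderiv ℝ G c.rep (drep c w) :=
  mfderiv_comp_space hG (mdifferentiableAt_rep c) w

theorem fderiv_drep_of_const {W : Type*} [NormedAddCommGroup W] [NormedSpace ℝ W] {G : SplitOct → W}
    {c : NullRay} (hG : DifferentiableAt ℝ G c.rep) {y : W} (hc : ∀ c : NullRay, G c.rep = y)
    (w : E5) : fderiv ℝ G c.rep (drep c w) = 0 := by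
  rw [← mfderiv_comp_rep hG]
  have : (fun c : NullRay => G c.rep) = fun _ => y := funext hc
  rw [this, mfderiv_const]
  rfl

theorem drep_fst_re (c : NullRay) (w : E5) : (drep c w).1.re = 0 := by
  let l : SplitOct →L[ℝ] ℝ := LinearMap.toContinuousLinearMap
    { toFun := fun x => x.1.re
      map_add' := fun _ _ => rfl
      map_smul' := fun _ _ => rfl }
  have := fderiv_drep_of_const (c := c) l.differentiableAt rep_re w
  rwa [l.fderiv] at this

/-- The first component, as a continuous linear map. -/
def fstL : SplitOct →L[ℝ] ℍ[ℝ] := ContinuousLinearMap.fst ℝ ℍ[ℝ] ℍ[ℝ]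

/-- This is the derivative of v² = -1, i.e. orthogonality of a tangent vector to v, in the form in
which quaternion computations use it. -/
theorem drep_fst_mul (c : NullRay) (w : E5) :
    (drep c w).1 * c.rep.1 = -(c.rep.1 * (drep c w).1) := by
  have h : HasFDerivAt (fun x : SplitOct => x.1 * x.1) _ c.rep :=
    fstL.hasFDerivAt.mul' fstL.hasFDerivAt
  have := fderiv_drep_of_const h.differentiableAt rep_fst_mul_self w
  rw [h.fderiv] at this
  have h2 : c.rep.1 * (drep c w).1 + (drep c w).1 * c.rep.1 = 0 := this
  rw [eq_neg_iff_add_eq_zero, add_comm, h2]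

/-- The vector of the octonionic plane at `c` with given first component. -/
def planeVec (c : NullRay) (b : ℍ[ℝ]) : SplitOct := pr b (c.rep.2 * c.rep.1 * b)

/-- With (v,h) the representative, the second entry of the equation (v,h)(b,y) = 0 is yv = hb, so y
= -hbv = hvb as v² = -1 and bv = -vb. The first entry is then automatic. -/
theorem mem_annihil_rep {c : NullRay} {y : SplitOct} (h0 : y.1.re = 0)
    (h : y.1 * c.rep.1 = -(c.rep.1 * y.1)) : y ∈ annihil c.rep ↔ y = planeVec c y.1 := by
  have hv := c.rep_fst_mul_self
  have hs := Quaternion.star_eq_neg_of_re h0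
  have hvs := Quaternion.star_eq_neg_of_re c.rep_re
  rw [mem_annihil, mem_imag]
  constructor
  · rintro ⟨-, h1⟩
    have h2 : y.2 * c.rep.1 + c.rep.2 * star y.1 = 0 := congrArg (fun x : SplitOct => x.2) h1
    refine SplitOct.ext' rfl ?_
    have h3 : y.2 * c.rep.1 = c.rep.2 * y.1 := by
      rw [hs, mul_neg, add_neg_eq_zero] at h2; exact h2
    have h4 := congrArg (· * c.rep.1) h3
    simp only [mul_assoc, hv, h] at h4
    rw [mul_neg, mul_neg, mul_one, neg_inj] at h4
    rw [h4]
    exact (mul_assoc _ _ _).symm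
  · intro e
    refine ⟨h0, ?_⟩
    have e2 : y.2 = c.rep.2 * c.rep.1 * y.1 := congrArg (fun x : SplitOct => x.2) e
    apply SplitOct.ext'
    · rw [mul_fst, e2, star_mul, star_mul, hs, hvs, mul_assoc, mul_assoc, c.star_rep_snd_mul, mul_one,
        neg_mul_neg, h, add_neg_cancel]
      rfl
    · rw [mul_snd, e2, hs, mul_assoc, h, mul_neg, mul_assoc c.rep.2, ← mul_assoc c.rep.1, hv]
      simp

theorem mem_octDist_iff {c : NullRay} {w : TangentSpace 𝓘(ℝ, E5) c} :
    w ∈ octDist c ↔ drep c w = planeVec c (drep c w).1 :=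
  mem_octDist.trans (mem_annihil_rep (drep_fst_re c w) (drep_fst_mul c w))

end NullRay

theorem inner_eq_zero_of_anticomm {v b : ℍ[ℝ]} (hb : b.re = 0) (h : b * v = -(v * b)) :
    inner ℝ v b = 0 := by
  rw [Quaternion.inner_def, Quaternion.star_eq_neg_of_re hb]
  have h1 := congrArg QuaternionAlgebra.re h
  simp at h1 ⊢
  linarith

theorem re_mul_eq_zero_of_anticomm {v b : ℍ[ℝ]} (h : b * v = -(v * b)) : (v * b).re = 0 := by
  have h1 := congrArg QuaternionAlgebra.re h
  simp at h1 ⊢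
  linarith

/-! ### Vector fields spanning the octonionic planes. -/

namespace NullRay

theorem inner_rep_snd {c : NullRay} {b : ℍ[ℝ]} (h : b * c.rep.1 = -(c.rep.1 * b)) :
    inner ℝ c.rep.2 (c.rep.2 * c.rep.1 * b) = 0 := by
  have h1 : inner ℝ c.rep.2 (c.rep.2 * c.rep.1 * b) =
      Quaternion.normSq c.rep.2 * (c.rep.1 * b).re := by
    rw [Quaternion.inner_def, Quaternion.normSq_def']
    simp
    ring
  rw [h1, re_mul_eq_zero_of_anticomm h, mul_zero]

/-- Smooth quaternionic functions that parametrize vector fields in the octonionic distribution. -/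
structure IsField (F : SplitOct → ℍ[ℝ]) : Prop where
  contDiff : ContDiff ℝ ∞ F
  re : ∀ c : NullRay, (F c.rep).re = 0
  anticomm : ∀ c : NullRay, F c.rep * c.rep.1 = -(c.rep.1 * F c.rep)

variable {F : SplitOct → ℍ[ℝ]}

/-- Straight motion in the direction of a field, projected back to the space of null rays. -/
def IsField.flow (hF : IsField F) (p : ℝ × NullRay) : NullRay :=
  ofUnit (‖p.2.rep.1 + p.1 • F p.2.rep‖⁻¹ • (p.2.rep.1 + p.1 • F p.2.rep))
    (‖p.2.rep.2 + p.1 • (planeVec p.2 (F p.2.rep)).2‖⁻¹ •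
      (p.2.rep.2 + p.1 • (planeVec p.2 (F p.2.rep)).2))
    (by simp [rep_re, hF.re])
    (norm_smul_inv_norm (norm_pos_iff.1 (zero_lt_one.trans_le (one_le_norm_add_smul
      (norm_rep_fst _) (inner_eq_zero_of_anticomm (hF.re _) (hF.anticomm _)) _))))
    (norm_smul_inv_norm (norm_pos_iff.1 (zero_lt_one.trans_le (one_le_norm_add_smul
      (norm_rep_snd _) (inner_rep_snd (hF.anticomm _)) _))))

theorem IsField.rep_flow (hF : IsField F) (p : ℝ × NullRay) : (hF.flow p).rep =
    pr (‖p.2.rep.1 + p.1 • F p.2.rep‖⁻¹ • (p.2.rep.1 + p.1 • F p.2.rep))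
      (‖p.2.rep.2 + p.1 • (planeVec p.2 (F p.2.rep)).2‖⁻¹ •
        (p.2.rep.2 + p.1 • (planeVec p.2 (F p.2.rep)).2)) :=
  rep_ofUnit _ _ _

theorem IsField.flow_zero (hF : IsField F) (c : NullRay) : hF.flow (0, c) = c := by
  apply rep_injective
  rw [hF.rep_flow]
  apply SplitOct.ext' <;> simp [norm_rep_fst, norm_rep_snd]

theorem IsField.contMDiff_flow (hF : IsField F) :
    ContMDiff (𝓘(ℝ, ℝ).prod 𝓘(ℝ, E5)) 𝓘(ℝ, E5) ∞ hF.flow := by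
  refine contMDiff_of_rep ?_
  simp_rw [hF.rep_flow]
  intro p
  have hr : ContMDiff (𝓘(ℝ, ℝ).prod 𝓘(ℝ, E5)) 𝓘(ℝ, ℝ × SplitOct) ∞
      (fun p : ℝ × NullRay => (p.1, p.2.rep)) :=
    contMDiff_fst.prodMk_space (contMDiff_rep.comp contMDiff_snd)
  have h1 : ContDiff ℝ ∞ fun q : ℝ × SplitOct => q.2.1 + q.1 • F q.2 :=
    (contDiff_fst'.comp contDiff_snd).add (contDiff_fst.smul (hF.contDiff.comp contDiff_snd))
  have h2 : ContDiff ℝ ∞ fun q : ℝ × SplitOct => q.2.2 + q.1 • (q.2.2 * q.2.1 * F q.2) :=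
    (contDiff_snd'.comp contDiff_snd).add (contDiff_fst.smul
      (((contDiff_snd'.comp contDiff_snd).mul (contDiff_fst'.comp contDiff_snd)).mul
        (hF.contDiff.comp contDiff_snd)))
  have n1 : p.2.rep.1 + p.1 • F p.2.rep ≠ 0 := norm_pos_iff.1 (zero_lt_one.trans_le
    (one_le_norm_add_smul (norm_rep_fst _) (inner_eq_zero_of_anticomm (hF.re _) (hF.anticomm _)) _))
  have n2 : p.2.rep.2 + p.1 • (p.2.rep.2 * p.2.rep.1 * F p.2.rep) ≠ 0 :=
    norm_pos_iff.1 (zero_lt_one.trans_le (one_le_norm_add_smul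
      (norm_rep_snd _) (inner_rep_snd (hF.anticomm _)) _))
  have h3 : ContDiffAt ℝ ∞ (fun q : ℝ × SplitOct =>
      (pr (‖q.2.1 + q.1 • F q.2‖⁻¹ • (q.2.1 + q.1 • F q.2))
        (‖q.2.2 + q.1 • (q.2.2 * q.2.1 * F q.2)‖⁻¹ •
          (q.2.2 + q.1 • (q.2.2 * q.2.1 * F q.2))) : SplitOct)) (p.1, p.2.rep) :=
    (((h1.contDiffAt.norm ℝ n1).inv (norm_ne_zero_iff.2 n1)).smul h1.contDiffAt).prodMk
      (((h2.contDiffAt.norm ℝ n2).inv (norm_ne_zero_iff.2 n2)).smul h2.contDiffAt)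
  exact h3.contMDiffAt.comp p (hr p)

/-- The vector field determined by a quaternionic function. -/
def IsField.vec (hF : IsField F) (c : NullRay) : E5 :=
  (mfderiv (𝓘(ℝ, ℝ).prod 𝓘(ℝ, E5)) 𝓘(ℝ, E5) hF.flow (0, c) : ℝ × E5 →L[ℝ] E5) (1, 0)

/-- The field is the time derivative at t = 0 of a smooth map on ℝ × C, that is, its tangent map
along the smooth section (∂ₜ, 0). This avoids any computation in charts. -/
theorem IsField.contMDiff_vec (hF : IsField F) : ContMDiff 𝓘(ℝ, E5) 𝓘(ℝ, E5).tangent ∞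
    (fun c => (⟨c, hF.vec c⟩ : TangentBundle 𝓘(ℝ, E5) NullRay)) := by
  have h1 := hF.contMDiff_flow.contMDiff_tangentMap (m := ∞) (by simp)
  have h2 : ContMDiff 𝓘(ℝ, E5) (𝓘(ℝ, ℝ).prod 𝓘(ℝ, E5)).tangent ∞ (fun c : NullRay =>
      (equivTangentBundleProd 𝓘(ℝ, ℝ) ℝ 𝓘(ℝ, E5) NullRay).symm
        ((⟨0, (1 : ℝ)⟩ : TangentBundle 𝓘(ℝ, ℝ) ℝ), (⟨c, (0 : E5)⟩ : TangentBundle 𝓘(ℝ, E5) NullRay))) :=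
    contMDiff_equivTangentBundleProd_symm.comp
      (contMDiff_const.prodMk (Bundle.contMDiff_zeroSection ℝ (TangentSpace 𝓘(ℝ, E5))))
  refine (h1.comp h2).congr fun c => ?_
  have : (⟨hF.flow (0, c), hF.vec c⟩ : TangentBundle 𝓘(ℝ, E5) NullRay) = ⟨c, hF.vec c⟩ :=
    congrArg (fun p => (⟨p, (hF.vec c : E5)⟩ : TangentBundle 𝓘(ℝ, E5) NullRay)) (hF.flow_zero c)
  exact this.symm

theorem IsField.drep_vec (hF : IsField F) (c : NullRay) :
    drep c (hF.vec c) = planeVec c (F c.rep) := by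
  have h1 : HasMFDerivAt 𝓘(ℝ, ℝ) (𝓘(ℝ, ℝ).prod 𝓘(ℝ, E5)) (fun t : ℝ => (t, c)) 0
      ((ContinuousLinearMap.id ℝ ℝ).prod (0 : ℝ →L[ℝ] E5)) :=
    (hasMFDerivAt_id (0 : ℝ)).prodMk (hasMFDerivAt_const c (0 : ℝ))
  have h2 := (hF.contMDiff_flow (0, c)).mdifferentiableAt (by simp) |>.hasMFDerivAt
  have h3 := (mdifferentiableAt_rep (hF.flow (0, c))).hasMFDerivAt.comp (0 : ℝ) (h2.comp (0 : ℝ) h1)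
  have h4 : HasFDerivAt (fun t => (hF.flow (t, c)).rep) ((drep (hF.flow (0, c))).comp
      ((mfderiv (𝓘(ℝ, ℝ).prod 𝓘(ℝ, E5)) 𝓘(ℝ, E5) hF.flow (0, c) : ℝ × E5 →L[ℝ] E5).comp
        ((ContinuousLinearMap.id ℝ ℝ).prod (0 : ℝ →L[ℝ] E5)))) 0 :=
    hasMFDerivAt_iff_hasFDerivAt.1 h3
  have h5 : HasDerivAt (fun t => (hF.flow (t, c)).rep) (planeVec c (F c.rep)) 0 := by
    simp_rw [hF.rep_flow]
    exact (hasDerivAt_normalize_line (norm_rep_fst _)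
      (inner_eq_zero_of_anticomm (hF.re _) (hF.anticomm _))).prodMk
        (hasDerivAt_normalize_line (norm_rep_snd _) (inner_rep_snd (hF.anticomm _)))
  have h6 := congrArg (fun L : ℝ →L[ℝ] SplitOct => L 1) (h4.unique h5.hasFDerivAt)
  rw [hF.flow_zero] at h6
  refine Eq.trans ?_ (h6.trans ?_)
  · rfl
  · rw [ContinuousLinearMap.toSpanSingleton_apply, one_smul]

theorem IsField.vec_mem (hF : IsField F) (c : NullRay) :
    (hF.vec c : TangentSpace 𝓘(ℝ, E5) c) ∈ octDist c := by
  refine mem_octDist_iff.2 ?_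
  rw [hF.drep_vec]
  rfl

/-- The commutator with a fixed imaginary quaternion. -/
def commField (a : ℍ[ℝ]) (x : SplitOct) : ℍ[ℝ] := x.1 * a - a * x.1

theorem isField_commField (a : ℍ[ℝ]) : IsField (commField a) where
  contDiff := (contDiff_fst'.mul contDiff_const).sub (contDiff_const.mul contDiff_fst')
  re c := by simp [commField]; ring
  anticomm c := by
    have hv := c.rep_fst_mul_self
    rw [commField, sub_mul, mul_sub, ← mul_assoc c.rep.1, hv, mul_assoc a, hv, mul_assoc]
    simp

/-- Left multiplication by v is a quarter turn in the plane of imaginary quaternions orthogonal to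
v, so it produces the second field of a frame. -/
theorem IsField.mul (hF : IsField F) : IsField fun x => x.1 * F x where
  contDiff := contDiff_fst'.mul hF.contDiff
  re c := re_mul_eq_zero_of_anticomm (hF.anticomm c)
  anticomm c := by rw [mul_assoc, hF.anticomm, mul_neg]

/-- Every vector orthogonal to a unit vector `v` is a combination of `b` and `v b`, for any nonzero
`b` orthogonal to `v`. -/
theorem exists_eq_smul_add_smul {v b d : ℍ[ℝ]} (hv : v * v = -1) (hvr : v.re = 0) (hb0 : b ≠ 0)
    (hb : b * v = -(v * b)) (hd : d * v = -(v * d)) : ∃ x y : ℝ, d = x • b + y • (v * b) := by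
  -- Both b and d anticommute with v, so z = d b⁻¹ commutes with v and lies in ℝ + ℝv.
  obtain ⟨z, hz⟩ : ∃ z, z * b = d := ⟨d * b⁻¹, by rw [mul_assoc, inv_mul_cancel₀ hb0, mul_one]⟩
  have hc : z * v = v * z := by
    have h1 : z * v * b = v * z * b := by
      rw [← neg_inj, mul_assoc v, hz, ← hd, ← hz, mul_assoc z b v, hb]
      simp [mul_assoc]
    exact mul_right_cancel₀ hb0 h1
  have h2 : v * z + v * z = (2 * z.re) • v + (2 * (v * z).re) • (1 : ℍ[ℝ]) := by
    nth_rewrite 2 [← hc]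
    apply Quaternion.ext <;> simp [hvr] <;> ring
  have h3 : v * z = z.re • v + (v * z).re • (1 : ℍ[ℝ]) := by
    have h4 : (2 : ℝ) • (v * z) = (2 : ℝ) • (z.re • v + (v * z).re • (1 : ℍ[ℝ])) := by
      rw [two_smul, h2, smul_add, smul_smul, smul_smul]
    exact smul_right_injective _ (two_ne_zero' ℝ) h4
  have h5 : z = z.re • (1 : ℍ[ℝ]) - (v * z).re • v := by
    have h6 := congrArg (v * ·) h3
    simp only [← mul_assoc, hv, mul_add, mul_smul_comm, mul_one] at h6
    rw [neg_one_mul, neg_eq_iff_eq_neg, smul_neg, neg_add, neg_neg] at h6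
    exact h6.trans (sub_eq_add_neg _ _).symm
  refine ⟨z.re, -(v * z).re, ?_⟩
  rw [← hz]
  nth_rewrite 1 [h5]
  rw [sub_mul, smul_mul_assoc, smul_mul_assoc, one_mul, neg_smul, sub_eq_add_neg]

theorem eq_zero_of_smul_add_smul {v b : ℍ[ℝ]} (hv : v ≠ 0) (hvr : v.re = 0) (hb0 : b ≠ 0) {x y : ℝ}
    (h : x • b + y • (v * b) = 0) : x = 0 ∧ y = 0 := by
  have h1 : (x • (1 : ℍ[ℝ]) + y • v) * b = 0 := by
    rw [add_mul, smul_mul_assoc, smul_mul_assoc, one_mul, h]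
  have h2 := (mul_eq_zero.1 h1).resolve_right hb0
  have h3 : x = 0 := by simpa [hvr] using congrArg QuaternionAlgebra.re h2
  rw [h3, zero_smul, zero_add] at h2
  exact ⟨h3, (smul_eq_zero.1 h2).resolve_right hv⟩

theorem rep_fst_ne_zero (c : NullRay) : c.rep.1 ≠ 0 :=
  norm_ne_zero_iff.1 (by rw [norm_rep_fst]; exact one_ne_zero)

theorem exists_commField_ne_zero (c : NullRay) : ∃ a : ℍ[ℝ], commField a c.rep ≠ 0 := by
  obtain ⟨u, hu, -, h⟩ := exists_anticomm c.rep_re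
  refine ⟨u, fun h0 => ?_⟩
  rw [commField, h, neg_mul, sub_neg_eq_add, ← two_smul ℝ, smul_eq_zero_iff_right two_ne_zero,
    mul_eq_zero] at h0
  rcases h0 with h0 | h0
  · exact c.rep_fst_ne_zero h0
  · exact hu h0

theorem planeVec_add (c : NullRay) (b d : ℍ[ℝ]) : planeVec c (b + d) = planeVec c b + planeVec c d :=
  SplitOct.ext' rfl (mul_add _ _ _)

theorem planeVec_smul (c : NullRay) (t : ℝ) (b : ℍ[ℝ]) : planeVec c (t • b) = t • planeVec c b :=
  SplitOct.ext' rfl (mul_smul_comm _ _ _)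

/-- On the open set where F = va - av is nonzero, F and vF form a basis of the plane orthogonal to
v. A suitable a exists at each point because v is not central. -/
theorem isDistribution_octDist :
    IsDistribution 2 (octDist : ∀ c : NullRay, Submodule ℝ (TangentSpace 𝓘(ℝ, E5) c)) := by
  intro c₀
  obtain ⟨a, ha⟩ := exists_commField_ne_zero c₀
  have hF := isField_commField a
  refine ⟨{c | commField a c.rep ≠ 0},
    isOpen_ne.preimage (hF.contDiff.continuous.comp continuous_rep), ha,
    ![hF.vec, hF.mul.vec], ?_, fun c hc => ?_⟩
  · rw [Fin.forall_fin_two]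
    exact ⟨hF.contMDiff_vec.contMDiffOn, hF.mul.contMDiff_vec.contMDiffOn⟩
  · have hd : ∀ x y : ℝ, drep c (x • hF.vec c + y • hF.mul.vec c) = planeVec c
        (x • commField a c.rep + y • (c.rep.1 * commField a c.rep)) := fun x y => by
      rw [map_add, map_smul, map_smul, hF.drep_vec, hF.mul.drep_vec, planeVec_add, planeVec_smul,
        planeVec_smul]
    have he : (fun i => (![hF.vec, hF.mul.vec] : Fin 2 → ∀ p : NullRay, TangentSpace 𝓘(ℝ, E5) p) i c) =
        ![(hF.vec c : TangentSpace 𝓘(ℝ, E5) c), hF.mul.vec c] := by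
      ext1 i; fin_cases i <;> rfl
    rw [he]
    constructor
    · refine LinearIndependent.pair_iff.2 fun x y h => ?_
      have h1 := (hd x y).symm.trans ((congrArg (drep c) h).trans (map_zero _))
      exact eq_zero_of_smul_add_smul c.rep_fst_ne_zero c.rep_re hc
        (congrArg (fun x : SplitOct => x.1) h1)
    · refine le_antisymm (Submodule.span_le.2 ?_) fun w hw => ?_
      · rintro _ ⟨i, rfl⟩
        fin_cases i
        · exact hF.vec_mem c
        · exact hF.mul.vec_mem c
      · obtain ⟨x, y, h⟩ := exists_eq_smul_add_smul c.rep_fst_mul_self c.rep_re hc (hF.anticomm c)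
          (drep_fst_mul c w)
        have h1 := mem_octDist_iff.1 hw
        rw [h, ← hd] at h1
        rw [drep_injective c h1]
        exact Submodule.add_mem _ (Submodule.smul_mem _ _ (Submodule.subset_span ⟨0, rfl⟩))
          (Submodule.smul_mem _ _ (Submodule.subset_span ⟨1, rfl⟩))

/-- Every vector in the plane at `c` is the velocity of a vector tangent to the distribution. -/
theorem exists_mem_octDist {c : NullRay} {b : ℍ[ℝ]} (h : b * c.rep.1 = -(c.rep.1 * b)) :
    ∃ w : TangentSpace 𝓘(ℝ, E5) c, w ∈ octDist c ∧ drep c w = planeVec c b := by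
  obtain ⟨a, ha⟩ := exists_commField_ne_zero c
  have hF := isField_commField a
  obtain ⟨x, y, e⟩ := exists_eq_smul_add_smul c.rep_fst_mul_self c.rep_re ha (hF.anticomm c) h
  refine ⟨(x • hF.vec c + y • hF.mul.vec c : E5), ?_, ?_⟩
  · exact Submodule.add_mem _ (Submodule.smul_mem _ _ (hF.vec_mem c))
      (Submodule.smul_mem _ _ (hF.mul.vec_mem c))
  · rw [map_add, map_smul, map_smul, hF.drep_vec, hF.mul.drep_vec, e, planeVec_add, planeVec_smul,
        planeVec_smul]

end NullRay

/-! ### Rotations and quaternions -/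

/-- The coordinates of the imaginary part of a quaternion, as a linear map to column vectors. -/
def imVec : ℍ[ℝ] →L[ℝ] (Fin 3 → ℝ) := LinearMap.toContinuousLinearMap
  { toFun := fun q => ![q.imI, q.imJ, q.imK]
    map_add' := fun x y => by ext i; fin_cases i <;> simp
    map_smul' := fun c x => by ext i; fin_cases i <;> simp }

theorem imVec_apply (q : ℍ[ℝ]) : imVec q = ![q.imI, q.imJ, q.imK] := rfl

theorem vecQuat_imVec {q : ℍ[ℝ]} (hq : q.re = 0) : vecQuat (imVec q) = q := (eq_imq hq).symm

theorem imVec_vecQuat (w : Fin 3 → ℝ) : imVec (vecQuat w) = w := by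
  ext i; fin_cases i <;> rfl

theorem vecQuat_injective : Function.Injective vecQuat := fun v w h => by
  rw [← imVec_vecQuat v, h, imVec_vecQuat]

/-- The matrix of `v ↦ p v q̄` on imaginary parts. -/
def sandwich (p q : ℍ[ℝ]) : Matrix (Fin 3) (Fin 3) ℝ :=
  Matrix.of fun i j => imVec (p * vecQuat (Pi.single j 1) * star q) i

theorem sandwich_apply (p q : ℍ[ℝ]) (i j : Fin 3) :
    sandwich p q i j = imVec (p * vecQuat (Pi.single j 1) * star q) i := rfl

theorem vecQuat_eq_sum (w : Fin 3 → ℝ) : vecQuat w = ∑ j, w j • vecQuat (Pi.single j 1) := by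
  rw [Fin.sum_univ_three]
  apply Quaternion.ext <;> simp [vecQuat]

theorem sandwich_mulVec (p q : ℍ[ℝ]) (w : Fin 3 → ℝ) :
    sandwich p q *ᵥ w = imVec (p * vecQuat w * star q) := by
  ext i
  rw [vecQuat_eq_sum, Finset.mul_sum, Finset.sum_mul, map_sum, Finset.sum_apply, Matrix.mulVec,
    dotProduct]
  refine Finset.sum_congr rfl fun j _ => ?_
  rw [mul_smul_comm, smul_mul_assoc, map_smul, Pi.smul_apply, sandwich_apply, smul_eq_mul, mul_comm]

theorem quatRot_eq_sandwich (q : UnitQuat) : quatRot q = sandwich q q := by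
  ext i j
  have h : ∀ j : Fin 3, (![⟨0, 1, 0, 0⟩, ⟨0, 0, 1, 0⟩, ⟨0, 0, 0, 1⟩] : Fin 3 → ℍ[ℝ]) j =
      vecQuat (Pi.single j 1) := fun j => by fin_cases j <;> apply Quaternion.ext <;> simp [vecQuat]
  rw [sandwich_apply, ← h j]
  rfl

theorem re_conj {q y : ℍ[ℝ]} (hy : y.re = 0) : (q * y * star q).re = 0 := by
  simp [hy]; ring

theorem vecQuat_sandwich_self (q : ℍ[ℝ]) (w : Fin 3 → ℝ) :
    vecQuat (sandwich q q *ᵥ w) = q * vecQuat w * star q := by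
  rw [sandwich_mulVec, vecQuat_imVec (re_conj rfl)]

theorem sandwich_mul (p q : ℍ[ℝ]) : sandwich (p * q) (p * q) = sandwich p p * sandwich q q := by
  apply Matrix.ext_of_mulVec_single
  intro j
  apply vecQuat_injective
  rw [← Matrix.mulVec_mulVec, vecQuat_sandwich_self, vecQuat_sandwich_self, vecQuat_sandwich_self,
    star_mul]
  simp only [mul_assoc]

theorem sandwich_one : sandwich 1 1 = 1 := by
  apply Matrix.ext_of_mulVec_single
  intro j
  apply vecQuat_injective
  rw [vecQuat_sandwich_self, Matrix.one_mulVec, star_one, one_mul, mul_one]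

theorem sandwich_star (q : ℍ[ℝ]) : sandwich (star q) (star q) = (sandwich q q)ᵀ := by
  ext i j
  rw [Matrix.transpose_apply, sandwich_apply, sandwich_apply, imVec_apply, imVec_apply]
  fin_cases i <;> fin_cases j <;> simp [vecQuat] <;> ring

theorem det_sandwich (q : ℍ[ℝ]) : (sandwich q q).det = Quaternion.normSq q ^ 3 := by
  rw [Matrix.det_fin_three, Quaternion.normSq_def']
  simp only [sandwich_apply, imVec_apply, vecQuat]
  simp
  ring

theorem sandwich_mul_transpose {q : ℍ[ℝ]} (hq : ‖q‖ = 1) :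
    sandwich q q * (sandwich q q)ᵀ = 1 := by
  rw [← sandwich_star, ← sandwich_mul, Quaternion.self_mul_star, Quaternion.normSq_eq_norm_mul_self,
    hq, mul_one, Quaternion.coe_one, sandwich_one]

theorem sandwich_mem {q : ℍ[ℝ]} (hq : ‖q‖ = 1) :
    sandwich q q ∈ Matrix.specialOrthogonalGroup (Fin 3) ℝ := by
  rw [Matrix.mem_specialOrthogonalGroup_iff, Matrix.mem_orthogonalGroup_iff, det_sandwich,
    Quaternion.normSq_eq_norm_mul_self, hq, mul_one, one_pow]
  exact ⟨sandwich_mul_transpose hq, rfl⟩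

/-- The trace of the rotation is 3 Re(r)² - ‖Im r‖²; with ‖r‖ = 1 it equals 3 only if r is real. -/
theorem eq_one_or_eq_neg_one_of_sandwich {r : ℍ[ℝ]} (hr : ‖r‖ = 1) (h : sandwich r r = 1) :
    r = 1 ∨ r = -1 := by
  have hn : Quaternion.normSq r = 1 := by rw [Quaternion.normSq_eq_norm_mul_self, hr, mul_one]
  rw [Quaternion.normSq_def'] at hn
  have h1 := congrArg Matrix.trace h
  rw [Matrix.trace_fin_three, Matrix.trace_one] at h1
  simp only [sandwich_apply, imVec_apply, vecQuat] at h1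
  simp at h1
  have hb : r.imI = 0 := by nlinarith [sq_nonneg r.imI, sq_nonneg r.imJ, sq_nonneg r.imK]
  have hc : r.imJ = 0 := by nlinarith [sq_nonneg r.imI, sq_nonneg r.imJ, sq_nonneg r.imK]
  have hd : r.imK = 0 := by nlinarith [sq_nonneg r.imI, sq_nonneg r.imJ, sq_nonneg r.imK]
  rw [hb, hc, hd] at hn
  have ha : r.re * r.re = 1 := by linarith
  rcases mul_self_eq_one_iff.1 ha with ha | ha
  · left; apply Quaternion.ext <;> simp [ha, hb, hc, hd]
  · right; apply Quaternion.ext <;> simp [ha, hb, hc, hd]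

/-- Unit quaternions with the same rotation agree up to sign. -/
theorem eq_or_eq_neg_of_sandwich_eq {p q : ℍ[ℝ]} (hp : ‖p‖ = 1) (hq : ‖q‖ = 1)
    (h : sandwich p p = sandwich q q) : q = p ∨ q = -p := by
  have hs : sandwich (star p * q) (star p * q) = 1 := by
    rw [sandwich_mul, sandwich_star, ← h]
    exact mul_eq_one_comm.1 (sandwich_mul_transpose hp)
  have hpp : p * star p = 1 := by
    rw [Quaternion.self_mul_star, Quaternion.normSq_eq_norm_mul_self, hp]; simp
  have hpq : q = p * (star p * q) := by rw [← mul_assoc, hpp, one_mul]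
  rcases eq_one_or_eq_neg_one_of_sandwich (by rw [norm_mul, norm_star, hp, hq, mul_one]) hs with e | e
  · left; rw [hpq, e, mul_one]
  · right; rw [hpq, e, mul_neg, mul_one]

/-- A rotation that fixes the first two basis vectors is the identity. -/
theorem eq_one_of_fix_two {g : Matrix (Fin 3) (Fin 3) ℝ} (hg : g * gᵀ = 1) (hd : g.det = 1)
    (h0 : g *ᵥ Pi.single 0 1 = Pi.single 0 1) (h1 : g *ᵥ Pi.single 1 1 = Pi.single 1 1) : g = 1 := by
  have c0 : ∀ i, g i 0 = (Pi.single 0 1 : Fin 3 → ℝ) i := fun i => by rw [← h0]; simp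
  have c1 : ∀ i, g i 1 = (Pi.single 1 1 : Fin 3 → ℝ) i := fun i => by rw [← h1]; simp
  have r0 := congrFun (congrFun hg 0) 0
  have r1 := congrFun (congrFun hg 1) 1
  simp [Matrix.mul_apply, Fin.sum_univ_three, c0, c1] at r0 r1
  have r2 : g 2 2 = 1 := by
    rw [Matrix.det_fin_three] at hd
    simpa [c0, c1] using hd
  ext i j
  fin_cases i <;> fin_cases j <;> simp [c0, c1, r0, r1, r2]

theorem norm_vecQuat_sq (w : Fin 3 → ℝ) : ‖vecQuat w‖ ^ 2 = w ⬝ᵥ w := by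
  rw [sq, ← Quaternion.normSq_eq_norm_mul_self, Quaternion.normSq_def', dotProduct,
    Fin.sum_univ_three]
  simp [vecQuat]
  ring

theorem vecQuat_anticomm {v w : Fin 3 → ℝ} (h : v ⬝ᵥ w = 0) :
    vecQuat v * vecQuat w = -(vecQuat w * vecQuat v) := by
  rw [dotProduct, Fin.sum_univ_three] at h
  apply Quaternion.ext <;> simp [vecQuat]
  · linarith
  all_goals ring

theorem norm_eq_one_of_dot {w : Fin 3 → ℝ} (h : w ⬝ᵥ w = 1) : ‖vecQuat w‖ = 1 := by
  rw [← sq_eq_sq₀ (norm_nonneg _) zero_le_one, norm_vecQuat_sq, h, one_pow]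

/-- Every rotation is given by a unit quaternion. -/
theorem exists_sandwich_eq {g : Matrix (Fin 3) (Fin 3) ℝ}
    (hg : g ∈ Matrix.specialOrthogonalGroup (Fin 3) ℝ) : ∃ q : ℍ[ℝ], ‖q‖ = 1 ∧ sandwich q q = g := by
  rw [Matrix.mem_specialOrthogonalGroup_iff, Matrix.mem_orthogonalGroup_iff'] at hg
  obtain ⟨h1 : gᵀ * g = 1, h2⟩ := hg
  have hdot : ∀ v w, (g *ᵥ v) ⬝ᵥ (g *ᵥ w) = v ⬝ᵥ w := fun v w => by
    rw [Matrix.dotProduct_mulVec, Matrix.vecMul_mulVec, h1, Matrix.vecMul_one]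
  obtain ⟨q, e0, e1⟩ := exists_intertwine_pair (i := vecQuat (Pi.single 0 1))
    (j := vecQuat (Pi.single 1 1)) (v := vecQuat (g *ᵥ Pi.single 0 1))
    (w := vecQuat (g *ᵥ Pi.single 1 1)) rfl rfl rfl rfl (norm_eq_one_of_dot (by simp))
    (norm_eq_one_of_dot (by simp)) (norm_eq_one_of_dot (by rw [hdot]; simp))
    (norm_eq_one_of_dot (by rw [hdot]; simp)) (vecQuat_anticomm (by simp))
    (vecQuat_anticomm (by rw [hdot]; simp))
  have hq : ‖(q : ℍ[ℝ])‖ = 1 := norm_eq_of_mem_sphere q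
  have hm := sandwich_mem hq
  rw [Matrix.mem_specialOrthogonalGroup_iff] at hm
  have ht := sandwich_mul_transpose hq
  have ht' := mul_eq_one_comm.1 ht
  have s0 : sandwich q q *ᵥ Pi.single 0 1 = g *ᵥ Pi.single 0 1 := vecQuat_injective <| by
    rw [vecQuat_sandwich_self, UnitQuat.conj_eq e0]
  have s1 : sandwich q q *ᵥ Pi.single 1 1 = g *ᵥ Pi.single 1 1 := vecQuat_injective <| by
    rw [vecQuat_sandwich_self, UnitQuat.conj_eq e1]
  refine ⟨q, hq, ?_⟩
  -- The quaternion was chosen to agree with g on two basis vectors; orthogonality and determinant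
  -- one settle the third.
  have key : gᵀ * sandwich q q = 1 := by
    refine eq_one_of_fix_two ?_ ?_ ?_ ?_
    · rw [Matrix.transpose_mul, Matrix.transpose_transpose, mul_assoc, ← mul_assoc (sandwich _ _),
        ht, one_mul, h1]
    · rw [Matrix.det_mul, Matrix.det_transpose, h2, hm.2, mul_one]
    · rw [← Matrix.mulVec_mulVec, s0, Matrix.mulVec_mulVec, h1, Matrix.one_mulVec]
    · rw [← Matrix.mulVec_mulVec, s1, Matrix.mulVec_mulVec, h1, Matrix.one_mulVec]
  calc sandwich (q : ℍ[ℝ]) q = g * gᵀ * sandwich q q := by rw [mul_eq_one_comm.1 h1, one_mul]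
    _ = g := by rw [mul_assoc, key, mul_one]

theorem vecQuat_crossMat (u : ℍ[ℝ]) (hu : u.re = 0) (w : Fin 3 → ℝ) :
    vecQuat (crossMat (imVec u) *ᵥ w) = (2⁻¹ : ℝ) • (u * vecQuat w - vecQuat w * u) := by
  rw [crossMat, LinearMap.toMatrix'_mulVec, vecQuat_cross, vecQuat_imVec hu]

/-- The derivative of the rotation given by a curve of quaternions with `q' = (1/2) u q`. -/
theorem sandwich_deriv {u q q' : ℍ[ℝ]} (hu : u.re = 0) (h : q' = (2⁻¹ : ℝ) • (u * q)) :
    sandwich q' q + sandwich q q' = crossMat (imVec u) * sandwich q q := by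
  apply Matrix.ext_of_mulVec_single
  intro j
  apply vecQuat_injective
  rw [← Matrix.mulVec_mulVec, vecQuat_crossMat u hu, vecQuat_sandwich_self, Matrix.add_mulVec,
    sandwich_mulVec, sandwich_mulVec, ← map_add]
  have e : q' * vecQuat (Pi.single j 1) * star q + q * vecQuat (Pi.single j 1) * star q' =
      (2⁻¹ : ℝ) • (u * (q * vecQuat (Pi.single j 1) * star q) -
        q * vecQuat (Pi.single j 1) * star q * u) := by
    rw [h, Quaternion.star_smul, star_mul, Quaternion.star_eq_neg_of_re hu]
    simp only [mul_smul_comm, smul_mul_assoc, ← smul_add]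
    congr 1
    noncomm_ring
  rw [e, vecQuat_imVec]
  simp
  ring

theorem crossMat_injective : Function.Injective crossMat := fun v w h => by
  rw [crossMat_eq, crossMat_eq] at h
  simp at h
  ext i
  fin_cases i <;> simp_all

/-! ### The rolling covers -/

namespace NullRay

theorem rep_quatHom_smul (q : UnitQuat × UnitQuat) (c : NullRay) :
    (quatHom q • c).rep = quatAct q c.rep := by
  rw [rep_smul, SplitOct.normalize, toEnd_quatHom, quatAct_fst, norm_mul, norm_mul, norm_star,
    norm_eq_of_mem_sphere, norm_rep_fst, mul_one, mul_one, inv_one, one_smul]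

theorem rep_deck_smul (c : NullRay) : (quatHom deckElt • c).rep = pr c.rep.1 (-c.rep.2) := by
  rw [rep_quatHom_smul]
  apply SplitOct.ext'
  · rw [quatAct_fst]; simp [deckElt]
  · rw [quatAct_snd]; simp [deckElt]

theorem deck_smul_ne (c : NullRay) : quatHom deckElt • c ≠ c := fun h => by
  have h1 := congrArg (fun c : NullRay => c.rep.2) h
  simp only [rep_deck_smul, pr_snd] at h1
  have h2 := quat_eq_zero_of_eq_neg h1.symm
  have h3 := c.norm_rep_snd
  rw [h2, norm_zero] at h3
  exact zero_ne_one h3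

theorem deck_smul_deck_smul (c : NullRay) : quatHom deckElt • quatHom deckElt • c = c := by
  apply rep_injective
  rw [rep_deck_smul, rep_deck_smul]
  apply SplitOct.ext' <;> simp

theorem deck_mul_deck : quatHom deckElt * quatHom deckElt = 1 := by
  rw [← map_mul, quatHom_eq_one]
  left
  refine Prod.ext (Subtype.ext ?_) (Subtype.ext ?_) <;> simp [deckElt]

theorem mem_zpowers_deck {g : G2} (hg : g ∈ Subgroup.zpowers (quatHom deckElt)) :
    g = 1 ∨ g = quatHom deckElt := by
  obtain ⟨n, rfl⟩ := Subgroup.mem_zpowers_iff.1 hg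
  rcases Int.even_or_odd' n with ⟨k, rfl | rfl⟩
  · left; rw [zpow_mul, zpow_ofNat, sq, deck_mul_deck, one_zpow]
  · right; rw [zpow_add, zpow_mul, zpow_ofNat, sq, deck_mul_deck, one_zpow, one_mul, zpow_one]

/-- A continuous surjection whose fibres are the orbits of the deck group is a covering map. -/
theorem isCoveringMap_of_fibre {Z : Type*} [TopologicalSpace Z] [T2Space Z] {f : NullRay → Z}
    (hf : Continuous f) (hs : Function.Surjective f)
    (h : ∀ c c', f c = f c' ↔ c' = c ∨ c' = quatHom deckElt • c) : IsCoveringMap f := by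
  have hq : Topology.IsQuotientMap f := hf.isClosedMap.isQuotientMap hf hs
  have : T2Space NullRay := homeo.symm.t2Space
  have hc : IsQuotientCoveringMap f (Subgroup.zpowers (quatHom deckElt)) :=
    { hq with
      continuous_const_smul := fun g => continuous_const_smul (g : G2)
      apply_eq_iff_mem_orbit := by
        intro c c'
        rw [h]
        constructor
        · rintro (rfl | rfl)
          · exact MulAction.mem_orbit_self _
          · exact ⟨⟨_, Subgroup.mem_zpowers _⟩, deck_smul_deck_smul c⟩
        · rintro ⟨⟨g, hg⟩, rfl⟩
          rcases mem_zpowers_deck hg with rfl | rfl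
          · left; exact (one_smul G2 c').symm
          · right; exact (deck_smul_deck_smul c').symm
      disjoint := by
        intro c
        obtain ⟨A, B, hA, hB, hcA, hcB, hAB⟩ := t2_separation (deck_smul_ne c)
        -- The deck involution carries this neighbourhood into A, which is disjoint from B.
        refine ⟨B ∩ (fun c => quatHom deckElt • c) ⁻¹' A, Filter.inter_mem (hB.mem_nhds hcB)
          ((hA.preimage (continuous_const_smul (quatHom deckElt))).mem_nhds hcA), ?_⟩
        rintro ⟨g, hg⟩ ⟨_, ⟨d, hd, rfl⟩, hd'⟩
        rcases mem_zpowers_deck hg with rfl | rfl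
        · rfl
        · exact (Set.disjoint_left.1 hAB hd.2 hd'.1).elim }
  exact hc.isCoveringMap

end NullRay

/-- The rolling configuration given by a unit quaternion and a unit imaginary quaternion. -/
def rollConf (q x : ℍ[ℝ]) (hq : ‖q‖ = 1) (hx : x.re = 0) (hx1 : ‖x‖ = 1) : RollConf :=
  (⟨sandwich q q, sandwich_mem hq⟩, ⟨imCoord x, by
    rw [mem_sphere_zero_iff_norm, norm_imCoord hx, hx1]⟩)

theorem rollConf_dir {q x : ℍ[ℝ]} (hq : ‖q‖ = 1) (hx : x.re = 0) (hx1 : ‖x‖ = 1) :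
    (rollConf q x hq hx hx1).dir = imVec x := by
  ext i; fin_cases i <;> rfl

theorem RollConf.ext {p p' : RollConf} (h1 : p.rot = p'.rot) (h2 : p.dir = p'.dir) : p = p' := by
  refine Prod.ext (Subtype.ext h1) (Subtype.ext ?_)
  ext i
  exact congrFun h2 i

/-- The coordinates of the configuration given by a pair of quaternions. -/
def rollCoord (q x : ℍ[ℝ]) : RollAmb := (fun i j => sandwich q q i j, imVec x)

theorem rollConf_coord {q x : ℍ[ℝ]} (hq : ‖q‖ = 1) (hx : x.re = 0) (hx1 : ‖x‖ = 1) :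
    (rollConf q x hq hx hx1).coord = rollCoord q x :=
  Prod.ext rfl (rollConf_dir hq hx hx1)

/-- The conjugation of quaternions as a continuous linear map. -/
def quatStar : ℍ[ℝ] →L[ℝ] ℍ[ℝ] := LinearMap.toContinuousLinearMap
  { toFun := star
    map_add' := star_add
    map_smul' := fun c x => Quaternion.star_smul c x }

theorem ContDiff.quat_star {E : Type*} [NormedAddCommGroup E] [NormedSpace ℝ E] {f : E → ℍ[ℝ]}
    (hf : ContDiff ℝ ∞ f) : ContDiff ℝ ∞ fun x => star (f x) := quatStar.contDiff.comp hf

theorem HasDerivAt.quat_star {f : ℝ → ℍ[ℝ]} {f' : ℍ[ℝ]} {t : ℝ} (hf : HasDerivAt f f' t) :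
    HasDerivAt (fun t => star (f t)) (star f') t := quatStar.hasFDerivAt.comp_hasDerivAt t hf

theorem fderiv_eq_of_line {V W : Type*} [NormedAddCommGroup V] [NormedSpace ℝ V]
    [NormedAddCommGroup W] [NormedSpace ℝ W] {F : V → W} {x y : V} {z : W}
    (hF : DifferentiableAt ℝ F x) (h : HasDerivAt (fun t : ℝ => F (x + t • y)) z 0) :
    fderiv ℝ F x y = z := by
  have hl : HasDerivAt (fun t : ℝ => x + t • y) y 0 := by
    simpa using ((hasDerivAt_id (0 : ℝ)).smul_const y).const_add x
  have h0 : x + (0 : ℝ) • y = x := by simp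
  have hG : HasFDerivAt F (fderiv ℝ F x) (x + (0 : ℝ) • y) := by rw [h0]; exact hF.hasFDerivAt
  exact (hG.comp_hasDerivAt (0 : ℝ) hl).unique h

/-- The formulas for a map from the space of null rays to the space of rolling configurations, in
terms of quaternions: `Q` and `X` describe the rotation and the point of contact, `Q'` and `X'` are
their directional derivatives. -/
structure IsRollingModel (R r : ℝ) (s : UnitQuat × UnitQuat → UnitQuat × UnitQuat)
    (Q X : SplitOct → ℍ[ℝ]) (Q' X' : SplitOct → SplitOct → ℍ[ℝ]) : Prop where
  contDiff_Q : ContDiff ℝ ∞ Q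
  contDiff_X : ContDiff ℝ ∞ X
  deriv_Q : ∀ x y, HasDerivAt (fun t : ℝ => Q (x + t • y)) (Q' x y) 0
  deriv_X : ∀ x y, HasDerivAt (fun t : ℝ => X (x + t • y)) (X' x y) 0
  norm_Q : ∀ c : NullRay, ‖Q c.rep‖ = 1
  norm_X : ∀ c : NullRay, ‖X c.rep‖ = 1
  re_X : ∀ c : NullRay, (X c.rep).re = 0
  equivariant_Q : ∀ q x, Q (quatAct q x) = ((s q).1 : ℍ[ℝ]) * Q x * star ((s q).2 : ℍ[ℝ])
  equivariant_X : ∀ q x, X (quatAct q x) = ((s q).1 : ℍ[ℝ]) * X x * star ((s q).1 : ℍ[ℝ])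
  deck : ∀ v h, Q (pr v (-h)) = -Q (pr v h) ∧ X (pr v (-h)) = X (pr v h)
  injective : ∀ c c' : NullRay, Q c.rep = Q c'.rep → X c.rep = X c'.rep → c.rep = c'.rep
  surjective : ∀ q x : ℍ[ℝ], ‖q‖ = 1 → ‖x‖ = 1 → x.re = 0 → ∃ c : NullRay, Q c.rep = q ∧ X c.rep = x
  immersion : ∀ (c : NullRay) (w : E5), Q' c.rep (NullRay.drep c w) = 0 →
    X' c.rep (NullRay.drep c w) = 0 → NullRay.drep c w = 0
  push_le : ∀ (c : NullRay) (b : ℍ[ℝ]), b.re = 0 → b * c.rep.1 = -(c.rep.1 * b) → ∃ u : ℍ[ℝ],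
    u.re = 0 ∧ u * X c.rep = -(X c.rep * u) ∧
    Q' c.rep (c.planeVec b) = (2⁻¹ : ℝ) • (u * Q c.rep) ∧
    (R + r) • X' c.rep (c.planeVec b) = r • (u * X c.rep)
  push_ge : ∀ (c : NullRay) (u : ℍ[ℝ]), u.re = 0 → u * X c.rep = -(X c.rep * u) → ∃ b : ℍ[ℝ],
    b * c.rep.1 = -(c.rep.1 * b) ∧ Q' c.rep (c.planeVec b) = (2⁻¹ : ℝ) • (u * Q c.rep) ∧
    (R + r) • X' c.rep (c.planeVec b) = r • (u * X c.rep)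

/-! ### From quaternion formulas to covers of the configuration space. -/

namespace IsRollingModel

open NullRay

variable {R r : ℝ} {s : UnitQuat × UnitQuat → UnitQuat × UnitQuat} {Q X : SplitOct → ℍ[ℝ]}
  {Q' X' : SplitOct → SplitOct → ℍ[ℝ]}

/-- The map to the rolling configurations. -/
def proj (hm : IsRollingModel R r s Q X Q' X')
    (c : NullRay) : RollConf :=
  rollConf (Q c.rep) (X c.rep) (hm.norm_Q c) (hm.re_X c) (hm.norm_X c)

theorem proj_rot (hm : IsRollingModel R r s Q X Q' X')
    (c : NullRay) : (hm.proj c).rot = sandwich (Q c.rep) (Q c.rep) := rfl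

theorem proj_dir (hm : IsRollingModel R r s Q X Q' X')
    (c : NullRay) : (hm.proj c).dir = imVec (X c.rep) := rollConf_dir _ _ _

theorem contDiff_coord (hm : IsRollingModel R r s Q X Q' X') :
    ContDiff ℝ ∞ fun x => rollCoord (Q x) (X x) := by
  refine ContDiff.prodMk (contDiff_pi.2 fun i => contDiff_pi.2 fun j => ?_)
    (imVec.contDiff.comp hm.contDiff_X)
  exact ((contDiff_apply ℝ ℝ i).comp imVec.contDiff).comp
    ((hm.contDiff_Q.mul contDiff_const).mul hm.contDiff_Q.quat_star)

theorem contMDiff_coord (hm : IsRollingModel R r s Q X Q' X') :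
    ContMDiff 𝓘(ℝ, E5) 𝓘(ℝ, RollAmb) ∞ (fun c => (hm.proj c).coord) := by
  have : (fun c => (hm.proj c).coord) = fun c : NullRay => rollCoord (Q c.rep) (X c.rep) :=
    funext fun c => rollConf_coord _ _ _
  rw [this]
  exact hm.contDiff_coord.contMDiff.comp contMDiff_rep

/-- The matrix `sandwich p q` is ℝ-bilinear in p and q, so its derivative is a sum of two terms by
the product rule. -/
theorem fderiv_coord (hm : IsRollingModel R r s Q X Q' X')
    (x y : SplitOct) : fderiv ℝ (fun x => rollCoord (Q x) (X x)) x y =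
    (fun i j => (sandwich (Q' x y) (Q x) + sandwich (Q x) (Q' x y)) i j, imVec (X' x y)) := by
  have h0 : x + (0 : ℝ) • y = x := by simp
  refine fderiv_eq_of_line (hm.contDiff_coord.differentiable (by simp) _)
    (HasDerivAt.prodMk (hasDerivAt_pi.2 fun i => hasDerivAt_pi.2 fun j => ?_)
    (imVec.hasFDerivAt.comp_hasDerivAt _ (hm.deriv_X x y)))
  have h2 := ((hm.deriv_Q x y).mul_const (vecQuat (Pi.single j 1))).mul (hm.deriv_Q x y).quat_star
  have h3 := ((ContinuousLinearMap.proj (R := ℝ) i).comp imVec).hasFDerivAt.comp_hasDerivAt _ h2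
  refine h3.congr_deriv ?_
  rw [h0, map_add]
  rfl

/-- The derivative of the map to the rolling configurations. -/
theorem mfderiv_coord (hm : IsRollingModel R r s Q X Q' X')
    (c : NullRay) (w : E5) :
    (mfderiv 𝓘(ℝ, E5) 𝓘(ℝ, RollAmb) (fun c => (hm.proj c).coord) c : E5 →L[ℝ] RollAmb) w =
      (fun i j => (sandwich (Q' c.rep (drep c w)) (Q c.rep) +
        sandwich (Q c.rep) (Q' c.rep (drep c w))) i j, imVec (X' c.rep (drep c w))) := by
  have : (fun c => (hm.proj c).coord) = fun c : NullRay => rollCoord (Q c.rep) (X c.rep) :=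
    funext fun c => rollConf_coord _ _ _
  rw [this, ← hm.fderiv_coord]
  exact mfderiv_comp_rep (G := fun x => rollCoord (Q x) (X x))
    (hm.contDiff_coord.differentiable (by simp) _) w

theorem continuous_proj (hm : IsRollingModel R r s Q X Q' X') : Continuous hm.proj := by
  have h1 : Continuous fun c => (hm.proj c).coord := hm.contMDiff_coord.continuous
  refine (Continuous.subtype_mk (continuous_fst.comp h1) _).prodMk (Continuous.subtype_mk ?_ _)
  exact imCoord.continuous.comp (hm.contDiff_X.continuous.comp continuous_rep)

theorem rep_deck (hm : IsRollingModel R r s Q X Q' X') (c : NullRay) :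
    Q (quatHom deckElt • c).rep = -Q c.rep ∧ X (quatHom deckElt • c).rep = X c.rep := by
  rw [rep_deck_smul]
  exact hm.deck c.rep.1 c.rep.2

theorem sandwich_neg (q : ℍ[ℝ]) : sandwich (-q) (-q) = sandwich q q := by
  ext i j
  rw [sandwich_apply, sandwich_apply, star_neg, neg_mul, neg_mul, mul_neg, neg_neg]

/-- Equal rotations mean that the quaternions Q agree up to sign; the deck transformation changes
exactly this sign and keeps X. -/
theorem proj_eq_iff (hm : IsRollingModel R r s Q X Q' X') (c c' : NullRay) :
    hm.proj c = hm.proj c' ↔ c' = c ∨ c' = quatHom deckElt • c := by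
  constructor
  · intro h
    have hx : X c.rep = X c'.rep := by
      have h2 := congrArg (fun p => vecQuat (RollConf.dir p)) h
      simp only [proj_dir] at h2
      rwa [vecQuat_imVec (hm.re_X c), vecQuat_imVec (hm.re_X c')] at h2
    have hq : sandwich (Q c.rep) (Q c.rep) = sandwich (Q c'.rep) (Q c'.rep) :=
      congrArg RollConf.rot h
    obtain ⟨d1, d2⟩ := hm.rep_deck c
    rcases eq_or_eq_neg_of_sandwich_eq (hm.norm_Q c) (hm.norm_Q c') hq with e | e
    · left; exact (rep_injective (hm.injective c c' e.symm hx)).symm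
    · right
      exact (rep_injective (hm.injective _ c' (d1.trans e.symm) (d2.trans hx))).symm
  · rintro (rfl | rfl)
    · rfl
    · obtain ⟨d1, d2⟩ := hm.rep_deck c
      refine RollConf.ext ?_ ?_
      · rw [proj_rot, proj_rot, d1, sandwich_neg]
      · rw [proj_dir, proj_dir, d2]

theorem surjective_proj (hm : IsRollingModel R r s Q X Q' X') : Function.Surjective hm.proj := by
  intro p
  obtain ⟨q, hq, e⟩ := exists_sandwich_eq p.1.2
  have hx : ‖imQuat p.2.1‖ = 1 := by rw [imQuat.norm_map, norm_eq_of_mem_sphere]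
  obtain ⟨c, h1, h2⟩ := hm.surjective q (imQuat p.2.1) hq hx rfl
  refine ⟨c, RollConf.ext ?_ ?_⟩
  · rw [proj_rot, h1]; exact e
  · rw [proj_dir, h2]; exact imVec_vecQuat _

theorem re_deriv_X (hm : IsRollingModel R r s Q X Q' X') (c : NullRay) (w : E5) :
    (X' c.rep (drep c w)).re = 0 := by
  let l : ℍ[ℝ] →L[ℝ] ℝ := LinearMap.toContinuousLinearMap
    { toFun := fun x => x.re
      map_add' := fun _ _ => rfl
      map_smul' := fun _ _ => rfl }
  have hd : ContDiff ℝ ∞ fun x => l (X x) := l.contDiff.comp hm.contDiff_X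
  have h := fderiv_drep_of_const (c := c) (hd.differentiable (by simp) _) hm.re_X w
  rwa [fderiv_eq_of_line (hd.differentiable (by simp) _)
    (l.hasFDerivAt.comp_hasDerivAt _ (hm.deriv_X _ _))] at h

/-- Differentiate Q Q̄ = 1. Together with `eq_half_mul` it makes 2 Q' Q̄ an imaginary quaternion,
the angular velocity. -/
theorem re_deriv_Q (hm : IsRollingModel R r s Q X Q' X') (c : NullRay) (w : E5) :
    (Q' c.rep (drep c w) * star (Q c.rep)).re = 0 := by
  have hd : ContDiff ℝ ∞ fun x => Q x * star (Q x) := hm.contDiff_Q.mul hm.contDiff_Q.quat_star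
  have h1 : ∀ c : NullRay, Q c.rep * star (Q c.rep) = 1 := fun c => by
    rw [Quaternion.self_mul_star, Quaternion.normSq_eq_norm_mul_self, hm.norm_Q]; simp
  have h := fderiv_drep_of_const (c := c) (hd.differentiable (by simp) _) h1 w
  rw [fderiv_eq_of_line (hd.differentiable (by simp) _)
    ((hm.deriv_Q _ _).mul (hm.deriv_Q _ _).quat_star)] at h
  have h2 := congrArg QuaternionAlgebra.re h
  simp at h2 ⊢
  linarith

theorem eq_half_mul {q p : ℍ[ℝ]} (hq : ‖q‖ = 1) : p = (2⁻¹ : ℝ) • ((2 : ℝ) • (p * star q) * q) := by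
  rw [smul_mul_assoc, smul_smul, mul_assoc, Quaternion.star_mul_self,
    Quaternion.normSq_eq_norm_mul_self, hq]
  simp

/-- A vanishing derivative of the rotation forces the angular velocity to vanish, hence Q' = 0; as X
is imaginary, X' = 0 too, and the `immersion` field applies. -/
theorem injective_mfderiv (hm : IsRollingModel R r s Q X Q' X') (c : NullRay) : Function.Injective
    (mfderiv 𝓘(ℝ, E5) 𝓘(ℝ, RollAmb) (fun c => (hm.proj c).coord) c) := by
  rw [injective_iff_map_eq_zero]
  intro (w : E5) hw
  have h := (hm.mfderiv_coord c w).symm.trans hw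
  have h1 : sandwich (Q' c.rep (drep c w)) (Q c.rep) + sandwich (Q c.rep) (Q' c.rep (drep c w)) = 0 :=
    congrArg Prod.fst h
  have h2 : imVec (X' c.rep (drep c w)) = 0 := congrArg Prod.snd h
  have hu : ((2 : ℝ) • (Q' c.rep (drep c w) * star (Q c.rep))).re = 0 := by
    rw [Quaternion.re_smul, hm.re_deriv_Q, smul_zero]
  rw [sandwich_deriv hu (eq_half_mul (hm.norm_Q c))] at h1
  have h3 : crossMat (imVec ((2 : ℝ) • (Q' c.rep (drep c w) * star (Q c.rep)))) = crossMat 0 := by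
    rw [← mul_one (crossMat (imVec _)), ← sandwich_mul_transpose (hm.norm_Q c), ← mul_assoc, h1,
      zero_mul, crossMat, map_zero, map_zero]
  have h4 := congrArg vecQuat (crossMat_injective h3)
  rw [vecQuat_imVec hu] at h4
  have h5 : vecQuat 0 = 0 := by apply Quaternion.ext <;> simp [vecQuat]
  have hQ : Q' c.rep (drep c w) = 0 := by
    rw [eq_half_mul (p := Q' c.rep (drep c w)) (hm.norm_Q c), h4, h5, zero_mul, smul_zero]
  have hX : X' c.rep (drep c w) = 0 := by
    rw [← vecQuat_imVec (hm.re_deriv_X c w), h2, h5]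
  exact drep_injective c ((hm.immersion c w hQ hX).trans (map_zero _).symm)

theorem imVec_cross {u x : ℍ[ℝ]} (hu : u.re = 0) (hx : x.re = 0) (h : u * x = -(x * u)) :
    imVec (u * x) = imVec u ⨯₃ imVec x := by
  apply vecQuat_injective
  rw [vecQuat_cross, vecQuat_imVec hu, vecQuat_imVec hx, vecQuat_imVec]
  · rw [eq_neg_iff_add_eq_zero.1 h |> eq_neg_of_add_eq_zero_right, sub_neg_eq_add, ← two_smul ℝ,
      smul_smul]
    simp
  · have := congrArg QuaternionAlgebra.re h
    simp at this ⊢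
    linarith

theorem dot_imVec {u x : ℍ[ℝ]} (h : u * x = -(x * u)) (hu : u.re = 0) :
    imVec u ⬝ᵥ imVec x = 0 := by
  have := congrArg QuaternionAlgebra.re h
  rw [dotProduct, Fin.sum_univ_three]
  simp [hu, imVec_apply] at this ⊢
  linarith

theorem anticomm_of_dot {u x : ℍ[ℝ]} (hu : u.re = 0) (hx : x.re = 0)
    (h : imVec u ⬝ᵥ imVec x = 0) : u * x = -(x * u) := by
  rw [← vecQuat_imVec hu, ← vecQuat_imVec hx]
  exact vecQuat_anticomm h

/-- Left multiplication by an imaginary u orthogonal to x is the cross product with u, so the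
conditions of the model on Q' and X' are the rolling conditions with angular velocity u. -/
theorem map_octDist (hm : IsRollingModel R r s Q X Q' X') (hRr : R + r ≠ 0) (c : NullRay) :
    Submodule.map (mfderiv 𝓘(ℝ, E5) 𝓘(ℝ, RollAmb) (fun c => (hm.proj c).coord) c :
      E5 →L[ℝ] RollAmb).toLinearMap (octDist c) = rollDist R r (hm.proj c) := by
  apply le_antisymm
  · rintro _ ⟨w, hw, rfl⟩
    have hw' := mem_octDist_iff.1 hw
    obtain ⟨u, hu, hux, e1, e2⟩ := hm.push_le c _ (drep_fst_re c w) (drep_fst_mul c w)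
    rw [← hw'] at e1 e2
    refine (congrArg (· ∈ rollDist R r (hm.proj c)) (hm.mfderiv_coord c w)).mpr
      ⟨imVec u, ?_, ?_, ?_⟩
    · rw [proj_rot, ← sandwich_deriv hu e1]
      rfl
    · rw [proj_dir, ← imVec_cross hu (hm.re_X c) hux, ← map_smul, ← map_smul, e2]
    · rw [proj_dir]; exact dot_imVec hux hu
  · rintro ⟨y1, y2⟩ ⟨ω', h1, h2, h3⟩
    rw [proj_dir] at h2 h3
    rw [← imVec_vecQuat ω'] at h1 h2 h3
    have hux := anticomm_of_dot (u := vecQuat ω') rfl (hm.re_X c) h3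
    obtain ⟨b, hb, e1, e2⟩ := hm.push_ge c (vecQuat ω') rfl hux
    obtain ⟨w, hw, e⟩ := exists_mem_octDist hb
    rw [← e] at e1 e2
    refine ⟨w, hw, (hm.mfderiv_coord c w).trans (Prod.ext ?_ ?_)⟩
    · have := sandwich_deriv rfl e1
      rw [proj_rot, ← this] at h1
      exact h1.symm
    · rw [← imVec_cross rfl (hm.re_X c) hux, ← map_smul, ← e2, map_smul] at h2
      exact (smul_right_injective _ hRr h2).symm

theorem isRollingCover (hm : IsRollingModel R r s Q X Q' X') (hRr : R + r ≠ 0) :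
    IsRollingCover octDist R r s hm.proj where
  covering := isCoveringMap_of_fibre hm.continuous_proj hm.surjective_proj hm.proj_eq_iff
  surjective := hm.surjective_proj
  fibre := hm.proj_eq_iff
  two := deck_smul_ne
  smooth := hm.contMDiff_coord
  immersion := hm.injective_mfderiv
  equivariant_rot q c := by
    rw [proj_rot, proj_rot, quatRot_eq_sandwich, quatRot_eq_sandwich, rep_quatHom_smul,
      hm.equivariant_Q, sandwich_mul, sandwich_mul, sandwich_star]
  equivariant_dir q c := by
    rw [proj_dir, proj_dir, quatRot_eq_sandwich, sandwich_mulVec, rep_quatHom_smul,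
      hm.equivariant_X, vecQuat_imVec (hm.re_X c)]
  push := hm.map_octDist hRr

end IsRollingModel

/-! ### The two explicit models, for the ratios 3 : 1 and 1 : 3. -/

open NullRay

theorem quat_mul_star {q : ℍ[ℝ]} (hq : ‖q‖ = 1) : q * star q = 1 := by
  rw [Quaternion.self_mul_star, Quaternion.normSq_eq_norm_mul_self, hq]; simp

theorem quat_star_mul {q : ℍ[ℝ]} (hq : ‖q‖ = 1) : star q * q = 1 := by
  rw [Quaternion.star_mul_self, Quaternion.normSq_eq_norm_mul_self, hq]; simp

theorem quat_star_mul_cancel {q : ℍ[ℝ]} (hq : ‖q‖ = 1) (x : ℍ[ℝ]) : star q * (q * x) = x := by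
  rw [← mul_assoc, quat_star_mul hq, one_mul]

theorem quat_mul_star_cancel {q : ℍ[ℝ]} (hq : ‖q‖ = 1) (x : ℍ[ℝ]) : q * (star q * x) = x := by
  rw [← mul_assoc, quat_mul_star hq, one_mul]

theorem mul_mul_of_anticomm {v b : ℍ[ℝ]} (hv : v * v = -1) (hb : b * v = -(v * b)) :
    v * (b * v) = b := by
  rw [hb, mul_neg, ← mul_assoc, hv, neg_one_mul, neg_neg]

theorem mul_anticomm {v b : ℍ[ℝ]} (hb : b * v = -(v * b)) : v * b * v = -(v * (v * b)) := by
  rw [mul_assoc, hb, mul_neg]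

theorem hasDerivAt_fst_line (x y : SplitOct) :
    HasDerivAt (fun t : ℝ => (x + t • y).1) y.1 0 := by
  have h : HasDerivAt (fun t : ℝ => x.1 + t • y.1) y.1 0 := by
    simpa using ((hasDerivAt_id (0 : ℝ)).smul_const y.1).const_add x.1
  exact h

theorem hasDerivAt_snd_line (x y : SplitOct) :
    HasDerivAt (fun t : ℝ => (x + t • y).2) y.2 0 := by
  have h : HasDerivAt (fun t : ℝ => x.2 + t • y.2) y.2 0 := by
    simpa using ((hasDerivAt_id (0 : ℝ)).smul_const y.2).const_add x.2
  exact h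

section Formulas

variable {c : NullRay} {b : ℍ[ℝ]}

/-- The derivative of v h̄ along (b, hvb): both terms equal b h̄, and vbv = b turns 2bh̄ into ½ u v
h̄ with u = 4vb. -/
theorem planeVec_deriv_mul_star (hb0 : b.re = 0) (hb : b * c.rep.1 = -(c.rep.1 * b)) :
    b * star c.rep.2 + c.rep.1 * star (planeVec c b).2 =
      (2⁻¹ : ℝ) • ((4 : ℝ) • (c.rep.1 * b) * (c.rep.1 * star c.rep.2)) := by
  have e : c.rep.1 * star (planeVec c b).2 = b * star c.rep.2 := by
    change c.rep.1 * star (c.rep.2 * c.rep.1 * b) = _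
    rw [star_mul, star_mul, Quaternion.star_eq_neg_of_re hb0, Quaternion.star_eq_neg_of_re c.rep_re,
      neg_mul, mul_neg, neg_mul, mul_neg, mul_neg, neg_neg, ← mul_assoc b, ← mul_assoc,
      mul_mul_of_anticomm c.rep_fst_mul_self hb]
  rw [e, smul_mul_assoc, smul_smul, mul_assoc, ← mul_assoc b, ← mul_assoc c.rep.1,
    mul_mul_of_anticomm c.rep_fst_mul_self hb, ← two_smul ℝ]
  norm_num

theorem planeVec_deriv_mul (hb : b * c.rep.1 = -(c.rep.1 * b)) :
    (planeVec c b).2 * c.rep.1 + c.rep.2 * b = (2 : ℝ) • (c.rep.2 * b) := by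
  change c.rep.2 * c.rep.1 * b * c.rep.1 + _ = _
  rw [mul_assoc, mul_assoc, mul_mul_of_anticomm c.rep_fst_mul_self hb, two_smul]

/-- The derivative of h v h̄: each of its three factors contributes h b h̄. Against the 4 in the
angular velocity this 3 produces the ratio 1 : 3. -/
theorem planeVec_deriv_conj (hb0 : b.re = 0) (hb : b * c.rep.1 = -(c.rep.1 * b)) :
    ((planeVec c b).2 * c.rep.1 + c.rep.2 * b) * star c.rep.2 +
      c.rep.2 * c.rep.1 * star (planeVec c b).2 = (3 : ℝ) • (c.rep.2 * b * star c.rep.2) := by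
  have e : c.rep.2 * c.rep.1 * star (planeVec c b).2 = c.rep.2 * b * star c.rep.2 := by
    change c.rep.2 * c.rep.1 * star (c.rep.2 * c.rep.1 * b) = _
    rw [star_mul, star_mul, Quaternion.star_eq_neg_of_re hb0, Quaternion.star_eq_neg_of_re c.rep_re,
      neg_mul, mul_neg, neg_mul, mul_neg, mul_neg, neg_neg, ← mul_assoc b, mul_assoc c.rep.2,
      ← mul_assoc c.rep.1, mul_mul_of_anticomm c.rep_fst_mul_self hb, mul_assoc]
  rw [e, planeVec_deriv_mul hb, smul_mul_assoc]
  module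

theorem planeVec_deriv_mul_eq (hb : b * c.rep.1 = -(c.rep.1 * b)) :
    (planeVec c b).2 * c.rep.1 + c.rep.2 * b = (2⁻¹ : ℝ) •
      ((4 : ℝ) • (c.rep.2 * (c.rep.1 * b) * star c.rep.2) * (c.rep.2 * c.rep.1)) := by
  rw [planeVec_deriv_mul hb, smul_mul_assoc, smul_smul]
  simp only [mul_assoc, quat_star_mul_cancel c.norm_rep_snd]
  rw [mul_mul_of_anticomm c.rep_fst_mul_self hb]
  norm_num

theorem planeVec_deriv_conj_eq (hb0 : b.re = 0) (hb : b * c.rep.1 = -(c.rep.1 * b)) {R r : ℝ}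
    (h : r = 3 * R) :
    (R + r) • (((planeVec c b).2 * c.rep.1 + c.rep.2 * b) * star c.rep.2 +
      c.rep.2 * c.rep.1 * star (planeVec c b).2) =
    r • ((4 : ℝ) • (c.rep.2 * (c.rep.1 * b) * star c.rep.2) *
      (c.rep.2 * c.rep.1 * star c.rep.2)) := by
  rw [planeVec_deriv_conj hb0 hb, smul_mul_assoc, smul_smul, smul_smul]
  simp only [mul_assoc, quat_star_mul_cancel c.norm_rep_snd]
  rw [← mul_assoc b, ← mul_assoc c.rep.1, mul_mul_of_anticomm c.rep_fst_mul_self hb, h]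
  congr 1
  ring

end Formulas

/-- The rolling model for the ratio `3 : 1`. -/
theorem isRollingModel_three {R r : ℝ} (h : R = 3 * r) : IsRollingModel R r id
    (fun x => x.1 * star x.2) (fun x => x.1) (fun x y => y.1 * star x.2 + x.1 * star y.2)
    (fun _ y => y.1) where
  contDiff_Q := contDiff_fst'.mul contDiff_snd'.quat_star
  contDiff_X := contDiff_fst'
  deriv_Q x y := by
    refine ((hasDerivAt_fst_line x y).mul (hasDerivAt_snd_line x y).quat_star).congr_deriv ?_
    simp
  deriv_X x y := hasDerivAt_fst_line x y
  norm_Q c := by rw [norm_mul, norm_star, norm_rep_fst, norm_rep_snd, mul_one]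
  norm_X := norm_rep_fst
  re_X := rep_re
  equivariant_Q q x := by
    rw [quatAct_fst, quatAct_snd, star_mul, star_mul, star_star]
    simp only [mul_assoc, quat_star_mul_cancel (norm_eq_of_mem_sphere q.1), id]
  equivariant_X q x := rfl
  deck v h := by simp
  injective c c' h1 h2 := by
    refine SplitOct.ext' h2 ?_
    simp only [h2] at h1
    exact star_injective (mul_left_cancel₀ c'.rep_fst_ne_zero h1)
  surjective q x hq hx hx0 := by
    -- Solving v = x and v h̄ = q for h.
    refine ⟨ofUnit x (star (star x * q)) hx0 hx (by rw [norm_star, norm_mul, norm_star, hx, hq, mul_one]),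
      ?_, ?_⟩
    · rw [rep_ofUnit, pr_fst, pr_snd, star_star, quat_mul_star_cancel hx]
    · rw [rep_ofUnit, pr_fst]
  immersion c w h1 h2 := by
    simp only [h2, zero_mul, zero_add] at h1
    exact SplitOct.ext' h2 (star_eq_zero.1 ((mul_eq_zero.1 h1).resolve_left c.rep_fst_ne_zero))
  push_le c b hb0 hb := by
    -- With u = 4vb one has u v = 4b while the contact point moves with velocity b, so no-slip
    -- amounts to R + r = 4r.
    refine ⟨(4 : ℝ) • (c.rep.1 * b), ?_, ?_, planeVec_deriv_mul_star hb0 hb, ?_⟩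
    · rw [Quaternion.re_smul, re_mul_eq_zero_of_anticomm hb, smul_zero]
    · rw [smul_mul_assoc, mul_smul_comm, mul_anticomm hb, smul_neg]
    · rw [smul_mul_assoc, mul_assoc, mul_mul_of_anticomm c.rep_fst_mul_self hb, smul_smul, h]
      change _ • b = _
      congr 1
      ring
  push_ge c u hu0 hu := by
    -- The vector b = -vu/4 solves 4vb = u.
    have hb : (-(4⁻¹ : ℝ)) • (c.rep.1 * u) * c.rep.1 = -(c.rep.1 * (-(4⁻¹ : ℝ)) • (c.rep.1 * u)) := by
      rw [smul_mul_assoc, mul_smul_comm, mul_anticomm hu, smul_neg]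
    have hb0 : ((-(4⁻¹ : ℝ)) • (c.rep.1 * u)).re = 0 := by
      rw [Quaternion.re_smul, re_mul_eq_zero_of_anticomm hu, smul_zero]
    have e : (4 : ℝ) • (c.rep.1 * (-(4⁻¹ : ℝ)) • (c.rep.1 * u)) = u := by
      rw [mul_smul_comm, smul_smul, ← mul_assoc, c.rep_fst_mul_self]
      norm_num
    have h1 := planeVec_deriv_mul_star hb0 hb
    rw [e] at h1
    refine ⟨_, hb, h1, ?_⟩
    change _ • (-(4⁻¹ : ℝ)) • (c.rep.1 * u) = _
    rw [← neg_eq_iff_eq_neg.2 hu, smul_smul, smul_neg, ← neg_smul, h]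
    congr 1
    ring

/-- The rolling model for the ratio `1 : 3`. -/
theorem isRollingModel_third {R r : ℝ} (h : r = 3 * R) : IsRollingModel R r Prod.swap
    (fun x => x.2 * x.1) (fun x => x.2 * x.1 * star x.2) (fun x y => y.2 * x.1 + x.2 * y.1)
    (fun x y => (y.2 * x.1 + x.2 * y.1) * star x.2 + x.2 * x.1 * star y.2) where
  contDiff_Q := contDiff_snd'.mul contDiff_fst'
  contDiff_X := (contDiff_snd'.mul contDiff_fst').mul contDiff_snd'.quat_star
  deriv_Q x y := by
    refine ((hasDerivAt_snd_line x y).mul (hasDerivAt_fst_line x y)).congr_deriv ?_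
    simp
  deriv_X x y := by
    refine (((hasDerivAt_snd_line x y).mul (hasDerivAt_fst_line x y)).mul
      (hasDerivAt_snd_line x y).quat_star).congr_deriv ?_
    simp
  norm_Q c := by rw [norm_mul, norm_rep_fst, norm_rep_snd, mul_one]
  norm_X c := by rw [norm_mul, norm_mul, norm_star, norm_rep_fst, norm_rep_snd, mul_one, mul_one]
  re_X c := re_conj c.rep_re
  equivariant_Q q x := by
    rw [quatAct_fst, quatAct_snd]
    simp only [mul_assoc, quat_star_mul_cancel (norm_eq_of_mem_sphere q.1), Prod.fst_swap,
      Prod.snd_swap]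
  equivariant_X q x := by
    rw [quatAct_fst, quatAct_snd, star_mul, star_mul, star_star]
    simp only [mul_assoc, quat_star_mul_cancel (norm_eq_of_mem_sphere q.1), Prod.fst_swap]
  deck v h := by simp
  injective c c' h1 h2 := by
    have hne : c'.rep.2 ≠ 0 := norm_ne_zero_iff.1 (by rw [norm_rep_snd]; exact one_ne_zero)
    simp only [h1] at h2
    have h3 := star_injective (mul_left_cancel₀ (mul_ne_zero hne c'.rep_fst_ne_zero) h2)
    rw [h3] at h1
    exact SplitOct.ext' (mul_left_cancel₀ hne h1) h3
  surjective q x hq hx hx0 := by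
    have hr : (star q * x * q).re = 0 := by
      have := re_conj (q := star q) hx0
      rwa [star_star] at this
    -- From hv = q and h v h̄ = x one gets q h̄ = x, so h = x̄q and v = h̄q = q̄xq.
    refine ⟨ofUnit (star q * x * q) (star x * q) hr
      (by rw [norm_mul, norm_mul, norm_star, hx, hq, mul_one, mul_one])
      (by rw [norm_mul, norm_star, hx, hq, mul_one]), ?_, ?_⟩
    · rw [rep_ofUnit, pr_fst, pr_snd]
      simp only [mul_assoc, quat_mul_star_cancel hq, quat_star_mul_cancel hx]
    · rw [rep_ofUnit, pr_fst, pr_snd, star_mul, star_star]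
      simp only [mul_assoc, quat_mul_star_cancel hq, quat_star_mul_cancel hx]
  immersion c w h1 h2 := by
    have hne : c.rep.2 ≠ 0 := norm_ne_zero_iff.1 (by rw [norm_rep_snd]; exact one_ne_zero)
    simp only [h1, zero_mul, zero_add] at h2
    have h3 := star_eq_zero.1 ((mul_eq_zero.1 h2).resolve_left
      (mul_ne_zero hne c.rep_fst_ne_zero))
    rw [h3, zero_mul, zero_add] at h1
    exact SplitOct.ext' ((mul_eq_zero.1 h1).resolve_left hne) h3
  push_le c b hb0 hb := by
    -- The angular velocity is that of the other model, 4vb, conjugated by h.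
    refine ⟨(4 : ℝ) • (c.rep.2 * (c.rep.1 * b) * star c.rep.2), ?_, ?_,
      planeVec_deriv_mul_eq hb, planeVec_deriv_conj_eq hb0 hb h⟩
    · rw [Quaternion.re_smul, re_conj (re_mul_eq_zero_of_anticomm hb), smul_zero]
    · rw [smul_mul_assoc, mul_smul_comm, ← smul_neg]
      congr 1
      simp only [mul_assoc, quat_star_mul_cancel c.norm_rep_snd]
      rw [← mul_assoc b, hb]
      simp only [mul_assoc, neg_mul, mul_neg]
  push_ge c u hu0 hu := by
    have hh := c.norm_rep_snd
    have hu' : (star c.rep.2 * u * c.rep.2) * c.rep.1 =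
        -(c.rep.1 * (star c.rep.2 * u * c.rep.2)) := by
      have := congrArg (fun z => star c.rep.2 * z * c.rep.2) hu
      simp only [mul_neg, neg_mul, mul_assoc, quat_star_mul_cancel hh, quat_star_mul hh,
        mul_one] at this
      simpa only [mul_assoc] using this
    have hb : (-(4⁻¹ : ℝ)) • (c.rep.1 * (star c.rep.2 * u * c.rep.2)) * c.rep.1 =
        -(c.rep.1 * (-(4⁻¹ : ℝ)) • (c.rep.1 * (star c.rep.2 * u * c.rep.2))) := by
      rw [smul_mul_assoc, mul_smul_comm, mul_anticomm hu', smul_neg]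
    have hb0 : ((-(4⁻¹ : ℝ)) • (c.rep.1 * (star c.rep.2 * u * c.rep.2))).re = 0 := by
      rw [Quaternion.re_smul, re_mul_eq_zero_of_anticomm hu', smul_zero]
    have e : (4 : ℝ) • (c.rep.2 * (c.rep.1 * (-(4⁻¹ : ℝ)) •
        (c.rep.1 * (star c.rep.2 * u * c.rep.2))) * star c.rep.2) = u := by
      rw [mul_smul_comm, ← mul_assoc c.rep.1, c.rep_fst_mul_self, neg_one_mul, mul_smul_comm,
        smul_mul_assoc, smul_smul, mul_neg, mul_neg, neg_mul]
      simp only [mul_assoc, quat_mul_star_cancel hh, quat_mul_star hh, mul_one]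
      norm_num
    have h1 := planeVec_deriv_mul_eq hb
    have h2 := planeVec_deriv_conj_eq hb0 hb h
    rw [e] at h1 h2
    exact ⟨_, hb, h1, h2⟩

end

theorem mainTheorem2 :
    ∃ (_ : ChartedSpace E5 NullRay) (_ : IsManifold 𝓘(ℝ, E5) ∞ NullRay),
      -- the smooth structure of `C` is that of a submanifold of the space of rays
      IsRaySubmanifold ∧
      -- `G₂` is a closed linear group with Lie algebra `𝔤₂`, and `C` is a homogeneous space of it
      IsClosed (G2 : Set (SplitOct →L[ℝ] SplitOct)ˣ) ∧
      lieAlg ⊤ = (g2 : Set (SplitOct →L[ℝ] SplitOct)) ∧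
      ContinuousSMul G2 NullRay ∧
      (∀ g : G2, ContMDiff 𝓘(ℝ, E5) 𝓘(ℝ, E5) ∞ (fun c : NullRay => g • c)) ∧
      MulAction.IsPretransitive G2 NullRay ∧
      -- `C` is diffeomorphic to `S³ × S²`
      Nonempty (NullRay ≃ₘ⟮𝓘(ℝ, E5), (𝓡 3).prod (𝓡 2)⟯ (S3 × S2)) ∧
      -- the subspaces `x⁰` define a `G₂`-invariant distribution of rank two
      IsDistribution 2 (octDist : ∀ c : NullRay, Submodule ℝ (TangentSpace 𝓘(ℝ, E5) c)) ∧
      (∀ (g : G2) (c : NullRay), Submodule.map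
        (mfderiv 𝓘(ℝ, E5) 𝓘(ℝ, E5) (fun c : NullRay => g • c) c : E5 →L[ℝ] E5).toLinearMap
          (octDist c) = octDist (g • c)) ∧
      -- `K` is a maximal compact subgroup of `G₂`, doubly covered by `SU(2) × SU(2)`,
      -- and `C` is a homogeneous space of it
      IsMaximalCompact maxK ∧
      (∀ q, quatHom q = 1 ↔ q = 1 ∨ ((q.1 : ℍ[ℝ]) = -1 ∧ (q.2 : ℍ[ℝ]) = -1)) ∧
      MulAction.IsPretransitive maxK NullRay ∧
      (∃ c₀ : NullRay,
        -- the data of `G₂`-homogeneous distribution are `(G₂, P, W)`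
        (∃ (H : LieSubalgebra ℝ g2) (σ l : Fin 3 → Module.Dual ℝ H), IsG2Diagram H σ l ∧
          (∀ ξ : g2, (ξ : SplitOct →L[ℝ] SplitOct) ∈ isotropyAlg ⊤ c₀ ↔ ξ ∈ parabolic H σ l) ∧
          MulAction.stabilizer G2 c₀ = Subgroup.closure
            {g : G2 | ∃ ξ ∈ parabolic H σ l,
              G2.toEnd g = NormedSpace.exp (ξ : SplitOct →L[ℝ] SplitOct)} ∧
          (∀ ξ : g2, (ξ : SplitOct →L[ℝ] SplitOct) ∈ distAlg ⊤ octDist c₀ ↔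
            ξ ∈ planeW H σ l)) ∧
        -- the data of `K`-homogeneous distribution are those of rolling, for the ratios 3:1, 1:3
        (∀ R r : ℝ, 0 < R → 0 < r → (R = 3 * r ∨ r = 3 * R) →
          HasRollingData octDist c₀ R r)) ∧
      -- the distribution pushes down to the rolling distribution under a two-to-one cover
      (∀ R r : ℝ, 0 < R → 0 < r → R = 3 * r → ∃ π, IsRollingCover octDist R r id π) ∧
      (∀ R r : ℝ, 0 < R → 0 < r → r = 3 * R → ∃ π, IsRollingCover octDist R r Prod.swap π) :=
  ⟨NullRay.chartedSpace, NullRay.isManifold, NullRay.isRaySubmanifold, isClosed_G2, lieAlg_top,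
    inferInstance, NullRay.contMDiff_smul, isPretransitive_G2, ⟨NullRay.diffeo⟩,
    NullRay.isDistribution_octDist, NullRay.map_mfderiv_smul_octDist, isMaximalCompact_maxK,
    quatHom_eq_one, isPretransitive_maxK,
    ⟨baseRay, ⟨torus, shortRoot, longRoot, isG2Diagram, mem_isotropyAlg_base, stabilizer_base,
      mem_distAlg_top_base⟩, fun _ _ hR hr h => hasRollingData hR hr h⟩,
    fun _ _ hR hr h => ⟨_, (isRollingModel_three h).isRollingCover (add_pos hR hr).ne'⟩,
    fun _ _ hR hr h => ⟨_, (isRollingModel_third h).isRollingCover (add_pos hR hr).ne'⟩⟩
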